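/- Neural networks. A network $\Phi$ of depth $L\ge 1$ with input dimension $N_0$ is a sequence of layers $(A_\ell,b_\ell,\varrho_\ell)$, $\ell=1,\dots,L$, with $A_\ell\in\mathbb R^{N_\ell\times N_{\ell-1}}$, $b_\ell\in\mathbb R^{N_\ell}$ and a list $\varrho_\ell$ of $N_\ell$ activation functions acting componentwise, $\varrho_L=\mathrm{Id}$. Its realization is $\mathrm R(\Phi)(x)=x_L$, where $x_0=x$, $x_\ell=\varrho_\ell(A_\ell x_{\ell-1}+b_\ell)$; $L(\Phi)=L$ is its depth, and its size $M(\Phi)$ is the total number of nonzero entries of all $A_\ell,b_\ell$. It is a (strict) ReLU network if all hidden activations are $x\mapsto\max\{0,x\}$. Setting. Let $d\ge 1$, $I=(0,T)$ with $T>0$, let $G\subset\mathbb R^d$ be a bounded polytopal domain (nonempty, open, connected, equal to the interior of its closure, the closure being a finite union of convex polytopes), and let $D=I\times G\subset\mathbb R^{1+d}$. Let $\mathcal T$ be a regular simplicial triangulation of $D$: a finite set of closed $(d+1)$-simplices with union $\overline D$ and pairwise disjoint interiors, any two distinct ones having as intersection a common subsimplex or the empty set. Let $\mathcal V$ be its set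 of vertices and, for $p\in\mathcal V$, let $s(p)=\#\{K\in\mathcal T: p\in K\}$. Let $S_1(\mathcal T)$ be the space of continuous functions on $\overline D$ that are affine on each $K\in\mathcal T$, with nodal shape functions $\theta_p$, $p\in\mathcal V$ ($\theta_p(p)=1$ and $\theta_p(q)=0$ for all other vertices $q$). Put $m=d+1$ and $$\mathbb V=\bigl(S_1(\mathcal T)\cap L^2(I;H^1_0(G))\bigr)\times S_1(\mathcal T)^d,$$ $\mathcal I_1=\mathcal V\cap(\overline I\times G)$, $\mathcal I_2=\dots=\mathcal I_m=\mathcal V$, $\mathcal I=\bigcup_{k=1}^m\mathcal I_k\times\{k\}$, and, for $i=(p,k)\in\mathcal I$, $\theta_i=\theta_p$ and $s(i)=s(p)$. Let $\mathfrak s=\max_{i\in\mathcal I}s(i)$. Claim. There are constants $C,C'>0$ independent of $d$, $T$, $G$ and $\mathcal T$ such that in every such setting $|\mathcal I|=\dim\mathbb V$ and the following hold. 1. There is a strict ReLU network $\Phi$ with input dimension $d+1$ and output dimension $|\mathcal I|$ (its outputs being indexed by an enumeration of $\mathcal I$) such that $\mathrm R(\Phi)_i(x)=\theta_i(x)$ for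 all $x\in D$ and all $i\in\mathcal I$, and $$L(\Phi)\le 8+\log_2\mathfrak s+\log_2(d+1),\qquad M(\Phi)\le C|\mathcal I|\log_2\mathfrak s+Cd^2\sum_{i\in\mathcal I}s(i)\le C'd^2\,\mathfrak s\,\dim\mathbb V.$$ 2. For every $v=(v_{(1)},\dots,v_{(m)})\in\mathbb V$ there is a strict ReLU network $\Phi^v$ with input and output dimension $d+1$ such that $\mathrm R(\Phi^v)_k(x)=v_{(k)}(x)$ for all $x\in D$ and $k=1,\dots,m$, with the same bounds for $L(\Phi^v)$ and $M(\Phi^v)$. 3. The layer dimensions and the lists of activation functions of $\Phi$ and of $\Phi^v$ do not depend on $v$; besides $d$, they depend only on the family $\{s(i)\}_{i\in\mathcal I}$ (in particular on its cardinality $|\mathcal I|$), as a multiset. 4. The set $\{\Phi^v:v\in\mathbb V\}$ with the linear operation $\Phi^v\mathbin{\widehat+}\lambda\Phi^w:=\Phi^{v+\lambda w}$, $v,w\in\mathbb V$, $\lambda\in\mathbb R$, is a real vector space, and the realization map $\Phi^v\mapsto \mathrm R(\Phi^v)|_D$ is a linear bijection from it onto $\mathbb V$ (elements of $\mathbb V$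 being identified with their restrictions to $D$). -/

import Mathlib

open scoped ContDiff
open MeasureTheory Filter Topology

noncomputable section

namespace FoSLS

/-! ### Neural networks -/

/-- A feedforward network with input dimension `m` and output dimension `n`, given by its layers
`(A_ℓ, b_ℓ, ϱ_ℓ)`. In a hidden layer every node carries its own activation function; in the
output layer the activation is the identity. There is at least one layer. -/
inductive NN : ℕ → ℕ → Type
  | output {m n : ℕ} (A : Matrix (Fin n) (Fin m) ℝ) (b : Fin n → ℝ) : NN m n
  | hidden {m k n : ℕ} (A : Matrix (Fin k) (Fin m) ℝ) (b : Fin k → ℝ) (ϱ : Fin k → ℝ → ℝ)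
      (Φ : NN k n) : NN m n

/-- The ReLU activation function. -/
def relu (x : ℝ) : ℝ := max 0 x

namespace NN

/-- The realization `x ↦ x_L`, `x_ℓ = ϱ_ℓ (A_ℓ x_{ℓ-1} + b_ℓ)`. -/
def realize : {m n : ℕ} → NN m n → (Fin m → ℝ) → (Fin n → ℝ)
  | _, _, output A b, x => A.mulVec x + b
  | _, _, hidden A b ϱ Φ, x => Φ.realize (fun i => ϱ i ((A.mulVec x + b) i))

/-- The number of layers, the output layer included. -/
def depth : {m n : ℕ} → NN m n → ℕ
  | _, _, output _ _ => 1
  | _, _, hidden _ _ _ Φ => Φ.depth + 1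

/-- The number of nonzero entries of a weight matrix and a bias vector. -/
def layerSize {m n : ℕ} (A : Matrix (Fin n) (Fin m) ℝ) (b : Fin n → ℝ) : ℕ :=
  {p : Fin n × Fin m | A p.1 p.2 ≠ 0}.ncard + {i : Fin n | b i ≠ 0}.ncard

/-- The number of nonzero weights and biases in all layers. -/
def size : {m n : ℕ} → NN m n → ℕ
  | _, _, output A b => layerSize A b
  | _, _, hidden A b _ Φ => layerSize A b + Φ.size

/-- All hidden activations are ReLU. -/
def IsReLU : {m n : ℕ} → NN m n → Prop
  | _, _, output _ _ => True
  | _, _, hidden _ _ ϱ Φ => (∀ i, ϱ i = relu) ∧ Φ.IsReLU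

/-- The lists of activation functions of the layers `1, …, L`; the length of the `ℓ`-th list is
the dimension of layer `ℓ`. -/
def architecture : {m n : ℕ} → NN m n → List (List (ℝ → ℝ))
  | _, n, output _ _ => [List.replicate n id]
  | _, _, hidden _ _ ϱ Φ => List.ofFn ϱ :: Φ.architecture

end NN

/-! ### Domains and triangulations -/

/-- A bounded polytopal domain: nonempty, open, connected, bounded, lying nowhere on both sides
of its boundary, with closure a finite union of convex polytopes. -/
structure IsPolytopalDomain {n : ℕ} (G : Set (Fin n → ℝ)) : Prop where
  isOpen : IsOpen G
  isConnected : IsConnected G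
  isBounded : Bornology.IsBounded G
  interior_closure : interior (closure G) = G
  polytopal : ∃ P : Finset (Finset (Fin n → ℝ)),
    closure G = ⋃ Q ∈ P, convexHull ℝ (Q : Set (Fin n → ℝ))

/-- The space-time cylinder `(0, T) × G`; the coordinate `0` is time. -/
def stCylinder {d : ℕ} (T : ℝ) (G : Set (Fin d → ℝ)) : Set (Fin (d + 1) → ℝ) :=
  {x | x 0 ∈ Set.Ioo 0 T ∧ Fin.tail x ∈ G}

/-- A regular simplicial triangulation of `D ⊆ ℝⁿ`. An element `σ` of `𝒯` is the vertex set of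
the closed `n`-simplex `convexHull ℝ σ`. Two different simplices meet in a common subsimplex,
which is necessarily the one spanned by their common vertices (and may be empty). -/
structure IsRegularTriangulation {n : ℕ} (𝒯 : Finset (Finset (Fin n → ℝ)))
    (D : Set (Fin n → ℝ)) : Prop where
  card_eq : ∀ σ ∈ 𝒯, σ.card = n + 1
  affineIndependent : ∀ σ ∈ 𝒯, AffineIndependent ℝ ((↑) : σ → (Fin n → ℝ))
  closure_eq : closure D = ⋃ σ ∈ 𝒯, convexHull ℝ (σ : Set (Fin n → ℝ))
  interior_disjoint : ∀ σ ∈ 𝒯, ∀ τ ∈ 𝒯, σ ≠ τ →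
    Disjoint (interior (convexHull ℝ (σ : Set (Fin n → ℝ))))
      (interior (convexHull ℝ (τ : Set (Fin n → ℝ))))
  inter_eq : ∀ σ ∈ 𝒯, ∀ τ ∈ 𝒯, σ ≠ τ →
    convexHull ℝ (σ : Set (Fin n → ℝ)) ∩ convexHull ℝ (τ : Set (Fin n → ℝ)) =
      convexHull ℝ ((σ : Set (Fin n → ℝ)) ∩ (τ : Set (Fin n → ℝ)))

/-- The set of vertices of a triangulation. -/
def vertices {n : ℕ} (𝒯 : Finset (Finset (Fin n → ℝ))) : Finset (Fin n → ℝ) := by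
  classical exact 𝒯.biUnion id

/-- The number of elements of the triangulation that contain the point `p`. -/
def numSharing {n : ℕ} (𝒯 : Finset (Finset (Fin n → ℝ))) (p : Fin n → ℝ) : ℕ := by
  classical exact (𝒯.filter fun σ => p ∈ convexHull ℝ (σ : Set (Fin n → ℝ))).card

/-! ### Continuous piecewise linear functions -/

/-- `S₁(𝒯)` on `X` (the closure of the domain): continuous functions that are affine on every
simplex. -/
def S1 {n : ℕ} (𝒯 : Finset (Finset (Fin n → ℝ))) (X : Set (Fin n → ℝ)) :
    Submodule ℝ (X → ℝ) where
  carrier := {u | Continuous u ∧ ∀ σ ∈ 𝒯, ∃ f : (Fin n → ℝ) →ᵃ[ℝ] ℝ,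
    ∀ x : X, (x : Fin n → ℝ) ∈ convexHull ℝ (σ : Set (Fin n → ℝ)) → u x = f x}
  zero_mem' := ⟨continuous_const, fun _ _ => ⟨0, fun _ _ => rfl⟩⟩
  add_mem' := by
    rintro u v ⟨hu, hu'⟩ ⟨hv, hv'⟩
    refine ⟨hu.add hv, fun σ hσ => ?_⟩
    obtain ⟨f, hf⟩ := hu' σ hσ
    obtain ⟨g, hg⟩ := hv' σ hσ
    exact ⟨f + g, fun x hx => by simp [hf x hx, hg x hx]⟩
  smul_mem' := by
    rintro c u ⟨hu, hu'⟩
    refine ⟨hu.const_smul c, fun σ hσ => ?_⟩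
    obtain ⟨f, hf⟩ := hu' σ hσ
    exact ⟨c • f, fun x hx => by simp [hf x hx]⟩

/-- `w` is the family of barycentric coordinates of `x` in the simplex with vertex set `σ`,
extended by `0` to all other points. -/
structure IsBarycentric {n : ℕ} (σ : Finset (Fin n → ℝ)) (x : Fin n → ℝ)
    (w : (Fin n → ℝ) → ℝ) : Prop where
  nonneg : ∀ p, 0 ≤ w p
  eq_zero : ∀ p, p ∉ σ → w p = 0
  sum_eq_one : ∑ p ∈ σ, w p = 1
  sum_smul_eq : ∑ p ∈ σ, w p • p = x

open Classical in
/-- The nodal shape function ("hat function") of the vertex `p`: at a point `x` of the closed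
domain it is the `p`-th barycentric coordinate of `x` in a simplex that contains `x`, which does
not depend on the simplex when the triangulation is regular. -/
def hat {n : ℕ} (𝒯 : Finset (Finset (Fin n → ℝ))) (p x : Fin n → ℝ) : ℝ :=
  if h : ∃ w, ∃ σ ∈ 𝒯, IsBarycentric σ x w then h.choose p else 0

/-! ### The spaces `H¹₀(G)` and `L²(I; H¹₀(G))` -/

/-- `u ∈ H¹₀(G)` with weak gradient `g`: the pair `(u, g)` is the limit in `L²(G) × L²(G)ⁿ` of
`(φ_m, ∇φ_m)` with test functions `φ_m ∈ C_c^∞(G)`. -/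
structure IsH10 {n : ℕ} (G : Set (Fin n → ℝ)) (u : (Fin n → ℝ) → ℝ)
    (g : Fin n → (Fin n → ℝ) → ℝ) : Prop where
  memLp : MemLp u 2 (volume.restrict G)
  memLp_grad : ∀ j, MemLp (g j) 2 (volume.restrict G)
  exists_seq : ∃ φ : ℕ → (Fin n → ℝ) → ℝ,
    (∀ m, ContDiff ℝ ∞ (φ m) ∧ HasCompactSupport (φ m) ∧ tsupport (φ m) ⊆ G) ∧
    Tendsto (fun m => eLpNorm (φ m - u) 2 (volume.restrict G)) atTop (𝓝 0) ∧
    ∀ j, Tendsto (fun m => eLpNorm ((fun y => fderiv ℝ (φ m) y (Pi.single j 1)) - g j) 2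
      (volume.restrict G)) atTop (𝓝 0)

/-- Functions in `L²(I; H¹₀(G))`, `I = (0, T)`: `u` and its spatial weak gradient are square
integrable on `I × G`, and `u(t, ·) ∈ H¹₀(G)` for almost every `t ∈ I`. -/
def MemL2H10 {n : ℕ} (T : ℝ) (G : Set (Fin n → ℝ)) (u : ℝ → (Fin n → ℝ) → ℝ) : Prop :=
  MemLp (Function.uncurry u) 2
      ((volume.restrict (Set.Ioo 0 T)).prod (volume.restrict G)) ∧
    ∃ g : Fin n → ℝ → (Fin n → ℝ) → ℝ,
      (∀ j, MemLp (Function.uncurry (g j)) 2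
        ((volume.restrict (Set.Ioo 0 T)).prod (volume.restrict G))) ∧
      ∀ᵐ t ∂(volume.restrict (Set.Ioo 0 T)), IsH10 G (u t) (fun j => g j t)

theorem tendsto_eLpNorm_add {α : Type*} [MeasurableSpace α] {μ : Measure α}
    {f f' : ℕ → α → ℝ} {u u' : α → ℝ}
    (hf : ∀ m, AEStronglyMeasurable (f m - u) μ) (hf' : ∀ m, AEStronglyMeasurable (f' m - u') μ)
    (h : Tendsto (fun m => eLpNorm (f m - u) 2 μ) atTop (𝓝 0))
    (h' : Tendsto (fun m => eLpNorm (f' m - u') 2 μ) atTop (𝓝 0)) :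
    Tendsto (fun m => eLpNorm (f m + f' m - (u + u')) 2 μ) atTop (𝓝 0) := by
  have hs := h.add h'
  rw [add_zero] at hs
  refine tendsto_of_tendsto_of_tendsto_of_le_of_le tendsto_const_nhds hs (fun _ => zero_le)
    fun m => ?_
  have e : f m + f' m - (u + u') = (f m - u) + (f' m - u') := by abel
  simp only [e]
  exact eLpNorm_add_le (hf m) (hf' m) (by norm_num)

theorem tendsto_eLpNorm_smul {α : Type*} [MeasurableSpace α] {μ : Measure α}
    {f : ℕ → α → ℝ} {u : α → ℝ} (c : ℝ)
    (h : Tendsto (fun m => eLpNorm (f m - u) 2 μ) atTop (𝓝 0)) :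
    Tendsto (fun m => eLpNorm (c • f m - c • u) 2 μ) atTop (𝓝 0) := by
  have e : (fun m => eLpNorm (c • f m - c • u) 2 μ) =
      fun m => ‖c‖ₑ * eLpNorm (f m - u) 2 μ := by
    funext m
    rw [← smul_sub, eLpNorm_const_smul]
  rw [e]
  simpa using ENNReal.Tendsto.const_mul h (Or.inr (by simp))

theorem IsH10.add {n : ℕ} {G : Set (Fin n → ℝ)} {u u' : (Fin n → ℝ) → ℝ}
    {g g' : Fin n → (Fin n → ℝ) → ℝ} (h : IsH10 G u g) (h' : IsH10 G u' g') :
    IsH10 G (u + u') (fun j => g j + g' j) := by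
  obtain ⟨φ, hφ, h1, h2⟩ := h.exists_seq
  obtain ⟨ψ, hψ, k1, k2⟩ := h'.exists_seq
  have md : ∀ {χ : (Fin n → ℝ) → ℝ}, ContDiff ℝ ∞ χ → ∀ j : Fin n,
      AEStronglyMeasurable (fun y => fderiv ℝ χ y (Pi.single j 1)) (volume.restrict G) :=
    fun hχ j => ((hχ.continuous_fderiv (by simp)).clm_apply
      continuous_const).aestronglyMeasurable
  refine ⟨h.memLp.add h'.memLp, fun j => (h.memLp_grad j).add (h'.memLp_grad j),
    fun m => φ m + ψ m, fun m => ⟨(hφ m).1.add (hψ m).1, (hφ m).2.1.add (hψ m).2.1, ?_⟩, ?_, ?_⟩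
  · exact (tsupport_add _ _).trans (Set.union_subset (hφ m).2.2 (hψ m).2.2)
  · exact tendsto_eLpNorm_add
      (fun m => (hφ m).1.continuous.aestronglyMeasurable.sub h.memLp.1)
      (fun m => (hψ m).1.continuous.aestronglyMeasurable.sub h'.memLp.1) h1 k1
  · intro j
    have e : ∀ m, (fun y => fderiv ℝ (φ m + ψ m) y (Pi.single j 1)) =
        (fun y => fderiv ℝ (φ m) y (Pi.single j 1)) +
          fun y => fderiv ℝ (ψ m) y (Pi.single j 1) := by
      intro m
      funext y
      rw [fderiv_add ((hφ m).1.differentiable (by simp) y)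
        ((hψ m).1.differentiable (by simp) y)]
      rfl
    simp only [e]
    exact tendsto_eLpNorm_add (fun m => (md (hφ m).1 j).sub (h.memLp_grad j).1)
      (fun m => (md (hψ m).1 j).sub (h'.memLp_grad j).1) (h2 j) (k2 j)

theorem IsH10.smul {n : ℕ} {G : Set (Fin n → ℝ)} {u : (Fin n → ℝ) → ℝ}
    {g : Fin n → (Fin n → ℝ) → ℝ} (c : ℝ) (h : IsH10 G u g) :
    IsH10 G (c • u) (fun j => c • g j) := by
  obtain ⟨φ, hφ, h1, h2⟩ := h.exists_seq
  refine ⟨h.memLp.const_smul c, fun j => (h.memLp_grad j).const_smul c,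
    fun m => c • φ m, fun m => ⟨(hφ m).1.const_smul c, ?_, ?_⟩, ?_, ?_⟩
  · exact (hφ m).2.1.smul_left (f := fun _ => c)
  · exact (tsupport_smul_subset_right (fun _ => c) _).trans (hφ m).2.2
  · exact tendsto_eLpNorm_smul c h1
  · intro j
    have e : ∀ m, (fun y => fderiv ℝ (c • φ m) y (Pi.single j 1)) =
        c • fun y => fderiv ℝ (φ m) y (Pi.single j 1) := by
      intro m
      funext y
      rw [fderiv_const_smul ((hφ m).1.differentiable (by simp) y)]
      rfl
    simp only [e]
    exact tendsto_eLpNorm_smul c (h2 j)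

theorem IsH10.zero {n : ℕ} {G : Set (Fin n → ℝ)} :
    IsH10 G (0 : (Fin n → ℝ) → ℝ) (fun _ => 0) := by
  refine ⟨MemLp.zero, fun _ => MemLp.zero, fun _ => 0,
    fun _ => ⟨contDiff_const, HasCompactSupport.zero, by simp [tsupport]⟩, ?_, fun j => ?_⟩
  · simp
  · have e : (fun y : Fin n → ℝ =>
        fderiv ℝ (0 : (Fin n → ℝ) → ℝ) y (Pi.single j 1)) - 0 = 0 := by
      funext y
      simp
    simp only [e, eLpNorm_zero]
    exact tendsto_const_nhds

/-- `L²(I; H¹₀(G))` as a linear space of functions `u(t, y)`. -/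
def L2H10 {n : ℕ} (T : ℝ) (G : Set (Fin n → ℝ)) : Submodule ℝ (ℝ → (Fin n → ℝ) → ℝ) where
  carrier := {u | MemL2H10 T G u}
  zero_mem' := ⟨MemLp.zero, fun _ => 0, fun _ => MemLp.zero, ae_of_all _ fun _ => IsH10.zero⟩
  add_mem' := by
    rintro u v ⟨hu, g, hg, hug⟩ ⟨hv, k, hk, hvk⟩
    refine ⟨hu.add hv, fun j => g j + k j, fun j => (hg j).add (hk j), ?_⟩
    filter_upwards [hug, hvk] with t ht ht'
    exact ht.add ht'
  smul_mem' := by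
    rintro c u ⟨hu, g, hg, hug⟩
    refine ⟨hu.const_smul c, fun j => c • g j, fun j => (hg j).const_smul c, ?_⟩
    filter_upwards [hug] with t ht
    exact ht.smul c

/-- A function on `X ⊆ ℝ^{1+d}`, extended by zero, as a function of time and space. -/
def asTimeSpace {d : ℕ} (X : Set (Fin (d + 1) → ℝ)) :
    (X → ℝ) →ₗ[ℝ] (ℝ → (Fin d → ℝ) → ℝ) where
  toFun u t y := Function.extend ((↑) : X → Fin (d + 1) → ℝ) u 0 (Fin.cons t y)
  map_add' u v := by
    funext t y
    by_cases h : (Fin.cons t y : Fin (d + 1) → ℝ) ∈ X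
    · simp only [Pi.add_apply]
      have := fun w : X → ℝ => Subtype.val_injective.extend_apply w (0 : (Fin (d + 1) → ℝ) → ℝ)
        (⟨Fin.cons t y, h⟩ : X)
      simp only at this
      rw [this, this, this]
      rfl
    · have h' : ¬ ∃ a : X, (a : Fin (d + 1) → ℝ) = Fin.cons t y := by
        rintro ⟨a, ha⟩
        exact h (ha ▸ a.2)
      simp [Function.extend_apply' _ _ _ h']
  map_smul' c u := by
    funext t y
    by_cases h : (Fin.cons t y : Fin (d + 1) → ℝ) ∈ X
    · simp only [Pi.smul_apply, RingHom.id_apply]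
      have := fun w : X → ℝ => Subtype.val_injective.extend_apply w (0 : (Fin (d + 1) → ℝ) → ℝ)
        (⟨Fin.cons t y, h⟩ : X)
      simp only at this
      rw [this, this]
      rfl
    · have h' : ¬ ∃ a : X, (a : Fin (d + 1) → ℝ) = Fin.cons t y := by
        rintro ⟨a, ha⟩
        exact h (ha ▸ a.2)
      simp [Function.extend_apply' _ _ _ h']

/-! ### The space-time finite element space -/

/-- `(S₁(𝒯) ∩ L²(I; H¹₀(G))) × S₁(𝒯)^d`, with components indexed by `0, …, d`. -/
def V4 {d : ℕ} (T : ℝ) (G : Set (Fin d → ℝ)) (𝒯 : Finset (Finset (Fin (d + 1) → ℝ))) :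
    Submodule ℝ (Fin (d + 1) → closure (stCylinder T G) → ℝ) :=
  Submodule.pi Set.univ fun k =>
    if k = 0 then
      S1 𝒯 (closure (stCylinder T G)) ⊓ (L2H10 T G).comap (asTimeSpace (closure (stCylinder T G)))
    else S1 𝒯 (closure (stCylinder T G))

/-- The index set of the shape functions: pairs `(p, k)` of a vertex and a component; for the
component `k = 0` only the vertices in `[0, T] × G`. -/
def idx {d : ℕ} (T : ℝ) (G : Set (Fin d → ℝ)) (𝒯 : Finset (Finset (Fin (d + 1) → ℝ))) :
    Finset ((Fin (d + 1) → ℝ) × Fin (d + 1)) := by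
  classical exact (vertices 𝒯 ×ˢ Finset.univ).filter fun i =>
    i.2 = 0 → i.1 0 ∈ Set.Icc 0 T ∧ Fin.tail i.1 ∈ G

/-- `max_{i ∈ ℐ} s(i)`. -/
def maxSharing {d : ℕ} (T : ℝ) (G : Set (Fin d → ℝ))
    (𝒯 : Finset (Finset (Fin (d + 1) → ℝ))) : ℕ :=
  (idx T G 𝒯).sup fun i => numSharing 𝒯 i.1

/-- `∑_{i ∈ ℐ} s(i)`. -/
def sumSharing {d : ℕ} (T : ℝ) (G : Set (Fin d → ℝ))
    (𝒯 : Finset (Finset (Fin (d + 1) → ℝ))) : ℕ :=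
  ∑ i ∈ idx T G 𝒯, numSharing 𝒯 i.1

/-- The family `{s(i)}_{i ∈ ℐ}`, as a multiset with `|ℐ|` entries. -/
def sharingData {d : ℕ} (T : ℝ) (G : Set (Fin d → ℝ))
    (𝒯 : Finset (Finset (Fin (d + 1) → ℝ))) : Multiset ℕ :=
  (idx T G 𝒯).val.map fun i => numSharing 𝒯 i.1

/-- The depth bound `8 + log₂ (max s(i)) + log₂ (d + 1)`. -/
def depthBound {d : ℕ} (T : ℝ) (G : Set (Fin d → ℝ))
    (𝒯 : Finset (Finset (Fin (d + 1) → ℝ))) : ℝ :=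
  8 + Real.logb 2 (maxSharing T G 𝒯) + Real.logb 2 ((d : ℝ) + 1)

/-- The size bound `C |ℐ| log₂ (max s(i)) + C d² ∑ s(i)`. -/
def sizeBound {d : ℕ} (C : ℝ) (T : ℝ) (G : Set (Fin d → ℝ))
    (𝒯 : Finset (Finset (Fin (d + 1) → ℝ))) : ℝ :=
  C * (idx T G 𝒯).card * Real.logb 2 (maxSharing T G 𝒯) + C * (d : ℝ) ^ 2 * sumSharing T G 𝒯

end FoSLS

end

open FoSLS

noncomputable section

namespace FoSLS

/-! ### Barycentric coordinates and hat functions -/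

/-! The proof rests on a max-min formula for hat functions that needs no convexity of the patch of
`p`. For a simplex `σ` containing `p`, with barycentric coordinates `λ_q`, take the affine functions
`λ_p` and `λ_p + C λ_q` for the other vertices `q` of `σ`. On `σ` all coordinates are nonnegative,
so their minimum is `λ_p`, the hat function. On any other simplex `τ`, some coordinate `λ_q` of `σ`
with `q ∉ τ` becomes negative as soon as one leaves the common face (`exists_bary_neg`). By
compactness it decreases at least linearly in the weight of the vertices of `τ` outside `σ`, so for
large `C` the minimum stays below the hat function (`eventually_exists_le_hat`). Hence on the closed
domain the hat function is the positive part of the maximum of these minima over the simplices at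
`p` (`exists_relu_iSup_iInf`).

Binary trees of pairwise minima and maxima turn this into a ReLU network. It is built from the
output backwards: `Emulates` describes a network that can still be precomposed with any affine map
with sparse rows, at a cost linear in the row size, and `Emulates.max` prepends one level. Only the
first layer is dense, with rows of at most `d + 2` entries, which gives `d² ∑ s(i)`. All trees of
one kind run in lockstep, so the widths depend only on `d` and the multiset of the `s(i)`. A finite
element function uses the same hidden layers, with nodal values as output weights; each index feeds
one output, so the size bound is unchanged.

The dimension formula says that a function of `S₁` lies in `L²(I; H¹₀(G))` exactly if it vanishes at
the vertices over the boundary of `G`. For necessity, `G` equals the interior of its closure, so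
every boundary point has exterior balls nearby, where test functions vanish. A function that is at
least `1/2` near the point would force a jump that is incompatible with bounded gradients
(`volume_le_of_jump`). For sufficiency, a lateral boundary point gets positive weight only from
vertices over the boundary (`mem_of_bary_pos`), so the function vanishes laterally. It is Lipschitz,
being realized by a ReLU network, and its slices lie in `H¹₀(G)` by soft thresholding and
mollification (`isH10_of_lipschitz`); the boundary of `G` needs no regularity for this.

Finally, the realization determines `v` because the cylinder is dense in its closure, so the linear
structure can be transported to the set of networks. -/

/-- The vertex set of a nondegenerate `n`-simplex in `ℝⁿ`. -/
structure IsSimplex {n : ℕ} (σ : Finset (Fin n → ℝ)) : Prop where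
  card_eq : σ.card = n + 1
  affineIndependent : AffineIndependent ℝ ((↑) : σ → (Fin n → ℝ))

theorem IsRegularTriangulation.isSimplex {n : ℕ} {𝒯 : Finset (Finset (Fin n → ℝ))}
    {D : Set (Fin n → ℝ)} (h : IsRegularTriangulation 𝒯 D) {σ : Finset (Fin n → ℝ)}
    (hσ : σ ∈ 𝒯) : IsSimplex σ :=
  ⟨h.card_eq σ hσ, h.affineIndependent σ hσ⟩

/-- The vertices of a nondegenerate simplex as an affine basis. -/
def IsSimplex.basis {n : ℕ} {σ : Finset (Fin n → ℝ)} (h : IsSimplex σ) :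
    AffineBasis σ ℝ (Fin n → ℝ) where
  toFun := (↑)
  ind' := h.affineIndependent
  tot' := by
    rw [h.affineIndependent.affineSpan_eq_top_iff_card_eq_finrank_add_one]
    simp [h.card_eq]

open Classical in
/-- The barycentric coordinate of the simplex `σ` that belongs to the vertex `p`, as an affine
function on the whole space; it is zero if `p` is not a vertex of `σ`. -/
def bary {n : ℕ} (σ : Finset (Fin n → ℝ)) (p : Fin n → ℝ) : (Fin n → ℝ) →ᵃ[ℝ] ℝ :=
  if h : IsSimplex σ ∧ p ∈ σ then h.1.basis.coord ⟨p, h.2⟩ else 0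

section Barycentric

variable {n : ℕ} {σ τ : Finset (Fin n → ℝ)} {p q x : Fin n → ℝ}

theorem bary_of_notMem (hp : p ∉ σ) : bary σ p = 0 := by
  simp [bary, hp]

namespace IsSimplex

theorem bary_eq_coord (h : IsSimplex σ) (p : σ) : bary σ p = h.basis.coord p := by
  simp [bary, h]

theorem bary_self (h : IsSimplex σ) (hp : p ∈ σ) : bary σ p p = 1 := by
  rw [h.bary_eq_coord ⟨p, hp⟩]
  exact h.basis.coord_apply_eq ⟨p, hp⟩

theorem bary_ne (h : IsSimplex σ) (hq : q ∈ σ) (hpq : p ≠ q) : bary σ p q = 0 := by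
  by_cases hp : p ∈ σ
  · rw [h.bary_eq_coord ⟨p, hp⟩]
    exact h.basis.coord_apply_ne (i := ⟨p, hp⟩) (j := ⟨q, hq⟩) (by simpa using hpq)
  · simp [bary_of_notMem hp]

theorem sum_bary (h : IsSimplex σ) (x : Fin n → ℝ) : ∑ p ∈ σ, bary σ p x = 1 := by
  rw [← Finset.sum_coe_sort]
  simp_rw [h.bary_eq_coord]
  exact h.basis.sum_coord_apply_eq_one x

theorem sum_bary_smul (h : IsSimplex σ) (x : Fin n → ℝ) : ∑ p ∈ σ, bary σ p x • p = x := by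
  rw [← Finset.sum_coe_sort]
  simp_rw [h.bary_eq_coord]
  exact h.basis.linear_combination_coord_eq_self x

end IsSimplex

/-- An affine function of an affine combination. -/
theorem affineMap_sum_smul (f : (Fin n → ℝ) →ᵃ[ℝ] ℝ) (s : Finset (Fin n → ℝ))
    (w : (Fin n → ℝ) → ℝ) (hw : ∑ p ∈ s, w p = 1) :
    f (∑ p ∈ s, w p • p) = ∑ p ∈ s, w p * f p := by
  have e : ∀ x, f x = f.linear x + f 0 := fun x => by
    have := congrFun f.decomp x
    simpa using this
  rw [e, map_sum]
  simp only [map_smul, smul_eq_mul]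
  rw [Finset.sum_congr rfl fun p _ => show w p * f p = w p * f.linear p + w p * f 0 by
    rw [e p, mul_add], Finset.sum_add_distrib, ← Finset.sum_mul, hw, one_mul]

namespace IsSimplex

theorem affineMap_eq (h : IsSimplex σ) (f : (Fin n → ℝ) →ᵃ[ℝ] ℝ) (x : Fin n → ℝ) :
    f x = ∑ p ∈ σ, bary σ p x * f p := by
  conv_lhs => rw [← h.sum_bary_smul x]
  exact affineMap_sum_smul f σ _ (h.sum_bary x)

theorem bary_sum_smul (h : IsSimplex σ) {w : (Fin n → ℝ) → ℝ} (hw : ∑ p ∈ σ, w p = 1)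
    (hp : p ∈ σ) : bary σ p (∑ q ∈ σ, w q • q) = w p := by
  rw [affineMap_sum_smul _ _ _ hw, Finset.sum_eq_single p]
  · rw [h.bary_self hp, mul_one]
  · intro q hq hqp
    rw [h.bary_ne hq hqp.symm, mul_zero]
  · exact fun h => absurd hp h

theorem mem_convexHull_iff (h : IsSimplex σ) :
    x ∈ convexHull ℝ (σ : Set (Fin n → ℝ)) ↔ ∀ p ∈ σ, 0 ≤ bary σ p x := by
  have hr : Set.range h.basis = (σ : Set (Fin n → ℝ)) := by
    change Set.range ((↑) : σ → (Fin n → ℝ)) = _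
    simp
  rw [← hr, h.basis.convexHull_eq_nonneg_coord]
  constructor
  · intro H p hp
    rw [h.bary_eq_coord ⟨p, hp⟩]
    exact H ⟨p, hp⟩
  · intro H p
    rw [← h.bary_eq_coord]
    exact H p p.2

theorem bary_nonneg (h : IsSimplex σ) (hx : x ∈ convexHull ℝ (σ : Set (Fin n → ℝ)))
    (p : Fin n → ℝ) : 0 ≤ bary σ p x := by
  by_cases hp : p ∈ σ
  · exact h.mem_convexHull_iff.1 hx p hp
  · simp [bary_of_notMem hp]

theorem isBarycentric (h : IsSimplex σ) (hx : x ∈ convexHull ℝ (σ : Set (Fin n → ℝ))) :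
    IsBarycentric σ x fun p => bary σ p x :=
  ⟨h.bary_nonneg hx, fun p hp => by simp [bary_of_notMem hp], h.sum_bary x, h.sum_bary_smul x⟩

end IsSimplex

theorem IsBarycentric.eq_bary {w : (Fin n → ℝ) → ℝ} (hw : IsBarycentric σ x w)
    (h : IsSimplex σ) (p : Fin n → ℝ) : w p = bary σ p x := by
  by_cases hp : p ∈ σ
  · rw [← hw.sum_smul_eq, h.bary_sum_smul hw.sum_eq_one hp]
  · rw [hw.eq_zero p hp, bary_of_notMem hp]
    rfl

theorem IsBarycentric.mem_convexHull {w : (Fin n → ℝ) → ℝ} (hw : IsBarycentric σ x w) :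
    x ∈ convexHull ℝ (σ : Set (Fin n → ℝ)) :=
  Finset.mem_convexHull'.2 ⟨w, fun p _ => hw.nonneg p, hw.sum_eq_one, hw.sum_smul_eq⟩

theorem IsBarycentric.mono {w : (Fin n → ℝ) → ℝ} (hw : IsBarycentric σ x w) (h : σ ⊆ τ) :
    IsBarycentric τ x w where
  nonneg := hw.nonneg
  eq_zero p hp := hw.eq_zero p fun h' => hp (h h')
  sum_eq_one := by
    rw [← hw.sum_eq_one]
    exact (Finset.sum_subset h fun p _ hp => hw.eq_zero p hp).symm
  sum_smul_eq := by
    rw [← hw.sum_smul_eq]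
    exact (Finset.sum_subset h fun p _ hp => by rw [hw.eq_zero p hp, zero_smul]).symm

open Classical in
theorem exists_isBarycentric (hx : x ∈ convexHull ℝ (σ : Set (Fin n → ℝ))) :
    ∃ w, IsBarycentric σ x w := by
  obtain ⟨w, h0, h1, h2⟩ := Finset.mem_convexHull'.1 hx
  refine ⟨fun p => if p ∈ σ then w p else 0, fun p => ?_, fun p hp => if_neg hp, ?_, ?_⟩
  · split_ifs with hp
    exacts [h0 p hp, le_rfl]
  · rw [← h1]
    exact Finset.sum_congr rfl fun p hp => if_pos hp
  · rw [← h2]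
    exact Finset.sum_congr rfl fun p hp => by rw [if_pos hp]

namespace IsRegularTriangulation

variable {𝒯 : Finset (Finset (Fin n → ℝ))} {D : Set (Fin n → ℝ)}

open Classical in
theorem exists_common (h : IsRegularTriangulation 𝒯 D) (hσ : σ ∈ 𝒯) (hτ : τ ∈ 𝒯)
    (hxσ : x ∈ convexHull ℝ (σ : Set (Fin n → ℝ)))
    (hxτ : x ∈ convexHull ℝ (τ : Set (Fin n → ℝ))) : ∃ w, IsBarycentric (σ ∩ τ) x w := by
  apply exists_isBarycentric
  by_cases e : σ = τ
  · subst e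
    simpa using hxσ
  · have := h.inter_eq σ hσ τ hτ e
    rw [Finset.coe_inter, ← this]
    exact ⟨hxσ, hxτ⟩

/-- The point lies in the face spanned by the common vertices. Its weights there, extended by zero,
are barycentric in both simplices, and such weights are unique. This makes `hat` independent of the
simplex chosen in its definition. -/
theorem bary_eq (h : IsRegularTriangulation 𝒯 D) (hσ : σ ∈ 𝒯) (hτ : τ ∈ 𝒯)
    (hxσ : x ∈ convexHull ℝ (σ : Set (Fin n → ℝ)))
    (hxτ : x ∈ convexHull ℝ (τ : Set (Fin n → ℝ))) (p : Fin n → ℝ) :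
    bary σ p x = bary τ p x := by
  classical
  obtain ⟨w, hw⟩ := h.exists_common hσ hτ hxσ hxτ
  rw [← (hw.mono Finset.inter_subset_left).eq_bary (h.isSimplex hσ),
    ← (hw.mono Finset.inter_subset_right).eq_bary (h.isSimplex hτ)]

theorem hat_eq_bary (h : IsRegularTriangulation 𝒯 D) (hσ : σ ∈ 𝒯)
    (hx : x ∈ convexHull ℝ (σ : Set (Fin n → ℝ))) (p : Fin n → ℝ) :
    hat 𝒯 p x = bary σ p x := by
  have H : ∃ w, ∃ σ ∈ 𝒯, IsBarycentric σ x w := ⟨_, σ, hσ, (h.isSimplex hσ).isBarycentric hx⟩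
  rw [hat, dif_pos H]
  obtain ⟨τ, hτ, hw⟩ := H.choose_spec
  rw [hw.eq_bary (h.isSimplex hτ)]
  exact h.bary_eq hτ hσ hw.mem_convexHull hx p

theorem exists_mem (h : IsRegularTriangulation 𝒯 D) (hx : x ∈ closure D) :
    ∃ σ ∈ 𝒯, x ∈ convexHull ℝ (σ : Set (Fin n → ℝ)) := by
  rw [h.closure_eq] at hx
  simpa using hx

theorem convexHull_subset (h : IsRegularTriangulation 𝒯 D) (hσ : σ ∈ 𝒯) :
    convexHull ℝ (σ : Set (Fin n → ℝ)) ⊆ closure D := by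
  rw [h.closure_eq]
  exact Set.subset_biUnion_of_mem (u := fun σ : Finset (Fin n → ℝ) =>
    convexHull ℝ (σ : Set (Fin n → ℝ))) hσ

theorem hat_nonneg (h : IsRegularTriangulation 𝒯 D) (hx : x ∈ closure D) (p : Fin n → ℝ) :
    0 ≤ hat 𝒯 p x := by
  obtain ⟨σ, hσ, hxσ⟩ := h.exists_mem hx
  rw [h.hat_eq_bary hσ hxσ]
  exact (h.isSimplex hσ).bary_nonneg hxσ p

end IsRegularTriangulation

theorem mem_vertices {𝒯 : Finset (Finset (Fin n → ℝ))} :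
    p ∈ vertices 𝒯 ↔ ∃ σ ∈ 𝒯, p ∈ σ := by
  simp [vertices]

/-! ### Nodal values, and separation of simplices by facets -/

namespace IsRegularTriangulation

variable {𝒯 : Finset (Finset (Fin n → ℝ))} {D : Set (Fin n → ℝ)}

/-- There are no hanging vertices, so the geometric count `numSharing` is the number of simplices
that have `p` as a vertex. -/
theorem mem_of_mem_convexHull (h : IsRegularTriangulation 𝒯 D) (hp : p ∈ vertices 𝒯)
    (hσ : σ ∈ 𝒯) (hpσ : p ∈ convexHull ℝ (σ : Set (Fin n → ℝ))) : p ∈ σ := by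
  obtain ⟨τ, hτ, hpτ⟩ := mem_vertices.1 hp
  by_contra hc
  have := h.bary_eq hσ hτ hpσ (subset_convexHull ℝ _ hpτ) p
  rw [(h.isSimplex hτ).bary_self hpτ, bary_of_notMem hc] at this
  simp at this

theorem mem_closure_of_mem_vertices (h : IsRegularTriangulation 𝒯 D) (hp : p ∈ vertices 𝒯) :
    p ∈ closure D := by
  obtain ⟨τ, hτ, hpτ⟩ := mem_vertices.1 hp
  exact h.convexHull_subset hτ (subset_convexHull ℝ _ hpτ)

theorem hat_self (h : IsRegularTriangulation 𝒯 D) (hp : p ∈ vertices 𝒯) : hat 𝒯 p p = 1 := by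
  obtain ⟨τ, hτ, hpτ⟩ := mem_vertices.1 hp
  rw [h.hat_eq_bary hτ (subset_convexHull ℝ _ hpτ), (h.isSimplex hτ).bary_self hpτ]

theorem hat_ne (h : IsRegularTriangulation 𝒯 D) (hq : q ∈ vertices 𝒯) (hpq : p ≠ q) :
    hat 𝒯 p q = 0 := by
  obtain ⟨τ, hτ, hqτ⟩ := mem_vertices.1 hq
  rw [h.hat_eq_bary hτ (subset_convexHull ℝ _ hqτ), (h.isSimplex hτ).bary_ne hqτ hpq]

/-- The part of a simplex `τ` that is opposite to the common face with `σ` is separated from `σ`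
by one of the facets of `σ` that contain the common face. -/
theorem exists_bary_neg (h : IsRegularTriangulation 𝒯 D) (hσ : σ ∈ 𝒯) (hτ : τ ∈ 𝒯)
    {z : Fin n → ℝ} (hz : z ∈ convexHull ℝ (τ : Set (Fin n → ℝ)))
    (hz' : ∀ q ∈ σ, bary τ q z = 0) : ∃ q ∈ σ, q ∉ τ ∧ bary σ q z < 0 := by
  classical
  have Hσ := h.isSimplex hσ
  have Hτ := h.isSimplex hτ
  by_contra! hc
  have key : z ∉ convexHull ℝ (σ : Set (Fin n → ℝ)) := by
    intro hzσ
    have h1 := Hσ.sum_bary z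
    rw [Finset.sum_eq_zero] at h1
    · simp at h1
    · intro q hq
      rw [h.bary_eq hσ hτ hzσ hz, hz' q hq]
  rcases (σ ∩ τ).eq_empty_or_nonempty with he | hne
  · apply key
    rw [Hσ.mem_convexHull_iff]
    intro q hq
    refine hc q hq fun hqτ => ?_
    have : q ∈ σ ∩ τ := Finset.mem_inter.2 ⟨hq, hqτ⟩
    simp [he] at this
  -- Move from the barycenter `b` of the common face a little towards `z`. If no coordinate of `σ`
  -- outside `τ` is negative at `z`, the new point `y` lies in both simplices, so its `τ`-weights
  -- outside `σ` vanish. Then those of `z` vanish too, and no weight is left.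
  · set k : ℝ := ((σ ∩ τ).card : ℝ) with hk
    have hkpos : 0 < k := by
      rw [hk]
      exact_mod_cast Finset.card_pos.2 hne
    set w : (Fin n → ℝ) → ℝ := fun q => if q ∈ σ ∩ τ then k⁻¹ else 0 with hw
    set b : Fin n → ℝ := ∑ q ∈ σ ∩ τ, w q • q with hb
    have hbw : IsBarycentric (σ ∩ τ) b w := by
      refine ⟨fun q => ?_, fun q hq => by simp only [hw, if_neg hq], ?_, rfl⟩
      · simp only [hw]
        split_ifs <;> positivity
      · rw [Finset.sum_congr rfl fun q hq => show w q = k⁻¹ by simp only [hw, if_pos hq],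
          Finset.sum_const, nsmul_eq_mul, ← hk, mul_inv_cancel₀ hkpos.ne']
    have hbσ := hbw.mono (Finset.inter_subset_left (s₂ := τ))
    have hbτ := hbw.mono (Finset.inter_subset_right (s₁ := σ))
    obtain ⟨M, hM0, hM⟩ : ∃ M : ℝ, 0 ≤ M ∧ ∀ q ∈ σ, -M ≤ bary σ q z := by
      refine ⟨∑ q ∈ σ, |bary σ q z|, Finset.sum_nonneg fun _ _ => abs_nonneg _, fun q hq => ?_⟩
      have := Finset.single_le_sum (f := fun q => |bary σ q z|) (fun _ _ => abs_nonneg _) hq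
      have h2 := neg_abs_le (bary σ q z)
      linarith
    -- Chosen so that `(1 - t) / k = t * (M + 1)`: the weight `1 / k` of `b` at a common vertex
    -- outweighs a coordinate of `z` as low as `-M`.
    set t : ℝ := (1 + k * M + k)⁻¹ with ht
    have hden : 0 < 1 + k * M + k := by positivity
    have ht0 : 0 < t := by positivity
    have ht1 : t ≤ 1 := inv_le_one_of_one_le₀ (by nlinarith [mul_nonneg hkpos.le hM0])
    set y : Fin n → ℝ := AffineMap.lineMap b z t with hy
    have hyf : ∀ f : (Fin n → ℝ) →ᵃ[ℝ] ℝ, f y = (1 - t) * f b + t * f z := by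
      intro f
      rw [hy, AffineMap.apply_lineMap, AffineMap.lineMap_apply_ring]
    have hyτ : y ∈ convexHull ℝ (τ : Set (Fin n → ℝ)) := by
      rw [Hτ.mem_convexHull_iff]
      intro q hq
      rw [hyf]
      exact add_nonneg (mul_nonneg (by linarith) (Hτ.bary_nonneg hbτ.mem_convexHull q))
        (mul_nonneg ht0.le (Hτ.bary_nonneg hz q))
    have hyσ : y ∈ convexHull ℝ (σ : Set (Fin n → ℝ)) := by
      rw [Hσ.mem_convexHull_iff]
      intro q hq
      rw [hyf]
      by_cases hqτ : q ∈ τ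
      · rw [← hbσ.eq_bary Hσ]
        have : w q = k⁻¹ := by simp only [hw, if_pos (Finset.mem_inter.2 ⟨hq, hqτ⟩)]
        rw [this]
        have e1 : (1 - t) * k⁻¹ = t * (M + 1) := by
          rw [ht]
          field_simp
          ring
        rw [e1, ← mul_add]
        exact mul_nonneg ht0.le (by linarith [hM q hq])
      · exact add_nonneg (mul_nonneg (by linarith) (Hσ.bary_nonneg hbσ.mem_convexHull q))
          (mul_nonneg ht0.le (hc q hq hqτ))
    have hsum : ∑ q ∈ τ, bary τ q z = ∑ q ∈ τ \ σ, bary τ q z := by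
      symm
      apply Finset.sum_subset Finset.sdiff_subset
      intro q hq hq'
      apply hz'
      simpa [hq] using hq'
    have h0 : ∀ q ∈ τ \ σ, bary τ q z = 0 := by
      intro q hq
      have hqσ : q ∉ σ := (Finset.mem_sdiff.1 hq).2
      have h1 := h.bary_eq hσ hτ hyσ hyτ q
      rw [hyf (bary τ q), bary_of_notMem hqσ, ← hbτ.eq_bary Hτ] at h1
      have h2 : w q = 0 := by simp only [hw]; rw [if_neg]; simp [hqσ]
      rw [h2] at h1
      have h3 : t * bary τ q z = 0 := by simpa using h1.symm
      exact (mul_eq_zero.1 h3).resolve_left ht0.ne'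
    have h1 := Hτ.sum_bary z
    rw [hsum, Finset.sum_eq_zero h0] at h1
    simp at h1

open Classical in
/-- The coefficient of the barycentric coordinate `q` in the affine functions whose minimum is
dominated by the hat function of `p`. -/
def facetSlope (C : ℝ) (p q : Fin n → ℝ) : ℝ := if q = p then 0 else C

/-- Let `ν` be the weight that `x` gives to the vertices of `τ` outside `σ`. Coordinates of `σ`
belonging to vertices outside `τ` vanish on the common face, and one of them is at most `-c ν` at
`x`. The difference of the two extensions of the `p`-th coordinate also vanishes on the common face
and is at most `B ν`. Hence every `C ≥ max (B / c) 0` suffices. -/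
theorem eventually_exists_le_hat (h : IsRegularTriangulation 𝒯 D) (hσ : σ ∈ 𝒯)
    (hτ : τ ∈ 𝒯) (hpσ : p ∈ σ) :
    ∀ᶠ C : ℝ in atTop, ∀ x ∈ convexHull ℝ (τ : Set (Fin n → ℝ)), ∃ q ∈ σ,
      bary σ p x + facetSlope C p q * bary σ q x ≤ hat 𝒯 p x := by
  classical
  have Hσ := h.isSimplex hσ
  have Hτ := h.isSimplex hτ
  set K : Set (Fin n → ℝ) := convexHull ℝ ((τ \ σ : Finset (Fin n → ℝ)) : Set (Fin n → ℝ))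
    with hK
  have hKc : IsCompact K := (Finset.finite_toSet (τ \ σ)).isCompact_convexHull ℝ
  have hneg : ∀ z ∈ K, ∃ q ∈ σ, q ∉ τ ∧ bary σ q z < 0 := by
    intro z hz
    obtain ⟨w, hw⟩ := exists_isBarycentric hz
    have hwτ := hw.mono (Finset.sdiff_subset (s := τ) (t := σ))
    refine h.exists_bary_neg hσ hτ hwτ.mem_convexHull fun q hq => ?_
    rw [← hwτ.eq_bary Hτ, hw.eq_zero]
    simp [hq]
  -- The minimum over `q` of these coordinates is continuous and negative on the compact face `K`,
  -- so its maximum there is negative.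
  obtain ⟨c, hc0, hc⟩ : ∃ c : ℝ, 0 < c ∧ ∀ z ∈ K, ∃ q ∈ σ, q ∉ τ ∧ bary σ q z ≤ -c := by
    rcases K.eq_empty_or_nonempty with he | hne
    · exact ⟨1, one_pos, by simp [he]⟩
    obtain ⟨z₀, hz₀⟩ := hne
    obtain ⟨q₀, hq₀, hq₀τ, -⟩ := hneg z₀ hz₀
    have hne' : (σ \ τ).Nonempty := ⟨q₀, Finset.mem_sdiff.2 ⟨hq₀, hq₀τ⟩⟩
    have hcont : Continuous fun z => (σ \ τ).inf' hne' fun q => bary σ q z :=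
      Continuous.finset_inf'_apply hne' fun q _ =>
        (bary σ q).continuous_of_finiteDimensional
    obtain ⟨z₁, hz₁, hmax⟩ := hKc.exists_isMaxOn ⟨z₀, hz₀⟩ hcont.continuousOn
    refine ⟨-((σ \ τ).inf' hne' fun q => bary σ q z₁), ?_, fun z hz => ?_⟩
    · obtain ⟨q, hq, hqτ, hlt⟩ := hneg z₁ hz₁
      have := Finset.inf'_le (fun q => bary σ q z₁) (Finset.mem_sdiff.2 ⟨hq, hqτ⟩)
      linarith
    · obtain ⟨q, hq, hqe⟩ := Finset.exists_mem_eq_inf' hne' fun q => bary σ q z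
      have := hmax hz
      simp only [Set.mem_ofPred_eq] at this
      obtain ⟨h1, h2⟩ := Finset.mem_sdiff.1 hq
      refine ⟨q, h1, h2, ?_⟩
      rw [← hqe, neg_neg]
      exact this
  set B : ℝ := ∑ r ∈ τ, |bary σ p r - bary τ p r| with hB
  filter_upwards [eventually_ge_atTop (B / c), eventually_ge_atTop 0] with C hC hC0 x hx
  rw [h.hat_eq_bary hτ hx]
  set ν : ℝ := ∑ r ∈ τ \ σ, bary τ r x with hν
  have hw0 := Hτ.bary_nonneg hx
  rcases (Finset.sum_nonneg fun r (_ : r ∈ τ \ σ) => hw0 r).eq_or_lt with h0 | hpos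
  · refine ⟨p, hpσ, ?_⟩
    have hz := (Finset.sum_eq_zero_iff_of_nonneg fun r (_ : r ∈ τ \ σ) => hw0 r).1 h0.symm
    have hsub : ∀ r ∈ τ, r ∉ σ ∩ τ → bary τ r x = 0 := fun r hr hr' =>
      hz r (Finset.mem_sdiff.2 ⟨hr, fun hrσ => hr' (Finset.mem_inter.2 ⟨hrσ, hr⟩)⟩)
    have hb : IsBarycentric (σ ∩ τ) x fun r => bary τ r x := by
      refine ⟨hw0, fun r hr => ?_, ?_, ?_⟩
      · by_cases hrτ : r ∈ τ
        · exact hsub r hrτ hr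
        · simp [bary_of_notMem hrτ]
      · rw [← Hτ.sum_bary x]
        exact Finset.sum_subset Finset.inter_subset_right hsub
      · conv_rhs => rw [← Hτ.sum_bary_smul x]
        exact Finset.sum_subset Finset.inter_subset_right fun r hr hr' => by
          rw [hsub r hr hr', zero_smul]
    rw [← (hb.mono Finset.inter_subset_left).eq_bary Hσ]
    simp [facetSlope]
  · change 0 < ν at hpos
    -- The normalized projection of `x` to the face of `τ` opposite to the common face; functions
    -- that are affine and vanish at the common vertices scale by `ν` from `z` to `x`.
    set z : Fin n → ℝ := ∑ r ∈ τ \ σ, (ν⁻¹ * bary τ r x) • r with hz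
    have hz1 : ∑ r ∈ τ \ σ, ν⁻¹ * bary τ r x = 1 := by
      rw [← Finset.mul_sum, ← hν, inv_mul_cancel₀ hpos.ne']
    have hzK : z ∈ K := Finset.mem_convexHull'.2
      ⟨_, fun r _ => mul_nonneg (inv_nonneg.2 hpos.le) (hw0 r), hz1, rfl⟩
    obtain ⟨q, hq, hqτ, hqc⟩ := hc z hzK
    have hsplit : ∀ f : (Fin n → ℝ) → ℝ, (∀ r ∈ τ, r ∈ σ → f r = 0) →
        ∑ r ∈ τ, bary τ r x * f r = ∑ r ∈ τ \ σ, bary τ r x * f r := by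
      intro f hf
      symm
      apply Finset.sum_subset Finset.sdiff_subset
      intro r hr hr'
      rw [hf r hr (by simpa [hr] using hr'), mul_zero]
    have hqx : bary σ q x ≤ -(c * ν) := by
      have e1 : bary σ q x = ν * bary σ q z := by
        rw [Hτ.affineMap_eq (bary σ q) x, hsplit (fun r => bary σ q r) fun r hr hrσ =>
          Hσ.bary_ne hrσ fun e => hqτ (e ▸ hr), hz, affineMap_sum_smul _ _ _ hz1,
          Finset.mul_sum]
        refine Finset.sum_congr rfl fun r _ => ?_
        field_simp
      rw [e1]
      nlinarith
    refine ⟨q, hq, ?_⟩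
    have hcν : 0 < c * ν := mul_pos hc0 hpos
    -- If the separating vertex is `p` itself, the slope is zero, but the `p`-th coordinate is
    -- already negative at `x`.
    by_cases hqp : q = p
    · subst hqp
      simp only [facetSlope, if_true, zero_mul, add_zero]
      linarith [hw0 q]
    · have hdiff : bary σ p x - bary τ p x ≤ B * ν := by
        have e2 : bary σ p x - bary τ p x
            = ∑ r ∈ τ, bary τ r x * (bary σ p r - bary τ p r) := by
          conv_lhs => rw [Hτ.affineMap_eq (bary σ p) x, Hτ.affineMap_eq (bary τ p) x]
          rw [← Finset.sum_sub_distrib]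
          exact Finset.sum_congr rfl fun r _ => by ring
        rw [e2, hsplit (fun r => bary σ p r - bary τ p r), hν, Finset.mul_sum]
        · refine Finset.sum_le_sum fun r hr => ?_
          rw [mul_comm]
          refine mul_le_mul_of_nonneg_right ?_ (hw0 r)
          refine (le_abs_self _).trans ?_
          exact Finset.single_le_sum (f := fun r => |bary σ p r - bary τ p r|)
            (fun _ _ => abs_nonneg _) (Finset.mem_sdiff.1 hr).1
        · intro r hr hrσ
          by_cases e : p = r
          · subst e
            rw [Hσ.bary_self hrσ, Hτ.bary_self hr, sub_self]
          · rw [Hσ.bary_ne hrσ e, Hτ.bary_ne hr e, sub_self]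
      have hBC : B ≤ C * c := (div_le_iff₀ hc0).1 hC
      simp only [facetSlope, if_neg hqp]
      have h1 : C * bary σ q x ≤ C * -(c * ν) := mul_le_mul_of_nonneg_left hqx hC0
      have h2 : B * ν ≤ C * c * ν := mul_le_mul_of_nonneg_right hBC hpos.le
      nlinarith

theorem exists_facetSlope (h : IsRegularTriangulation 𝒯 D) (p : Fin n → ℝ) :
    ∃ C : ℝ, 0 ≤ C ∧ ∀ σ ∈ 𝒯, p ∈ σ → ∀ x ∈ closure D, ∃ q ∈ σ,
      bary σ p x + facetSlope C p q * bary σ q x ≤ hat 𝒯 p x := by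
  have h1 : ∀ᶠ C : ℝ in atTop, ∀ σ ∈ 𝒯, ∀ τ ∈ 𝒯, p ∈ σ →
      ∀ x ∈ convexHull ℝ (τ : Set (Fin n → ℝ)), ∃ q ∈ σ,
        bary σ p x + facetSlope C p q * bary σ q x ≤ hat 𝒯 p x := by
    rw [Filter.eventually_all_finset]
    intro σ hσ
    rw [Filter.eventually_all_finset]
    intro τ hτ
    by_cases hp : p ∈ σ
    · filter_upwards [h.eventually_exists_le_hat hσ hτ hp] with C hC _ using hC
    · exact Eventually.of_forall fun _ h => absurd h hp
  obtain ⟨C, hC, hC0⟩ := (h1.and (eventually_ge_atTop 0)).exists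
  refine ⟨C, hC0, fun σ hσ hp x hx => ?_⟩
  obtain ⟨τ, hτ, hxτ⟩ := h.exists_mem hx
  exact hC σ hσ τ hτ hp x hxτ

end IsRegularTriangulation

end Barycentric

/-! ### Construction of ReLU networks -/

namespace NN

theorem depth_eq_length_architecture : {m n : ℕ} → (Φ : NN m n) →
    Φ.depth = Φ.architecture.length
  | _, _, output _ _ => rfl
  | _, _, hidden _ _ _ Φ => by
    simp [depth, architecture, depth_eq_length_architecture Φ]

end NN

theorem NN.realize_hidden {m k n : ℕ} (A : Matrix (Fin k) (Fin m) ℝ) (b : Fin k → ℝ)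
    (ϱ : Fin k → ℝ → ℝ) (Φ : NN k n) (x : Fin m → ℝ) :
    (NN.hidden A b ϱ Φ).realize x = Φ.realize fun i => ϱ i ((A.mulVec x + b) i) := rfl

theorem NN.realize_output {m n : ℕ} (A : Matrix (Fin n) (Fin m) ℝ) (b : Fin n → ℝ)
    (x : Fin m → ℝ) : (NN.output A b).realize x = A.mulVec x + b := rfl

theorem NN.size_hidden {m k n : ℕ} (A : Matrix (Fin k) (Fin m) ℝ) (b : Fin k → ℝ)
    (ϱ : Fin k → ℝ → ℝ) (Φ : NN k n) :
    (NN.hidden A b ϱ Φ).size = NN.layerSize A b + Φ.size := rfl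

theorem NN.size_output {m n : ℕ} (A : Matrix (Fin n) (Fin m) ℝ) (b : Fin n → ℝ) :
    (NN.output A b).size = NN.layerSize A b := rfl

theorem lipschitzWith_relu : LipschitzWith 1 relu :=
  LipschitzWith.id.const_max 0

theorem lipschitzWith_relu_comp (k : ℕ) :
    LipschitzWith 1 fun x : Fin k → ℝ => fun i => relu (x i) :=
  LipschitzWith.of_dist_le_mul fun x y => by
    simp only [NNReal.coe_one, one_mul]
    refine (dist_pi_le_iff dist_nonneg).2 fun i => ?_
    have := lipschitzWith_relu.dist_le_mul (x i) (y i)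
    simp only [NNReal.coe_one, one_mul] at this
    exact this.trans (dist_le_pi_dist x y i)

theorem exists_lipschitzWith_mulVec_add {m n : ℕ} (A : Matrix (Fin n) (Fin m) ℝ)
    (b : Fin n → ℝ) : ∃ K, LipschitzWith K fun x => A.mulVec x + b := by
  have h := (LinearMap.toContinuousLinearMap A.mulVecLin).lipschitz
  exact ⟨_, (h.add (LipschitzWith.const b))⟩

/-- Used for regularity rather than approximation: it supplies global Lipschitz extensions of
combinations of hat functions. -/
theorem NN.IsReLU.exists_lipschitzWith : {m n : ℕ} → (Φ : NN m n) → Φ.IsReLU →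
    ∃ K, LipschitzWith K Φ.realize
  | _, _, output A b, _ => exists_lipschitzWith_mulVec_add A b
  | _, _, hidden A b ϱ Φ, h => by
    obtain ⟨K, hK⟩ := NN.IsReLU.exists_lipschitzWith Φ h.2
    obtain ⟨K', hK'⟩ := exists_lipschitzWith_mulVec_add A b
    refine ⟨K * (1 * K'), ?_⟩
    convert hK.comp ((lipschitzWith_relu_comp _).comp hK') using 1
    funext x
    simp [NN.realize, h.1, Function.comp_def]

/-- The architecture with hidden ReLU layers of the given widths and `n` outputs. -/
def reluArchitecture (ws : List ℕ) (n : ℕ) : List (List (ℝ → ℝ)) :=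
  ws.map (fun w => List.replicate w relu) ++ [List.replicate n id]

/-- The number of nonzero weights and biases of the node `i`. -/
def rowSize {ι : Type*} {m : ℕ} (A : Matrix ι (Fin m) ℝ) (b : ι → ℝ) (i : ι) : ℕ := by
  classical exact {j | A i j ≠ 0}.ncard + if b i = 0 then 0 else 1

theorem layerSize_eq_sum {m n : ℕ} (A : Matrix (Fin n) (Fin m) ℝ) (b : Fin n → ℝ) :
    NN.layerSize A b = ∑ i, rowSize A b i := by
  classical
  simp only [NN.layerSize, rowSize, Finset.sum_add_distrib]
  congr 1
  · simp only [Set.ncard_eq_toFinset_card']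
    rw [← Finset.card_sigma]
    refine Finset.card_bij' (fun p _ => ⟨p.1, p.2⟩) (fun p _ => (p.1, p.2)) ?_ ?_ ?_ ?_ <;>
      simp
  · rw [Set.ncard_eq_toFinset_card', Finset.card_eq_sum_ones, Set.toFinset_ofPred,
      Finset.sum_filter]
    exact Finset.sum_congr rfl fun i _ => by split_ifs <;> simp_all

/-- Given an affine map with sparse rows into the space of the values `ι → ℝ`, its composition
with `F` is realized by a ReLU network with hidden layers of the widths `ws`, the size of which is
at most `c * r + S` if the rows of the affine map have at most `r` nonzero entries. -/
def Emulates {ι : Type} {n : ℕ} (F : (ι → ℝ) → Fin n → ℝ) (ws : List ℕ) (c S : ℕ) : Prop :=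
  ∀ (m r : ℕ) (A : Matrix ι (Fin m) ℝ) (b : ι → ℝ), (∀ i, rowSize A b i ≤ r) →
    ∃ Φ : NN m n, Φ.IsReLU ∧ (∀ x, Φ.realize x = F (A.mulVec x + b)) ∧
      Φ.architecture = reluArchitecture ws n ∧ Φ.size ≤ c * r + S

namespace Emulates

variable {ι κ : Type} {n : ℕ} {F : (ι → ℝ) → Fin n → ℝ} {ws : List ℕ} {c c' S S' : ℕ}

theorem mono (h : Emulates F ws c S) (hc : c ≤ c') (hS : S ≤ S') : Emulates F ws c' S' := by
  intro m r A b hr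
  obtain ⟨Φ, h1, h2, h3, h4⟩ := h m r A b hr
  exact ⟨Φ, h1, h2, h3, h4.trans (by gcongr)⟩

theorem neg (h : Emulates F ws c S) : Emulates (fun v => F (-v)) ws c S := by
  intro m r A b hr
  obtain ⟨Φ, h1, h2, h3, h4⟩ := h m r (-A) (-b) fun i => by
    simpa [rowSize] using hr i
  refine ⟨Φ, h1, fun x => ?_, h3, h4⟩
  simp only [h2, Matrix.neg_mulVec, neg_add]

theorem reindex (h : Emulates F ws c S) (e : ι → κ) :
    Emulates (fun v : κ → ℝ => F (v ∘ e)) ws c S := by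
  intro m r A b hr
  obtain ⟨Φ, h1, h2, h3, h4⟩ := h m r (A.submatrix e id) (b ∘ e) fun i => hr (e i)
  exact ⟨Φ, h1, fun x => h2 x, h3, h4⟩

/-- The linear readout `W` costs no layer of its own: it is merged into the first affine map of the
following network, where its row size `r` enters the bound through `c * r`. -/
theorem exists_hidden [Fintype κ] {F : (ι → ℝ) → Fin n → ℝ} (h : Emulates F ws c S) {r : ℕ}
    (W : Matrix ι κ ℝ) (hW : ∀ i, {k | W i k ≠ 0}.ncard ≤ r) {m : ℕ}
    (A : Matrix κ (Fin m) ℝ) (b : κ → ℝ) :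
    ∃ Φ : NN m n, Φ.IsReLU ∧
      (∀ x, Φ.realize x = F (W.mulVec fun k => relu ((A.mulVec x + b) k))) ∧
      Φ.architecture = reluArchitecture (Fintype.card κ :: ws) n ∧
      Φ.size ≤ ∑ k, rowSize A b k + (c * r + S) := by
  classical
  set e := Fintype.equivFin κ
  obtain ⟨Φ, h1, h2, h3, h4⟩ := h (Fintype.card κ) r (W.submatrix id e.symm) 0 fun i => by
    simp only [rowSize, Pi.zero_apply, if_true, add_zero, Matrix.submatrix_apply, id]
    refine le_trans (le_of_eq ?_) (hW i)
    exact Set.ncard_congr (fun j _ => e.symm j) (fun j hj => hj)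
      (fun _ _ _ _ hjk => e.symm.injective hjk)
      fun k hk => ⟨e k, by simpa using hk, e.symm_apply_apply k⟩
  refine ⟨.hidden (A.submatrix e.symm id) (fun j => b (e.symm j)) (fun _ => relu) Φ,
    ⟨fun _ => rfl, h1⟩, fun x => ?_, ?_, ?_⟩
  · rw [NN.realize_hidden, h2]
    congr 1
    funext i
    simp only [Matrix.mulVec, dotProduct, Pi.add_apply, Matrix.submatrix_apply, id]
    rw [Pi.zero_apply, add_zero]
    exact Equiv.sum_comp e.symm fun k => W i k * relu (∑ l, A k l * x l + b k)
  · simp [NN.architecture, h3, reluArchitecture, List.ofFn_const]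
  · rw [NN.size_hidden, layerSize_eq_sum]
    refine add_le_add (le_of_eq ?_) h4
    exact Fintype.sum_equiv e.symm _ _ fun _ => rfl

/-- One ReLU layer, followed by a linear output layer. -/
theorem relu_output [Fintype ι] (B : Matrix (Fin n) ι ℝ) :
    Emulates (fun v => B.mulVec fun i => relu (v i)) [Fintype.card ι] (Fintype.card ι)
      {p : Fin n × ι | B p.1 p.2 ≠ 0}.ncard := by
  classical
  intro m r A b hr
  set e := Fintype.equivFin ι
  refine ⟨.hidden (A.submatrix e.symm id) (fun j => b (e.symm j)) (fun _ => relu)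
    (.output (B.submatrix id e.symm) 0), ⟨fun _ => rfl, trivial⟩, fun x => ?_, ?_, ?_⟩
  · funext k
    simp only [NN.realize_hidden, NN.realize_output, Matrix.mulVec, dotProduct,
      Pi.add_apply, Matrix.submatrix_apply, id]
    rw [Pi.zero_apply, add_zero]
    exact Equiv.sum_comp e.symm fun i => B k i * relu (∑ l, A i l * x l + b i)
  · simp [NN.architecture, reluArchitecture, List.ofFn_const]
  · rw [NN.size_hidden, NN.size_output, layerSize_eq_sum]
    refine add_le_add ?_ (le_of_eq ?_)
    · refine (Finset.sum_le_card_nsmul _ _ r fun j _ => hr (e.symm j)).trans ?_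
      simp
    · simp only [NN.layerSize, Matrix.submatrix_apply, id, Pi.zero_apply, ne_eq,
        not_true_eq_false, Set.ofPred_false, Set.ncard_empty, add_zero]
      rw [Set.ncard_eq_toFinset_card', Set.ncard_eq_toFinset_card']
      refine Finset.card_bij' (fun p _ => (p.1, e.symm p.2)) (fun p _ => (p.1, e p.2))
        ?_ ?_ ?_ ?_ <;> simp

end Emulates

theorem rowSize_sub_le {ι : Type*} {m : ℕ} (A : Matrix ι (Fin m) ℝ) (b : ι → ℝ) (i j : ι) :
    rowSize (fun (_ : Unit) l => A i l - A j l) (fun _ => b i - b j) () ≤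
      rowSize A b i + rowSize A b j := by
  classical
  have h1 : {l | A i l - A j l ≠ 0}.ncard ≤ {l | A i l ≠ 0}.ncard + {l | A j l ≠ 0}.ncard := by
    refine (Set.ncard_le_ncard (fun l hl => ?_) (Set.toFinite _)).trans (Set.ncard_union_le _ _)
    by_contra hc
    simp only [Set.mem_union, Set.mem_ofPred_eq, not_or, not_not] at hc
    exact hl (by rw [hc.1, hc.2, sub_zero])
  have h2 : (if b i - b j = 0 then 0 else 1) ≤
      (if b i = 0 then 0 else 1) + if b j = 0 then 0 else 1 := by
    by_cases hi : b i = 0 <;> by_cases hj : b j = 0 <;> simp [hi, hj]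
    split_ifs <;> simp
  simp only [rowSize]
  omega

/-- Combine `max a b = b + relu (a - b)` with `b = relu b - relu (-b)`. This costs three nodes per
maximum, with the readout `(1, 1, -1)` used in `Emulates.max`. -/
theorem max_eq_relu (a b : ℝ) : max a b = relu (a - b) + relu b - relu (-b) := by
  simp only [relu]
  rcases max_cases a b with h | h <;> rcases max_cases 0 (a - b) with h1 | h1 <;>
    rcases max_cases 0 b with h2 | h2 <;> rcases max_cases 0 (-b) with h3 | h3 <;> linarith

/-- A layer that computes maxima of pairs of values. -/
theorem Emulates.max {ι κ : Type} [Fintype κ] {n : ℕ} {F : (κ → ℝ) → Fin n → ℝ} {ws : List ℕ}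
    {c S : ℕ} (h : Emulates F ws c S) (f g : κ → ι) :
    Emulates (fun v : ι → ℝ => F fun k => max (v (f k)) (v (g k)))
      ((3 * Fintype.card κ) :: ws) (4 * Fintype.card κ) (3 * c + S) := by
  classical
  intro m r A b hr
  set W : Matrix κ (κ × Fin 3) ℝ := fun k q => if q.1 = k then ![1, 1, -1] q.2 else 0 with hW
  set A' : Matrix (κ × Fin 3) (Fin m) ℝ := fun q l =>
    ![A (f q.1) l - A (g q.1) l, A (g q.1) l, -A (g q.1) l] q.2 with hA'
  set b' : κ × Fin 3 → ℝ := fun q => ![b (f q.1) - b (g q.1), b (g q.1), -b (g q.1)] q.2 with hb'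
  obtain ⟨Φ, h1, h2, h3, h4⟩ := h.exists_hidden (r := 3) W (fun k => by
    have : {q : κ × Fin 3 | W k q ≠ 0} ⊆ (({k} ×ˢ Finset.univ : Finset (κ × Fin 3)) : Set _) := by
      intro q hq
      simp only [hW, Set.mem_ofPred_eq] at hq
      simp only [Finset.coe_product, Finset.coe_singleton, Finset.coe_univ, Set.mem_prod,
        Set.mem_singleton_iff, Set.mem_univ, and_true]
      by_contra hc
      exact hq (if_neg hc)
    refine (Set.ncard_le_ncard this (Finset.finite_toSet _)).trans ?_
    rw [Set.ncard_coe_finset]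
    simp) A' b'
  refine ⟨Φ, h1, fun x => ?_, ?_, h4.trans ?_⟩
  · rw [h2]
    congr 1
    funext k
    have e0 : (A'.mulVec x + b') (k, 0) = (A.mulVec x + b) (f k) - (A.mulVec x + b) (g k) := by
      simp only [Pi.add_apply, Matrix.mulVec, dotProduct, hA', hb', Matrix.cons_val_zero, sub_mul,
        Finset.sum_sub_distrib]
      ring
    have e1 : (A'.mulVec x + b') (k, 1) = (A.mulVec x + b) (g k) := by
      simp [Matrix.mulVec, dotProduct, hA', hb']
    have e2 : (A'.mulVec x + b') (k, 2) = -(A.mulVec x + b) (g k) := by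
      simp [Matrix.mulVec, dotProduct, hA', hb']
      ring
    rw [max_eq_relu, ← e0, ← e2, ← e1, Matrix.mulVec, dotProduct, Fintype.sum_prod_type,
      Finset.sum_eq_single k]
    · simp only [hW, Fin.sum_univ_three, if_true]
      simp
      ring
    · intro k' _ hk
      simp [hW, hk]
    · simp
  · rw [h3]
    simp [mul_comm]
  -- The difference of two rows may have `2 r` entries, and the rows for `b` and `-b` have at most
  -- `r` each.
  · have hk : ∀ k, ∑ t, rowSize A' b' (k, t) ≤ 4 * r := by
      intro k
      have e0 : rowSize A' b' (k, 0) ≤ r + r :=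
        (rowSize_sub_le A b (f k) (g k)).trans (add_le_add (hr _) (hr _))
      have e1 : rowSize A' b' (k, 1) ≤ r := hr (g k)
      have e2 : rowSize A' b' (k, 2) ≤ r := by
        refine le_trans (le_of_eq ?_) (hr (g k))
        simp [rowSize, hA', hb']
      rw [Fin.sum_univ_three]
      omega
    rw [Fintype.sum_prod_type]
    have := Finset.sum_le_card_nsmul Finset.univ _ _ fun k _ => hk k
    rw [Finset.card_univ, smul_eq_mul] at this
    linarith

/-! ### Binary trees -/

/-- The number of values that remain when maxima of pairs are taken. -/
def halve (s : ℕ) : ℕ := (s + 1) / 2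

/-- For odd `s` the last value has no partner; the index `min (2 * k + 1) (s - 1)` pairs it with
itself. -/
theorem ciSup_halve {s : ℕ} (hs : 0 < s) (v : Fin s → ℝ) :
    ⨆ k : Fin (halve s), max (v ⟨2 * k, by have := k.2; simp only [halve] at this; omega⟩)
      (v ⟨min (2 * k + 1) (s - 1), by omega⟩) = ⨆ j, v j := by
  have : Nonempty (Fin s) := ⟨⟨0, hs⟩⟩
  have : Nonempty (Fin (halve s)) := ⟨⟨0, by simp only [halve]; omega⟩⟩
  have hb : BddAbove (Set.range v) := (Set.finite_range v).bddAbove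
  apply le_antisymm
  · exact ciSup_le fun k => max_le (le_ciSup hb _) (le_ciSup hb _)
  · refine ciSup_le fun j => ?_
    have hj := j.2
    refine le_ciSup_of_le (Set.finite_range _).bddAbove
      ⟨j / 2, by simp only [halve]; omega⟩ ?_
    rcases Nat.even_or_odd' (j : ℕ) with ⟨c, hc | hc⟩
    · refine le_max_of_le_left (le_of_eq ?_)
      congr 1
      ext
      simp only
      omega
    · refine le_max_of_le_right (le_of_eq ?_)
      congr 1
      ext
      simp only
      omega

/-- The widths of the hidden layers that compute the maxima of families of values, the numbers of
which form the multiset `M`, by `L` binary steps. -/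
def treeWidths : ℕ → Multiset ℕ → List ℕ
  | 0, _ => []
  | L + 1, M => 3 * (M.map halve).sum :: treeWidths L (M.map halve)

theorem length_treeWidths (L : ℕ) (M : Multiset ℕ) : (treeWidths L M).length = L := by
  induction L generalizing M with
  | zero => rfl
  | succ L ih => simp [treeWidths, ih]

/-- All trees have the same height `L`; once a family is reduced to one value, that value is passed
on as the maximum with itself, since `halve 1 = 1`. As `2 * halve s ≤ s + 1`, the number of values
nearly halves at each level. The total cost is therefore linear in `∑ s`, plus a constant per tree
and level; the term `3 * L * c` allows for merging readouts of row size three. -/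
theorem Emulates.iSup {Q : Type} [Fintype Q] {n : ℕ} {F : (Q → ℝ) → Fin n → ℝ} {ws : List ℕ}
    {c S : ℕ} (h : Emulates F ws c S) (L : ℕ) (s : Q → ℕ) (h1 : ∀ q, 1 ≤ s q)
    (h2 : ∀ q, s q ≤ 2 ^ L) :
    Emulates (fun v : (Σ q, Fin (s q)) → ℝ => F fun q => ⨆ j, v ⟨q, j⟩)
      (treeWidths L (Finset.univ.val.map s) ++ ws) (c + 4 * ∑ q, s q)
      (S + 3 * L * c + 12 * (∑ q, s q + L * Fintype.card Q)) := by
  induction L generalizing s with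
  | zero =>
    have hs : ∀ q, s q = 1 := fun q => le_antisymm (by simpa using h2 q) (h1 q)
    have := (h.reindex (κ := Σ q, Fin (s q)) fun q => ⟨q, ⟨0, h1 q⟩⟩).mono
      (c' := c + 4 * ∑ q, s q) (S' := S + 3 * 0 * c + 12 * (∑ q, s q + 0 * Fintype.card Q))
      (by omega) (by omega)
    convert this using 3 with v
    · funext q
      have : Unique (Fin (s q)) := by
        rw [hs q]
        infer_instance
      rw [ciSup_unique]
      congr 2
      exact Subsingleton.elim _ _
    · rfl
  | succ L ih =>
    have ih' := ih (fun q => halve (s q)) (fun q => by have := h1 q; simp only [halve]; omega)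
      (fun q => by have := h2 q; rw [pow_succ] at this; simp only [halve]; omega)
    have hstep := ih'.max (ι := Σ q, Fin (s q))
      (fun k => ⟨k.1, ⟨2 * k.2, by
        have := k.2.2
        simp only [halve] at this
        omega⟩⟩)
      (fun k => ⟨k.1, ⟨min (2 * k.2 + 1) (s k.1 - 1), by have := h1 k.1; omega⟩⟩)
    -- A new level adds `3 * (c + 4 * ∑ halve)` to the size. Together with the `12 * ∑ halve` from
    -- the induction hypothesis, the terms in `∑ halve` amount to `24 * ∑ halve`, at most `12 * (∑ s
    -- + card Q)` by this inequality.
    have hh : 2 * ∑ q, halve (s q) ≤ ∑ q, s q + Fintype.card Q := by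
      rw [Finset.mul_sum, ← Finset.card_univ, Finset.card_eq_sum_ones, ← Finset.sum_add_distrib]
      exact Finset.sum_le_sum fun q _ => by simp only [halve]; omega
    have hle : ∑ q, halve (s q) ≤ ∑ q, s q :=
      Finset.sum_le_sum fun q _ => by have := h1 q; simp only [halve]; omega
    convert hstep.mono (c' := c + 4 * ∑ q, s q)
      (S' := S + 3 * (L + 1) * c + 12 * (∑ q, s q + (L + 1) * Fintype.card Q)) ?_ ?_ using 1
    · funext v
      congr 1
      funext q
      exact (ciSup_halve (h1 q) fun j => v ⟨q, j⟩).symm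
    · simp [treeWidths, Multiset.map_map]
    · simp only [Fintype.card_sigma, Fintype.card_fin]
      omega
    · nlinarith

/-- A minimum is minus the maximum of the negated values. Both sign changes are absorbed in weights,
so widths and size are those of `Emulates.iSup`. -/
theorem Emulates.iInf {Q : Type} [Fintype Q] {n : ℕ} {F : (Q → ℝ) → Fin n → ℝ} {ws : List ℕ}
    {c S : ℕ} (h : Emulates F ws c S) (L : ℕ) (s : Q → ℕ) (h1 : ∀ q, 1 ≤ s q)
    (h2 : ∀ q, s q ≤ 2 ^ L) :
    Emulates (fun v : (Σ q, Fin (s q)) → ℝ => F fun q => ⨅ j, v ⟨q, j⟩)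
      (treeWidths L (Finset.univ.val.map s) ++ ws) (c + 4 * ∑ q, s q)
      (S + 3 * L * c + 12 * (∑ q, s q + L * Fintype.card Q)) := by
  convert (h.neg.iSup L s h1 h2).neg using 2 with v
  congr 1
  funext q
  simp only [Pi.neg_apply]
  rw [_root_.iInf, Real.sInf_def, _root_.iSup]
  congr 2
  ext a
  simp [neg_eq_iff_eq_neg]

/-! ### Emulation of hat functions -/

theorem exists_range_eq_of_card_eq {α : Type*} (s : Finset α) {m : ℕ} (hs : s.card = m) :
    ∃ f : Fin m → α, (∀ j, f j ∈ s) ∧ ∀ a ∈ s, ∃ j, f j = a :=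
  ⟨fun j => (s.equivFinOfCardEq hs).symm j, fun j => ((s.equivFinOfCardEq hs).symm j).2,
    fun a ha => ⟨s.equivFinOfCardEq hs ⟨a, ha⟩, by simp⟩⟩

theorem rowSize_le {ι : Type*} {m : ℕ} (A : Matrix ι (Fin m) ℝ) (b : ι → ℝ) (i : ι) :
    rowSize A b i ≤ m + 1 := by
  classical
  have h1 : {j | A i j ≠ 0}.ncard ≤ m := by
    simpa using Set.ncard_le_ncard (Set.subset_univ {j | A i j ≠ 0}) Set.finite_univ
  simp only [rowSize]
  split_ifs <;> omega

theorem exists_matrix_eq {ι : Type*} {n : ℕ} (f : ι → (Fin n → ℝ) →ᵃ[ℝ] ℝ) :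
    ∃ (A : Matrix ι (Fin n) ℝ) (b : ι → ℝ), ∀ x, A.mulVec x + b = fun i => f i x := by
  refine ⟨Matrix.of fun i j => (f i).linear (Pi.single j 1), fun i => f i 0, fun x => ?_⟩
  funext i
  have e : f i x = (f i).linear x + f i 0 := by
    have := congrFun (f i).decomp x
    simpa using this
  rw [e, Pi.add_apply]
  congr 1
  conv_rhs => rw [pi_eq_sum_univ' x, map_sum]
  simp only [Matrix.mulVec, dotProduct, Matrix.of_apply, map_smul, smul_eq_mul]
  exact Finset.sum_congr rfl fun j _ => mul_comm _ _

namespace IsRegularTriangulation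

variable {n : ℕ} {𝒯 : Finset (Finset (Fin n → ℝ))} {D : Set (Fin n → ℝ)} {p : Fin n → ℝ}

theorem numSharing_eq (h : IsRegularTriangulation 𝒯 D) (hp : p ∈ vertices 𝒯) :
    ∃ s : Finset (Finset (Fin n → ℝ)), s.card = numSharing 𝒯 p ∧
      ∀ σ, σ ∈ s ↔ σ ∈ 𝒯 ∧ p ∈ σ := by
  classical
  refine ⟨𝒯.filter fun σ => p ∈ convexHull ℝ (σ : Set (Fin n → ℝ)), ?_, fun σ => ?_⟩
  · simp only [numSharing]
    -- In `numSharing` the members counted are the vertex sets coerced to `Set`; the coercion is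
    -- injective, so the count is the same.
    refine Finset.card_bij (fun σ _ => (σ : Set (Fin n → ℝ))) ?_
      (fun _ _ _ _ e => Finset.coe_injective e) ?_
    · intro σ hσ
      simp only [Finset.mem_filter, Finset.bind_def, Finset.pure_def, Finset.mem_sup,
        Finset.mem_singleton] at hσ ⊢
      exact ⟨⟨σ, hσ.1, rfl⟩, hσ.2⟩
    · intro t ht
      simp only [Finset.mem_filter, Finset.bind_def, Finset.pure_def, Finset.mem_sup,
        Finset.mem_singleton] at ht
      obtain ⟨⟨σ, hσ, rfl⟩, h2⟩ := ht
      exact ⟨σ, Finset.mem_filter.2 ⟨hσ, h2⟩, rfl⟩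
  · rw [Finset.mem_filter]
    exact ⟨fun H => ⟨H.1, h.mem_of_mem_convexHull hp H.1 H.2⟩,
      fun H => ⟨H.1, subset_convexHull ℝ _ H.2⟩⟩

theorem one_le_numSharing (h : IsRegularTriangulation 𝒯 D) (hp : p ∈ vertices 𝒯) :
    1 ≤ numSharing 𝒯 p := by
  obtain ⟨s, hs, hmem⟩ := h.numSharing_eq hp
  obtain ⟨σ, hσ⟩ := mem_vertices.1 hp
  rw [← hs]
  exact Finset.card_pos.2 ⟨σ, (hmem σ).2 hσ⟩

/-- A hat function is the positive part of a maximum, over the simplices that share the node, of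
minima of `n + 1` affine functions. -/
theorem exists_relu_iSup_iInf (h : IsRegularTriangulation 𝒯 D) (hp : p ∈ vertices 𝒯) :
    ∃ f : Fin (numSharing 𝒯 p) → Fin (n + 1) → (Fin n → ℝ) →ᵃ[ℝ] ℝ,
      ∀ x ∈ closure D, relu (⨆ k, ⨅ j, f k j x) = hat 𝒯 p x := by
  obtain ⟨s, hs, hmem⟩ := h.numSharing_eq hp
  obtain ⟨st, hst, hst'⟩ := exists_range_eq_of_card_eq s hs
  have hst1 : ∀ k, st k ∈ 𝒯 ∧ p ∈ st k := fun k => (hmem _).1 (hst k)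
  choose vt hvt hvt' using fun k => exists_range_eq_of_card_eq (st k) (h.card_eq _ (hst1 k).1)
  obtain ⟨C, hC0, hC⟩ := h.exists_facetSlope p
  refine ⟨fun k j => bary (st k) p + facetSlope C p (vt k j) • bary (st k) (vt k j),
    fun x hx => ?_⟩
  have : Nonempty (Fin (numSharing 𝒯 p)) := ⟨⟨0, h.one_le_numSharing hp⟩⟩
  have hnn := h.hat_nonneg hx p
  have hsl : ∀ q, 0 ≤ facetSlope C p q := fun q => by
    simp only [facetSlope]
    split_ifs
    exacts [le_rfl, hC0]
  simp only [AffineMap.coe_add, AffineMap.coe_smul, Pi.add_apply, Pi.smul_apply, smul_eq_mul]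
  apply le_antisymm
  -- On the whole closed domain, each minimum is at most the hat function because one of its affine
  -- functions is, by the choice of `C`.
  · refine max_le hnn (ciSup_le fun k => ?_)
    obtain ⟨q, hq, hle⟩ := hC (st k) (hst1 k).1 (hst1 k).2 x hx
    obtain ⟨j, rfl⟩ := hvt' k q hq
    exact (ciInf_le (Set.finite_range _).bddBelow j).trans hle
  -- If the simplex containing `x` has the vertex `p`, its own minimum is at least the hat function
  -- there. Otherwise the hat function is zero and the outer `relu` suffices.
  · obtain ⟨σ, hσ, hxσ⟩ := h.exists_mem hx
    rw [h.hat_eq_bary hσ hxσ]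
    by_cases hpσ : p ∈ σ
    · obtain ⟨k, rfl⟩ := hst' σ ((hmem σ).2 ⟨hσ, hpσ⟩)
      refine le_max_of_le_right (le_ciSup_of_le (Set.finite_range _).bddAbove k ?_)
      refine le_ciInf fun j => le_add_of_nonneg_right (mul_nonneg (hsl _) ?_)
      exact (h.isSimplex hσ).bary_nonneg hxσ _
    · rw [bary_of_notMem hpσ]
      exact le_max_left _ _

/-- Linear combinations of hat functions are realized by ReLU networks. -/
theorem exists_network (h : IsRegularTriangulation 𝒯 D) {ι : Type} [Fintype ι]
    (P : ι → Fin n → ℝ) (hP : ∀ i, P i ∈ vertices 𝒯) {k : ℕ} (B : Matrix (Fin k) ι ℝ)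
    {L₁ L₂ : ℕ} (hL₁ : ∀ i, numSharing 𝒯 (P i) ≤ 2 ^ L₁) (hL₂ : n + 1 ≤ 2 ^ L₂) {N R b : ℕ}
    (hN : Fintype.card ι = N) (hR : ∑ i, numSharing 𝒯 (P i) = R)
    (hb : {p : Fin k × ι | B p.1 p.2 ≠ 0}.ncard ≤ b) :
    ∃ Φ : NN n k, Φ.IsReLU ∧
      (∀ x ∈ closure D, Φ.realize x = B.mulVec fun i => hat 𝒯 (P i) x) ∧
      Φ.architecture = reluArchitecture (treeWidths L₂ (Multiset.replicate R (n + 1)) ++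
        (treeWidths L₁ (Finset.univ.val.map fun i => numSharing 𝒯 (P i)) ++ [N])) k ∧
      Φ.size ≤ (N + 4 * R + 4 * ((n + 1) * R)) * (n + 1) +
        (b + 3 * L₁ * N + 12 * (R + L₁ * N) + 3 * L₂ * (N + 4 * R) +
          12 * ((n + 1) * R + L₂ * R)) := by
  choose f hf using fun i => h.exists_relu_iSup_iInf (hP i)
  -- From the output backwards: the positive parts combined by `B`, the maxima over the simplices at
  -- each node, and, next to the input, the minima of `n + 1` affine functions.
  have E := (((Emulates.relu_output B).mono le_rfl hb).iSup L₁ (fun i => numSharing 𝒯 (P i))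
    (fun i => h.one_le_numSharing (hP i)) hL₁).iInf L₂ (fun _ => n + 1)
    (fun _ => Nat.le_add_left 1 n) (fun _ => hL₂)
  obtain ⟨A, a, hAa⟩ := exists_matrix_eq fun q :
    Σ _ : Σ i, Fin (numSharing 𝒯 (P i)), Fin (n + 1) => f q.1.1 q.1.2 q.2
  obtain ⟨Φ, h1, h2, h3, h4⟩ := E n (n + 1) A a (rowSize_le A a)
  have hcard : Fintype.card (Σ i, Fin (numSharing 𝒯 (P i))) = R := by simp [hR]
  refine ⟨Φ, h1, fun x hx => ?_, ?_, ?_⟩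
  · rw [h2, hAa]
    exact congrArg B.mulVec (funext fun i => hf i x hx)
  · rw [h3, hN]
    rw [Multiset.map_const', Finset.card_val, Finset.card_univ, hcard]
  · refine h4.trans (le_of_eq ?_)
    rw [hR, hcard, hN, Finset.sum_const, Finset.card_univ, hcard, smul_eq_mul]
    ring

end IsRegularTriangulation

/-! ### Boundary values of functions in `H¹₀(G)` -/

/-- Squaring makes the truncation differentiable at zero, so the fundamental theorem of calculus
applies to truncated test functions. -/
theorem hasDerivAt_max_zero_sq (x : ℝ) :
    HasDerivAt (fun x : ℝ => max 0 x ^ 2) (2 * max 0 x) x := by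
  rcases lt_trichotomy x 0 with hx | rfl | hx
  · rw [max_eq_left hx.le, mul_zero]
    refine (hasDerivAt_const x (0 : ℝ)).congr_of_eventuallyEq ?_
    filter_upwards [Iio_mem_nhds hx] with y hy
    rw [max_eq_left (le_of_lt hy)]
    norm_num
  · rw [max_self, mul_zero, hasDerivAt_iff_isLittleO]
    simp only [max_self, sub_zero, smul_zero, ne_eq, OfNat.ofNat_ne_zero, not_false_eq_true,
      zero_pow]
    refine Asymptotics.IsBigO.trans_isLittleO (g := fun y : ℝ => y ^ 2) ?_ ?_
    · refine Asymptotics.IsBigO.of_bound 1 (Eventually.of_forall fun y => ?_)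
      rw [one_mul, norm_pow, norm_pow]
      gcongr
      rcases max_cases 0 y with h | h <;> simp [h.1]
    · have := Asymptotics.isLittleO_pow_id (𝕜 := ℝ) (n := 2) (by norm_num)
      exact this
  · rw [max_eq_right hx.le]
    have h := hasDerivAt_pow 2 x
    simp only [Nat.cast_ofNat, Nat.add_one_sub_one, pow_one] at h
    refine h.congr_of_eventuallyEq ?_
    filter_upwards [Ioi_mem_nhds hx] with y hy
    rw [max_eq_right (le_of_lt hy)]

theorem setLIntegral_add_right_le {n : ℕ} {B E : Set (Fin n → ℝ)} (hB : MeasurableSet B)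
    (hE : MeasurableSet E) (w : Fin n → ℝ) (h : ∀ y ∈ B, y + w ∈ E)
    (f : (Fin n → ℝ) → ENNReal) :
    ∫⁻ y in B, f (y + w) ≤ ∫⁻ y in E, f y := by
  rw [← lintegral_indicator hB, ← lintegral_indicator hE,
    ← lintegral_add_right_eq_self (E.indicator f) w]
  refine lintegral_mono fun y => ?_
  by_cases hy : y ∈ B
  · rw [Set.indicator_of_mem hy, Set.indicator_of_mem (h y hy)]
  · rw [Set.indicator_of_notMem hy]
    exact zero_le

theorem lintegral_enorm_mul_le {α : Type*} [MeasurableSpace α] {μ : Measure α} {f g : α → ℝ}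
    (hf : AEStronglyMeasurable f μ) (hg : AEStronglyMeasurable g μ) :
    ∫⁻ x, ‖f x‖ₑ * ‖g x‖ₑ ∂μ ≤ eLpNorm f 2 μ * eLpNorm g 2 μ := by
  have := eLpNorm_smul_le_mul_eLpNorm (p := 2) (q := 2) (r := 1) hg hf
  rw [eLpNorm_one_eq_lintegral_enorm] at this
  simpa [enorm_mul] using this

/-- If a test function with support in `G` is close to a function that is at least `1 / 2` near
a boundary point, then it varies much between the exterior and the interior of `G`. -/
theorem volume_le_of_jump {n : ℕ} {G : Set (Fin n → ℝ)} (hG : MeasurableSet G)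
    {φ u : (Fin n → ℝ) → ℝ} (hφ : ContDiff ℝ ∞ φ) (hsupp : tsupport φ ⊆ G)
    (hu : AEStronglyMeasurable u (volume.restrict G)) {a c z : Fin n → ℝ} {r ρ : ℝ}
    (h1 : Metric.ball c ρ ⊆ Metric.ball a r \ G)
    (h2 : Metric.ball (c + z) ρ ⊆ Metric.ball a r ∩ G)
    (hua : ∀ y ∈ G ∩ Metric.ball a r, 1 / 2 ≤ u y) :
    ENNReal.ofReal (1 / 4) * volume (Metric.ball c ρ) ≤
      eLpNorm (φ - u) 2 (volume.restrict G) * eLpNorm (φ - u) 2 (volume.restrict G) +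
      2 * (eLpNorm (φ - u) 2 (volume.restrict G) *
        eLpNorm (fun y => fderiv ℝ φ y z) 2 (volume.restrict G)) := by
  -- This function is `1 / 4` outside `G`, where `φ = 0`. On `G` near `a`, where `u ≥ 1 / 2`, it is
  -- at most `|φ - u|²`, with derivative along `z` at most `2 |φ - u| |∂_z φ|`. Integrating along
  -- the translation by `z` from the exterior ball to the interior one and applying Cauchy–Schwarz
  -- gives the claim.
  set k : (Fin n → ℝ) → ℝ := fun y => max 0 (1 / 2 - φ y) ^ 2 with hk
  set k' : (Fin n → ℝ) → ℝ := fun y => -(2 * max 0 (1 / 2 - φ y) * fderiv ℝ φ y z) with hk'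
  have hφd : Differentiable ℝ φ := hφ.differentiable (by simp)
  have hfc : Continuous fun y => fderiv ℝ φ y z :=
    (hφ.continuous_fderiv (by simp)).clm_apply continuous_const
  have hk'c : Continuous k' := by
    have := hφ.continuous
    fun_prop
  have hkc : Continuous k := by
    have := hφ.continuous
    fun_prop
  have hmφu : AEStronglyMeasurable (φ - u) (volume.restrict G) :=
    hφ.continuous.aestronglyMeasurable.sub hu
  have hpos : ∀ y ∈ G ∩ Metric.ball a r, max 0 (1 / 2 - φ y) ≤ |φ y - u y| := by
    intro y hy
    refine max_le (abs_nonneg _) ?_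
    have := neg_abs_le (φ y - u y)
    linarith [hua y hy]
  have hoff : ∀ y, y ∉ G → φ y = 0 ∧ fderiv ℝ φ y z = 0 := by
    intro y hy
    have hyt : y ∉ tsupport φ := fun h => hy (hsupp h)
    refine ⟨image_eq_zero_of_notMem_tsupport hyt, ?_⟩
    have : fderiv ℝ φ y = 0 := by
      have h0 : φ =ᶠ[𝓝 y] 0 := notMem_tsupport_iff_eventuallyEq.1 hyt
      rw [h0.fderiv_eq]
      simp
    rw [this]
    rfl
  have hftc : ∀ y, k (y + z) - k y = ∫ s in (0 : ℝ)..1, k' (y + s • z) := by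
    intro y
    have hd : ∀ s ∈ Set.uIcc (0 : ℝ) 1,
        HasDerivAt (fun s : ℝ => k (y + s • z)) (k' (y + s • z)) s := by
      intro s _
      have e1 : HasDerivAt (fun s : ℝ => y + s • z) z s := by
        simpa using ((hasDerivAt_id s).smul_const z).const_add y
      have e2 : HasDerivAt (fun s : ℝ => 1 / 2 - φ (y + s • z)) (-(fderiv ℝ φ (y + s • z) z)) s :=
        ((hφd _).hasFDerivAt.comp_hasDerivAt s e1).const_sub _
      have e3 := (hasDerivAt_max_zero_sq _).comp s e2
      refine e3.congr_deriv ?_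
      simp only [hk']
      ring
    have hc : Continuous fun s : ℝ => k' (y + s • z) := by fun_prop
    rw [intervalIntegral.integral_eq_sub_of_hasDerivAt hd (hc.intervalIntegrable _ _)]
    simp
  have hpt : ∀ y ∈ Metric.ball c ρ, ENNReal.ofReal (1 / 4) ≤
      ‖k (y + z)‖ₑ + ∫⁻ s in Set.Ioc (0 : ℝ) 1, ‖k' (y + s • z)‖ₑ := by
    intro y hy
    have hy0 : k y = 1 / 4 := by
      simp only [hk]
      rw [(hoff y (h1 hy).2).1]
      norm_num
    have e : (1 / 4 : ℝ) = k (y + z) - ∫ s in (0 : ℝ)..1, k' (y + s • z) := by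
      rw [← hftc, hy0]
      ring
    have e' : ENNReal.ofReal (1 / 4) = ‖(1 / 4 : ℝ)‖ₑ := by
      rw [Real.enorm_eq_ofReal (by norm_num)]
    rw [e', e]
    refine (enorm_sub_le).trans (add_le_add le_rfl ?_)
    rw [intervalIntegral.integral_of_le zero_le_one]
    exact enorm_integral_le_lintegral_enorm _
  have hB : MeasurableSet (Metric.ball c ρ) := measurableSet_ball
  have hmeas : Measurable fun p : (Fin n → ℝ) × ℝ => ‖k' (p.1 + p.2 • z)‖ₑ :=
    (Continuous.measurable (by fun_prop))
  calc ENNReal.ofReal (1 / 4) * volume (Metric.ball c ρ)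
      = ∫⁻ _ in Metric.ball c ρ, ENNReal.ofReal (1 / 4) := by rw [setLIntegral_const]
    _ ≤ ∫⁻ y in Metric.ball c ρ, (‖k (y + z)‖ₑ +
          ∫⁻ s in Set.Ioc (0 : ℝ) 1, ‖k' (y + s • z)‖ₑ) := setLIntegral_mono' hB hpt
    _ = (∫⁻ y in Metric.ball c ρ, ‖k (y + z)‖ₑ) +
          ∫⁻ y in Metric.ball c ρ, ∫⁻ s in Set.Ioc (0 : ℝ) 1, ‖k' (y + s • z)‖ₑ :=
        lintegral_add_left (Continuous.measurable (by fun_prop)) _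
    _ ≤ _ := add_le_add ?_ ?_
  · calc ∫⁻ y in Metric.ball c ρ, ‖k (y + z)‖ₑ
        ≤ ∫⁻ y in Metric.ball (c + z) ρ, ‖k y‖ₑ :=
          setLIntegral_add_right_le hB measurableSet_ball z (fun y hy => by
            simpa [Metric.mem_ball] using hy) fun y => ‖k y‖ₑ
      _ ≤ ∫⁻ y in Metric.ball (c + z) ρ, ‖(φ - u) y‖ₑ * ‖(φ - u) y‖ₑ := by
          refine setLIntegral_mono' measurableSet_ball fun y hy => ?_
          rw [← enorm_mul, Real.enorm_eq_ofReal_abs, Real.enorm_eq_ofReal_abs]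
          refine ENNReal.ofReal_le_ofReal ?_
          have h0 := hpos y ⟨(h2 hy).2, (h2 hy).1⟩
          have h3 : 0 ≤ max 0 (1 / 2 - φ y) := le_max_left _ _
          simp only [hk, Pi.sub_apply]
          rw [abs_mul, abs_of_nonneg (by positivity), sq]
          exact mul_le_mul h0 h0 h3 (abs_nonneg _)
      _ ≤ ∫⁻ y in G, ‖(φ - u) y‖ₑ * ‖(φ - u) y‖ₑ :=
          lintegral_mono_set fun y hy => (h2 hy).2
      _ ≤ _ := lintegral_enorm_mul_le hmφu hmφu
  · calc ∫⁻ y in Metric.ball c ρ, ∫⁻ s in Set.Ioc (0 : ℝ) 1, ‖k' (y + s • z)‖ₑ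
        = ∫⁻ s in Set.Ioc (0 : ℝ) 1, ∫⁻ y in Metric.ball c ρ, ‖k' (y + s • z)‖ₑ :=
          lintegral_lintegral_swap hmeas.aemeasurable
      _ ≤ ∫⁻ s in Set.Ioc (0 : ℝ) 1, ∫⁻ y in Metric.ball a r, ‖k' y‖ₑ := by
          refine setLIntegral_mono' measurableSet_Ioc fun s hs => ?_
          refine setLIntegral_add_right_le hB measurableSet_ball (s • z) (fun y hy => ?_)
            fun y => ‖k' y‖ₑ
          have hz : y + z ∈ Metric.ball a r := (h2 (by simpa [Metric.mem_ball] using hy)).1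
          have := (convex_ball a r).lineMap_mem (h1 hy).1 hz (t := s) ⟨hs.1.le, hs.2⟩
          rw [AffineMap.lineMap_apply_module'] at this
          simpa [add_comm] using this
      _ = ∫⁻ y in Metric.ball a r, ‖k' y‖ₑ := by simp
      _ ≤ ∫⁻ y in Metric.ball a r,
            G.indicator (fun y => 2 * (‖(φ - u) y‖ₑ * ‖fderiv ℝ φ y z‖ₑ)) y := by
          refine setLIntegral_mono' measurableSet_ball fun y hy => ?_
          by_cases hyG : y ∈ G
          · rw [Set.indicator_of_mem hyG]
            simp only [hk', enorm_neg, enorm_mul, mul_assoc]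
            have e2 : ‖(2 : ℝ)‖ₑ = 2 := by
              rw [Real.enorm_eq_ofReal (by norm_num)]
              norm_num
            rw [e2]
            gcongr
            rw [Real.enorm_eq_ofReal_abs, Real.enorm_eq_ofReal_abs]
            refine ENNReal.ofReal_le_ofReal ?_
            rw [abs_of_nonneg (le_max_left _ _)]
            exact hpos y ⟨hyG, hy⟩
          · rw [Set.indicator_of_notMem hyG]
            simp [hk', (hoff y hyG).2]
      _ ≤ ∫⁻ y, G.indicator (fun y => 2 * (‖(φ - u) y‖ₑ * ‖fderiv ℝ φ y z‖ₑ)) y :=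
          setLIntegral_le_lintegral _ _
      _ = 2 * ∫⁻ y in G, ‖(φ - u) y‖ₑ * ‖fderiv ℝ φ y z‖ₑ := by
          rw [lintegral_indicator hG, lintegral_const_mul' _ _ (by norm_num)]
      _ ≤ _ := by
          gcongr
          exact lintegral_enorm_mul_le hmφu hfc.aestronglyMeasurable

/-- A function in `H¹₀(G)` is not bounded below by a positive constant near a boundary point at
which `G` does not lie on both sides of its boundary. -/
theorem IsH10.exists_lt_half {n : ℕ} {G : Set (Fin n → ℝ)} (hG : IsOpen G)
    {u : (Fin n → ℝ) → ℝ} {g : Fin n → (Fin n → ℝ) → ℝ} (h : IsH10 G u g) {a : Fin n → ℝ}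
    (ha : a ∈ closure G) (ha' : a ∉ interior (closure G)) {r : ℝ} (hr : 0 < r) :
    ∃ y ∈ G ∩ Metric.ball a r, u y < 1 / 2 := by
  by_contra! hua
  -- This is where the point not being interior to the closure enters: there is a whole ball outside
  -- `G` arbitrarily close to it.
  have hext : a ∈ closure (closure G)ᶜ := by rwa [closure_compl]
  obtain ⟨c, hc, hcr⟩ := Metric.mem_closure_iff.1 hext r hr
  obtain ⟨c', hc', hcr'⟩ := Metric.mem_closure_iff.1 ha r hr
  rw [dist_comm] at hcr hcr'
  have ho1 : IsOpen (Metric.ball a r ∩ (closure G)ᶜ) :=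
    Metric.isOpen_ball.inter isClosed_closure.isOpen_compl
  have ho2 : IsOpen (Metric.ball a r ∩ G) := Metric.isOpen_ball.inter hG
  obtain ⟨ρ1, hρ1, hb1⟩ := Metric.isOpen_iff.1 ho1 c ⟨hcr, hc⟩
  obtain ⟨ρ2, hρ2, hb2⟩ := Metric.isOpen_iff.1 ho2 c' ⟨hcr', hc'⟩
  set ρ := min ρ1 ρ2 with hρ
  have hρ0 : 0 < ρ := lt_min hρ1 hρ2
  set z := c' - c with hz
  obtain ⟨φ, hφ, hφu, hφg⟩ := h.exists_seq
  have hA : ∀ m, ENNReal.ofReal (1 / 4) * volume (Metric.ball c ρ) ≤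
      eLpNorm (φ m - u) 2 (volume.restrict G) * eLpNorm (φ m - u) 2 (volume.restrict G) +
      2 * (eLpNorm (φ m - u) 2 (volume.restrict G) *
        eLpNorm (fun y => fderiv ℝ (φ m) y z) 2 (volume.restrict G)) := by
    intro m
    refine volume_le_of_jump hG.measurableSet (hφ m).1 (hφ m).2.2 h.memLp.1 (a := a) (r := r)
      ?_ ?_ hua
    · intro y hy
      have := hb1 (Metric.ball_subset_ball (min_le_left _ _) hy)
      exact ⟨this.1, fun hyG => this.2 (subset_closure hyG)⟩
    · have : c + z = c' := by simp [hz]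
      rw [this]
      exact (Metric.ball_subset_ball (min_le_right _ _)).trans hb2
  -- the directional derivatives are bounded in `L²`
  have hdir : ∀ m, eLpNorm (fun y => fderiv ℝ (φ m) y z) 2 (volume.restrict G) ≤
      ∑ j, ‖z j‖ₑ * (eLpNorm ((fun y => fderiv ℝ (φ m) y (Pi.single j 1)) - g j) 2
        (volume.restrict G) + eLpNorm (g j) 2 (volume.restrict G)) := by
    intro m
    have hcont : ∀ j : Fin n, Continuous fun y => fderiv ℝ (φ m) y (Pi.single j 1) := fun j =>
      (((hφ m).1.continuous_fderiv (by simp)).clm_apply continuous_const)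
    have e : (fun y => fderiv ℝ (φ m) y z) =
        ∑ j, z j • fun y => fderiv ℝ (φ m) y (Pi.single j 1) := by
      funext y
      conv_lhs => rw [pi_eq_sum_univ' z, map_sum]
      simp
    rw [e]
    refine (eLpNorm_sum_le (fun j _ => ((hcont j).const_smul _).aestronglyMeasurable)
      (by norm_num)).trans (Finset.sum_le_sum fun j _ => ?_)
    rw [eLpNorm_const_smul]
    gcongr
    calc eLpNorm (fun y => fderiv ℝ (φ m) y (Pi.single j 1)) 2 (volume.restrict G)
        = eLpNorm (((fun y => fderiv ℝ (φ m) y (Pi.single j 1)) - g j) + g j) 2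
          (volume.restrict G) := by rw [sub_add_cancel]
      _ ≤ _ := eLpNorm_add_le ((hcont j).aestronglyMeasurable.sub (h.memLp_grad j).1)
          (h.memLp_grad j).1 (by norm_num)
  -- The error tends to zero and the derivatives stay bounded in `L²`, so the upper bound tends to
  -- zero, while the lower bound is a fixed positive volume.
  have hlim : Tendsto (fun m => eLpNorm (φ m - u) 2 (volume.restrict G) *
      eLpNorm (φ m - u) 2 (volume.restrict G) +
      2 * (eLpNorm (φ m - u) 2 (volume.restrict G) *
        ∑ j, ‖z j‖ₑ * (eLpNorm ((fun y => fderiv ℝ (φ m) y (Pi.single j 1)) - g j) 2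
        (volume.restrict G) + eLpNorm (g j) 2 (volume.restrict G)))) atTop (𝓝 0) := by
    have hs : Tendsto (fun m => ∑ j, ‖z j‖ₑ *
        (eLpNorm ((fun y => fderiv ℝ (φ m) y (Pi.single j 1)) - g j) 2
        (volume.restrict G) + eLpNorm (g j) 2 (volume.restrict G))) atTop
        (𝓝 (∑ j, ‖z j‖ₑ * (0 + eLpNorm (g j) 2 (volume.restrict G)))) :=
      tendsto_finsetSum _ fun j _ =>
        ENNReal.Tendsto.const_mul ((hφg j).add tendsto_const_nhds) (Or.inr (by simp))
    have hfin : ∑ j, ‖z j‖ₑ * (0 + eLpNorm (g j) 2 (volume.restrict G)) ≠ ⊤ := by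
      refine ENNReal.sum_ne_top.2 fun j _ => ENNReal.mul_ne_top (by simp) ?_
      rw [zero_add]
      exact (h.memLp_grad j).2.ne
    have h1 := ENNReal.Tendsto.mul hφu (Or.inr ENNReal.zero_ne_top) hφu
      (Or.inr ENNReal.zero_ne_top)
    have h2 := ENNReal.Tendsto.const_mul (a := 2) (ENNReal.Tendsto.mul hφu (Or.inr hfin) hs
      (Or.inr ENNReal.zero_ne_top)) (Or.inr (by norm_num))
    simpa using h1.add h2
  have hle := ge_of_tendsto hlim (Eventually.of_forall fun m => (hA m).trans (by
    gcongr
    exact hdir m))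
  have hvol : 0 < volume (Metric.ball c ρ) := Metric.measure_ball_pos _ _ hρ0
  have : 0 < ENNReal.ofReal (1 / 4) * volume (Metric.ball c ρ) :=
    ENNReal.mul_pos (by simp) hvol.ne'
  exact absurd hle (not_le.2 this)

/-! ### Lipschitz functions that vanish on the boundary belong to `H¹₀(G)` -/

theorem tendsto_eLpNorm_two_of_bounded {α : Type*} [MeasurableSpace α] {μ : Measure α}
    [IsFiniteMeasure μ] {f : ℕ → α → ℝ} (hf : ∀ m, AEStronglyMeasurable (f m) μ) {M : ℝ}
    (hM : ∀ m, ∀ᵐ x ∂μ, ‖f m x‖ ≤ M)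
    (hlim : ∀ᵐ x ∂μ, Tendsto (fun m => f m x) atTop (𝓝 0)) :
    Tendsto (fun m => eLpNorm (f m) 2 μ) atTop (𝓝 0) := by
  have h1 : Tendsto (fun m => ∫⁻ x, ‖f m x‖ₑ ^ (2 : ℝ) ∂μ) atTop (𝓝 (∫⁻ _, 0 ∂μ)) := by
    refine tendsto_lintegral_of_dominated_convergence' (fun _ => ENNReal.ofReal M ^ (2 : ℝ))
      (fun m => (hf m).enorm.pow_const _) (fun m => ?_) ?_ ?_
    · filter_upwards [hM m] with x hx
      gcongr
      rw [← ofReal_norm]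
      exact ENNReal.ofReal_le_ofReal hx
    · rw [lintegral_const]
      exact ENNReal.mul_ne_top (by simp) (measure_ne_top _ _)
    · filter_upwards [hlim] with x hx
      have := (ENNReal.continuous_rpow_const (y := 2)).tendsto 0
      have h2 := (continuous_enorm.tendsto (0 : ℝ)).comp hx
      rw [enorm_zero] at h2
      simpa [Function.comp_def] using this.comp h2
  rw [lintegral_zero] at h1
  have h3 := ((ENNReal.continuous_rpow_const (y := 1 / 2)).tendsto 0).comp h1
  refine Tendsto.congr (fun m => ?_) (h3.trans (by simp))
  rw [eLpNorm_eq_lintegral_rpow_enorm_toReal (by norm_num) (by norm_num)]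
  simp

/-- Mollify `w`. The derivatives of the mollifications are mollified line derivatives of `w`, hence
uniformly bounded. They converge almost everywhere by Lebesgue differentiation, with limit `fderiv`
by Rademacher. Dominated convergence on the bounded set `G` gives the `L²` limits. -/
theorem exists_test_function_of_lipschitz {n : ℕ} {G : Set (Fin n → ℝ)} (hG : IsOpen G)
    (hGb : Bornology.IsBounded G) {K : NNReal} {w : (Fin n → ℝ) → ℝ} (hw : LipschitzWith K w)
    (hwc : HasCompactSupport w) (hwG : tsupport w ⊆ G) {η : ENNReal} (hη : 0 < η) :
    ∃ φ : (Fin n → ℝ) → ℝ, (ContDiff ℝ ∞ φ ∧ HasCompactSupport φ ∧ tsupport φ ⊆ G) ∧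
      eLpNorm (φ - w) 2 (volume.restrict G) < η ∧
      ∀ j, eLpNorm ((fun y => fderiv ℝ φ y (Pi.single j 1)) -
        fun y => fderiv ℝ w y (Pi.single j 1)) 2 (volume.restrict G) < η := by
  have : IsFiniteMeasure (volume.restrict G) := ⟨by
    rw [Measure.restrict_apply_univ]
    exact hGb.measure_lt_top⟩
  obtain ⟨δ, hδ0, hδ⟩ := hwc.exists_cthickening_subset_open hG hwG
  have hpos : ∀ m : ℕ, 0 < δ / 2 / (m + 1) := fun m => by positivity
  -- The outer radius is at most `δ`, which keeps the supports in `G`, and exactly twice the inner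
  -- one, a fixed ratio needed for the almost everywhere convergence.
  set ρ : ℕ → ContDiffBump (0 : Fin n → ℝ) := fun m =>
    ⟨δ / 2 / (m + 1), 2 * (δ / 2 / (m + 1)), hpos m, by linarith [hpos m]⟩ with hρ
  have hout : ∀ m, (ρ m).rOut = 2 * (δ / 2 / (m + 1)) := fun m => rfl
  have hlim : Tendsto (fun m => (ρ m).rOut) atTop (𝓝 0) := by
    simp only [hout]
    have : Tendsto (fun m : ℕ => δ / 2 / ((m : ℝ) + 1)) atTop (𝓝 0) :=
      tendsto_const_nhds.div_atTop
        (tendsto_atTop_add_const_right _ _ tendsto_natCast_atTop_atTop)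
    simpa using this.const_mul 2
  have hout_le : ∀ m, (ρ m).rOut ≤ δ := by
    intro m
    rw [hout]
    have : δ / 2 / ((m : ℝ) + 1) ≤ δ / 2 := div_le_self (by positivity) (by simp)
    linarith
  set L := ContinuousLinearMap.lsmul ℝ ℝ (E := ℝ) with hL
  set φ : ℕ → (Fin n → ℝ) → ℝ := fun m => convolution ((ρ m).normed volume) w L volume with hφ
  have hwi : LocallyIntegrable w volume := hw.continuous.locallyIntegrable
  have hφs : ∀ m, ContDiff ℝ ∞ (φ m) := fun m =>
    (ρ m).hasCompactSupport_normed.contDiff_convolution_left _ (ρ m).contDiff_normed hwi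
  have hsup : ∀ m, Function.support (φ m) ⊆ Metric.cthickening δ (tsupport w) := by
    intro m x hx
    obtain ⟨a, ha, b, hb, rfl⟩ := support_convolution_subset L hx
    rw [(ρ m).support_normed_eq] at ha
    refine Metric.mem_cthickening_of_dist_le _ b _ _ (subset_tsupport _ hb) ?_
    have : ‖a‖ < (ρ m).rOut := by simpa using ha
    simpa using this.le.trans (hout_le m)
  have hφc : ∀ m, HasCompactSupport (φ m) := fun m =>
    HasCompactSupport.of_support_subset_isCompact hwc.isCompact.cthickening (hsup m)
  have hφt : ∀ m, tsupport (φ m) ⊆ G := fun m =>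
    (closure_minimal (hsup m) Metric.isClosed_cthickening).trans hδ
  have hdist : ∀ m x, dist (φ m x) (w x) ≤ K * (ρ m).rOut := by
    intro m x
    refine ContDiffBump.dist_normed_convolution_le hw.continuous.aestronglyMeasurable
      fun y hy => (hw.dist_le_mul y x).trans ?_
    have := (Metric.mem_ball.1 hy).le
    gcongr
  have hder : ∀ m y e, fderiv ℝ (φ m) y e =
      convolution ((ρ m).normed volume) (fun x => lineDeriv ℝ w x e) L volume y := by
    intro m y e
    have hρc : Continuous fun x => (ρ m).normed volume (y - x) :=
      (ρ m).continuous_normed.comp (continuous_const.sub continuous_id)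
    have hρcs : HasCompactSupport fun x => (ρ m).normed volume (y - x) :=
      (ρ m).hasCompactSupport_normed.comp_homeomorph (Homeomorph.subLeft y)
    have h1 := (((hφs m).differentiable (by simp) y).hasFDerivAt.hasLineDerivAt
      e).tendsto_slope_zero_right
    have h2 := hw.integral_inv_smul_sub_mul_tendsto_integral_lineDeriv_mul (μ := volume)
      (hρc.integrable_of_hasCompactSupport hρcs) e
    have hval : ∀ t : ℝ, φ m (y + t • e) =
        ∫ x, w (x + t • e) * (ρ m).normed volume (y - x) := by
      intro t
      simp only [hφ, convolution]
      rw [← integral_sub_left_eq_self _ volume y]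
      refine integral_congr_ae (Eventually.of_forall fun x => ?_)
      simp only [hL, ContinuousLinearMap.lsmul_apply, smul_eq_mul]
      rw [mul_comm]
      congr 2
      abel
    have hint : ∀ t : ℝ, Integrable fun x => w (x + t • e) * (ρ m).normed volume (y - x) := by
      intro t
      refine Continuous.integrable_of_hasCompactSupport ?_ hρcs.mul_left
      exact (hw.continuous.comp (continuous_id.add continuous_const)).mul hρc
    have h3 : ∀ t : ℝ, t⁻¹ • (φ m (y + t • e) - φ m y) =
        ∫ x, t⁻¹ • (w (x + t • e) - w x) * (ρ m).normed volume (y - x) := by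
      intro t
      have e0 : φ m y = ∫ x, w x * (ρ m).normed volume (y - x) := by simpa using hval 0
      rw [hval, e0, ← integral_sub (hint t) (by simpa using hint 0), ← integral_smul]
      refine integral_congr_ae (Eventually.of_forall fun x => ?_)
      simp only [smul_eq_mul]
      ring
    simp only [h3] at h1
    rw [tendsto_nhds_unique h1 h2, convolution_eq_swap]
    refine integral_congr_ae (Eventually.of_forall fun x => ?_)
    simp only [hL, ContinuousLinearMap.lsmul_apply, smul_eq_mul]
    ring
  have hbd : ∀ m y e, ‖fderiv ℝ (φ m) y e‖ ≤ K * ‖e‖ := by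
    intro m y e
    rw [hder, convolution]
    have h0 : ∀ x, ‖L ((ρ m).normed volume x) (lineDeriv ℝ w (y - x) e)‖ ≤
        (ρ m).normed volume x * (K * ‖e‖) := by
      intro x
      simp only [hL, ContinuousLinearMap.lsmul_apply, norm_smul]
      rw [Real.norm_of_nonneg ((ρ m).nonneg_normed x)]
      exact mul_le_mul_of_nonneg_left (norm_lineDeriv_le_of_lipschitz ℝ hw)
        ((ρ m).nonneg_normed x)
    refine (norm_integral_le_of_norm_le ((ρ m).integrable_normed.mul_const _)
      (Eventually.of_forall h0)).trans (le_of_eq ?_)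
    rw [integral_mul_const, (ρ m).integral_normed, one_mul]
  have hT0 : Tendsto (fun m => eLpNorm (φ m - w) 2 (volume.restrict G)) atTop (𝓝 0) := by
    refine tendsto_eLpNorm_two_of_bounded (M := K * δ) (fun m =>
      ((hφs m).continuous.sub hw.continuous).aestronglyMeasurable) (fun m => ?_) ?_
    · refine Eventually.of_forall fun x => ?_
      have := hdist m x
      rw [dist_eq_norm] at this
      exact this.trans (mul_le_mul_of_nonneg_left (hout_le m) K.2)
    · refine Eventually.of_forall fun x => ?_
      refine squeeze_zero_norm (fun m => ?_) (by simpa using hlim.const_mul (K : ℝ))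
      have := hdist m x
      rwa [dist_eq_norm] at this
  have hTj : ∀ j, Tendsto (fun m => eLpNorm ((fun y => fderiv ℝ (φ m) y (Pi.single j 1)) -
      fun y => fderiv ℝ w y (Pi.single j 1)) 2 (volume.restrict G)) atTop (𝓝 0) := by
    intro j
    set e : Fin n → ℝ := Pi.single j 1 with he
    refine tendsto_eLpNorm_two_of_bounded (M := K * ‖e‖ + K * ‖e‖) (fun m => ?_) (fun m => ?_) ?_
    · exact (((hφs m).continuous_fderiv (by simp)).clm_apply
        continuous_const).aestronglyMeasurable.sub
        (measurable_fderiv_apply_const ℝ w e).aestronglyMeasurable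
    · refine Eventually.of_forall fun y => (norm_sub_le _ _).trans (add_le_add (hbd m y e) ?_)
      exact ((fderiv ℝ w y).le_opNorm e).trans
        (mul_le_mul_of_nonneg_right (norm_fderiv_le_of_lipschitz ℝ hw) (norm_nonneg _))
    · refine ae_restrict_of_ae ?_
      have h1 := ContDiffBump.ae_convolution_tendsto_right_of_locallyIntegrable (φ := ρ)
        (l := atTop) (K := 2) hlim (Eventually.of_forall fun m => le_of_eq rfl)
        (hw.locallyIntegrable_lineDeriv (μ := volume) e)
      filter_upwards [h1, hw.ae_differentiableAt] with y hy hyd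
      rw [hyd.lineDeriv_eq_fderiv] at hy
      have : Tendsto (fun m => fderiv ℝ (φ m) y e - fderiv ℝ w y e) atTop (𝓝 0) := by
        rw [← sub_self (fderiv ℝ w y e)]
        refine Tendsto.sub_const ?_ _
        simpa only [hder] using hy
      exact this
  have hev := (hT0.eventually (gt_mem_nhds hη)).and
    (eventually_all.2 fun j => (hTj j).eventually (gt_mem_nhds hη))
  obtain ⟨m, hm1, hm2⟩ := hev.exists
  exact ⟨φ m, ⟨hφs m, hφc m, hφt m⟩, hm1, hm2⟩

/-- Subtraction of the truncation at the level `ε`. -/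
def softThreshold (ε x : ℝ) : ℝ := x - max (-ε) (min ε x)

theorem softThreshold_of_abs_le {ε x : ℝ} (h : |x| ≤ ε) : softThreshold ε x = 0 := by
  obtain ⟨h1, h2⟩ := abs_le.1 h
  simp [softThreshold, min_eq_right h2, max_eq_right h1]

theorem abs_softThreshold_sub_le {ε : ℝ} (hε : 0 ≤ ε) (x : ℝ) : |softThreshold ε x - x| ≤ ε := by
  have : softThreshold ε x - x = -max (-ε) (min ε x) := by
    simp [softThreshold]
  rw [this, abs_neg, abs_le]
  exact ⟨le_max_left _ _, max_le (by linarith) (min_le_left _ _)⟩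

theorem lipschitzWith_softThreshold {ε : ℝ} : LipschitzWith 2 (softThreshold ε) := by
  have := LipschitzWith.id.sub ((LipschitzWith.id.const_min ε).const_max (-ε))
  rw [one_add_one_eq_two] at this
  exact this

/-- The function `|v|` is Lipschitz, hence differentiable almost everywhere. Where it vanishes it
has a minimum, so its derivative is zero; then `v` is of smaller order as well. -/
theorem ae_fderiv_eq_zero_of_lipschitz {n : ℕ} {K : NNReal} {v : (Fin n → ℝ) → ℝ}
    (hv : LipschitzWith K v) : ∀ᵐ y, v y = 0 → fderiv ℝ v y = 0 := by
  have habs : LipschitzWith K fun y => |v y| := by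
    simpa [Function.comp_def] using lipschitzWith_one_norm.comp hv
  filter_upwards [habs.ae_differentiableAt] with y hy h0
  have hmin : IsLocalMin (fun y => |v y|) y :=
    Eventually.of_forall fun x => by simp [h0]
  have h1 := hy.hasFDerivAt
  rw [hmin.fderiv_eq_zero, hasFDerivAt_iff_isLittleO] at h1
  refine HasFDerivAt.fderiv ?_
  rw [hasFDerivAt_iff_isLittleO]
  refine Asymptotics.IsLittleO.congr_left (f₁ := fun x => v x) ?_ (fun x => by simp [h0])
  rw [← Asymptotics.isLittleO_norm_left]
  exact h1.congr_left fun x => by simp [h0]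

/-- For small `ε`, thresholding near a point with `v y ≠ 0` just shifts `v` by a constant. Near a
zero of `v` it gives zero, which is why the gradient has to vanish there. -/
theorem eventually_fderiv_softThreshold {n : ℕ} {v : (Fin n → ℝ) → ℝ} (hv : Continuous v)
    {y : Fin n → ℝ} (h0 : v y = 0 → fderiv ℝ v y = 0) {ε : ℕ → ℝ} (hε : ∀ m, 0 < ε m)
    (hlim : Tendsto ε atTop (𝓝 0)) :
    ∀ᶠ m in atTop, fderiv ℝ (fun x => softThreshold (ε m) (v x)) y = fderiv ℝ v y := by
  by_cases hy : v y = 0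
  · refine Eventually.of_forall fun m => ?_
    rw [h0 hy]
    have : (fun x => softThreshold (ε m) (v x)) =ᶠ[𝓝 y] fun _ => 0 := by
      have h1 : ∀ᶠ x in 𝓝 y, |v x| < ε m :=
        (hv.abs.tendsto y).eventually (gt_mem_nhds (by simpa [hy] using hε m))
      filter_upwards [h1] with x hx using softThreshold_of_abs_le hx.le
    rw [this.fderiv_eq]
    simp
  · filter_upwards [hlim.eventually (gt_mem_nhds (abs_pos.2 hy))] with m hm
    have hεm := hε m
    rcases lt_or_gt_of_ne hy with hneg | hpos
    · have h1 : ∀ᶠ x in 𝓝 y, v x < -ε m := (hv.tendsto y).eventually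
        (gt_mem_nhds (by rw [abs_of_neg hneg] at hm; linarith))
      have : (fun x => softThreshold (ε m) (v x)) =ᶠ[𝓝 y] fun x => v x + ε m := by
        filter_upwards [h1] with x hx
        simp only [softThreshold]
        rw [min_eq_right (by linarith), max_eq_left hx.le]
        ring
      rw [this.fderiv_eq, fderiv_add_const]
    · have h1 : ∀ᶠ x in 𝓝 y, ε m < v x := (hv.tendsto y).eventually
        (lt_mem_nhds (by rwa [abs_of_pos hpos] at hm))
      have : (fun x => softThreshold (ε m) (v x)) =ᶠ[𝓝 y] fun x => v x - ε m := by
        filter_upwards [h1] with x hx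
        simp only [softThreshold]
        rw [min_eq_left hx.le, max_eq_right (by linarith)]
      rw [this.fderiv_eq, fderiv_sub_const]

/-- Thresholding at level `ε` confines the support to the closed set `{ε ≤ |v|}`, which lies inside
`G`. Mollifying the thresholded functions with errors below `1 / (m + 1)` gives the approximating
test functions. -/
theorem isH10_of_lipschitz {n : ℕ} {G : Set (Fin n → ℝ)} (hG : IsOpen G)
    (hGb : Bornology.IsBounded G) {K : NNReal} {v : (Fin n → ℝ) → ℝ} (hv : LipschitzWith K v)
    (hv0 : ∀ y, y ∉ G → v y = 0) :
    IsH10 G v fun j y => fderiv ℝ v y (Pi.single j 1) := by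
  have : IsFiniteMeasure (volume.restrict G) := ⟨by
    rw [Measure.restrict_apply_univ]
    exact hGb.measure_lt_top⟩
  have hfd : ∀ {K' : NNReal} {f : (Fin n → ℝ) → ℝ}, LipschitzWith K' f → ∀ y j,
      ‖fderiv ℝ f y (Pi.single j 1)‖ ≤ K' := by
    intro K' f hf y j
    refine ((fderiv ℝ f y).le_opNorm _).trans ?_
    rw [Pi.norm_single]
    simpa using norm_fderiv_le_of_lipschitz ℝ hf
  have hvc : HasCompactSupport v := by
    refine HasCompactSupport.of_support_subset_isCompact hGb.isCompact_closure fun y hy => ?_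
    by_contra hc
    exact hy (hv0 y fun h => hc (subset_closure h))
  obtain ⟨M, hM⟩ := hvc.exists_bound_of_continuous hv.continuous
  set ε : ℕ → ℝ := fun m => 1 / ((m : ℝ) + 1) with hε
  have hε0 : ∀ m, 0 < ε m := fun m => by positivity
  have hεlim : Tendsto ε atTop (𝓝 0) := tendsto_one_div_add_atTop_nhds_zero_nat
  set w : ℕ → (Fin n → ℝ) → ℝ := fun m y => softThreshold (ε m) (v y) with hw
  have hwl : ∀ m, LipschitzWith (2 * K) (w m) := fun m => lipschitzWith_softThreshold.comp hv
  have hwsupp : ∀ m, tsupport (w m) ⊆ G := by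
    intro m
    have hcl : IsClosed {y | ε m ≤ |v y|} := isClosed_le continuous_const hv.continuous.abs
    have : tsupport (w m) ⊆ {y | ε m ≤ |v y|} := by
      refine closure_minimal (fun y hy => ?_) hcl
      by_contra hc
      exact hy (softThreshold_of_abs_le (not_le.1 hc).le)
    refine this.trans fun y hy => ?_
    by_contra hc
    have h1 : ε m ≤ |v y| := hy
    rw [hv0 y hc, abs_zero] at h1
    exact absurd (hε0 m) (not_lt.2 h1)
  have hwc : ∀ m, HasCompactSupport (w m) := fun m =>
    HasCompactSupport.of_support_subset_isCompact hGb.isCompact_closure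
      ((subset_tsupport _).trans ((hwsupp m).trans subset_closure))
  have hηpos : ∀ m : ℕ, (0 : ENNReal) < ((m : ENNReal) + 1)⁻¹ := fun m => by
    simp
  choose φ hφ hφ0 hφj using fun m =>
    exists_test_function_of_lipschitz hG hGb (hwl m) (hwc m) (hwsupp m) (hηpos m)
  have hηlim : Tendsto (fun m : ℕ => ((m : ENNReal) + 1)⁻¹) atTop (𝓝 0) := by
    have := (tendsto_add_atTop_iff_nat 1).2 ENNReal.tendsto_inv_nat_nhds_zero
    simpa using this
  have hw0 : Tendsto (fun m => eLpNorm (w m - v) 2 (volume.restrict G)) atTop (𝓝 0) := by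
    have hb : ∀ m y, ‖(w m - v) y‖ ≤ ε m := fun m y => abs_softThreshold_sub_le (hε0 m).le _
    refine tendsto_eLpNorm_two_of_bounded (M := 1) (fun m =>
      ((hwl m).continuous.sub hv.continuous).aestronglyMeasurable) (fun m => ?_) ?_
    · refine Eventually.of_forall fun y => (hb m y).trans ?_
      simp only [hε]
      rw [div_le_one (by positivity)]
      simp
    · exact Eventually.of_forall fun y => squeeze_zero_norm (fun m => hb m y) hεlim
  have hmf : ∀ (f : (Fin n → ℝ) → ℝ) (j : Fin n), AEStronglyMeasurable
      (fun y => fderiv ℝ f y (Pi.single j 1)) (volume.restrict G) := fun f j =>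
    (measurable_fderiv_apply_const ℝ f (Pi.single j 1)).aestronglyMeasurable
  have hwj : ∀ j, Tendsto (fun m => eLpNorm ((fun y => fderiv ℝ (w m) y (Pi.single j 1)) -
      fun y => fderiv ℝ v y (Pi.single j 1)) 2 (volume.restrict G)) atTop (𝓝 0) := by
    intro j
    refine tendsto_eLpNorm_two_of_bounded (M := (2 * K : NNReal) + K)
      (fun m => (hmf _ j).sub (hmf _ j)) (fun m => ?_) ?_
    · exact Eventually.of_forall fun y =>
        (norm_sub_le _ _).trans (add_le_add (hfd (hwl m) y j) (hfd hv y j))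
    · refine ae_restrict_of_ae ?_
      filter_upwards [ae_fderiv_eq_zero_of_lipschitz hv] with y hy
      refine tendsto_const_nhds.congr' ?_
      filter_upwards [eventually_fderiv_softThreshold hv.continuous hy hε0 hεlim] with m hm
      simp only [Pi.sub_apply, hw, hm, sub_self]
  have combine : ∀ {a b : ℕ → (Fin n → ℝ) → ℝ} {c : (Fin n → ℝ) → ℝ},
      (∀ m, AEStronglyMeasurable (a m) (volume.restrict G)) →
      (∀ m, AEStronglyMeasurable (b m) (volume.restrict G)) →
      AEStronglyMeasurable c (volume.restrict G) →
      (∀ m : ℕ, eLpNorm (a m - b m) 2 (volume.restrict G) < ((m : ENNReal) + 1)⁻¹) →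
      Tendsto (fun m => eLpNorm (b m - c) 2 (volume.restrict G)) atTop (𝓝 0) →
      Tendsto (fun m => eLpNorm (a m - c) 2 (volume.restrict G)) atTop (𝓝 0) := by
    intro a b c ha hb hc hab hbc
    have hs := hηlim.add hbc
    rw [add_zero] at hs
    refine tendsto_of_tendsto_of_tendsto_of_le_of_le tendsto_const_nhds hs (fun _ => zero_le)
      fun m => ?_
    have e : a m - c = (a m - b m) + (b m - c) := by abel
    simp only [e]
    exact (eLpNorm_add_le ((ha m).sub (hb m)) ((hb m).sub hc) (by norm_num)).trans
      (add_le_add (hab m).le le_rfl)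
  refine ⟨MemLp.of_bound hv.continuous.aestronglyMeasurable M (Eventually.of_forall hM),
    fun j => MemLp.of_bound (hmf v j) K (Eventually.of_forall fun y => hfd hv y j),
    φ, hφ, ?_, fun j => ?_⟩
  · exact combine (fun m => (hφ m).1.continuous.aestronglyMeasurable)
      (fun m => (hwl m).continuous.aestronglyMeasurable) hv.continuous.aestronglyMeasurable
      hφ0 hw0
  · exact combine (fun m => hmf (φ m) j) (fun m => hmf (w m) j) (hmf v j)
      (fun m => hφj m j) (hwj j)

/-! ### Lipschitz functions on space-time cylinders -/

/-- A segment from a point of `G` to a point outside meets the boundary, where `f` vanishes. The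
value at the inner point is therefore controlled by its distance to the crossing point. -/
theorem lipschitzWith_indicator {n : ℕ} {G : Set (Fin n → ℝ)} (hG : IsOpen G) {K : NNReal}
    {f : (Fin n → ℝ) → ℝ} (hf : LipschitzWith K f) (h0 : ∀ y ∈ closure G, y ∉ G → f y = 0) :
    LipschitzWith K (G.indicator f) := by
  have key : ∀ x y, x ∈ G → y ∉ G → |f x| ≤ K * dist x y := by
    intro x y hx hy
    obtain ⟨z, hz, hzG, hz'⟩ : ∃ z ∈ segment ℝ x y, z ∈ closure G ∧ z ∉ G := by
      by_contra! hc
      refine hy ((convex_segment x y).isPreconnected.subset_left_of_subset_union hG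
        isClosed_closure.isOpen_compl (Set.disjoint_compl_right_iff_subset.2 subset_closure)
        (fun z hz => ?_) ⟨x, left_mem_segment ℝ x y, hx⟩ (right_mem_segment ℝ x y))
      by_cases hzc : z ∈ closure G
      · exact Or.inl (hc z hz hzc)
      · exact Or.inr hzc
    have h1 := hf.dist_le_mul x z
    rw [h0 z hzG hz', dist_zero_right, Real.norm_eq_abs] at h1
    refine h1.trans (mul_le_mul_of_nonneg_left ?_ K.2)
    have := dist_add_dist_of_mem_segment hz
    linarith [dist_nonneg (x := z) (y := y)]
  refine LipschitzWith.of_dist_le_mul fun x y => ?_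
  by_cases hx : x ∈ G <;> by_cases hy : y ∈ G
  · rw [Set.indicator_of_mem hx, Set.indicator_of_mem hy]
    exact hf.dist_le_mul x y
  · rw [Set.indicator_of_mem hx, Set.indicator_of_notMem hy, dist_zero_right]
    exact key x y hx hy
  · rw [Set.indicator_of_notMem hx, Set.indicator_of_mem hy, dist_zero_left, dist_comm x y]
    exact key y x hy hx
  · rw [Set.indicator_of_notMem hx, Set.indicator_of_notMem hy, dist_self]
    positivity

theorem dist_cons_cons {d : ℕ} (t t' : ℝ) (y y' : Fin d → ℝ) :
    dist (Fin.cons t y : Fin (d + 1) → ℝ) (Fin.cons t' y') = max (dist t t') (dist y y') := by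
  apply le_antisymm
  · refine (dist_pi_le_iff (le_max_of_le_left dist_nonneg)).2 fun i => ?_
    refine Fin.cases ?_ (fun j => ?_) i
    · simp
    · simpa using Or.inr (dist_le_pi_dist y y' j)
  · refine max_le ?_ ((dist_pi_le_iff dist_nonneg).2 fun j => ?_)
    · simpa using dist_le_pi_dist (Fin.cons t y : Fin (d + 1) → ℝ) (Fin.cons t' y') 0
    · simpa using dist_le_pi_dist (Fin.cons t y : Fin (d + 1) → ℝ) (Fin.cons t' y') j.succ

/-- A Lipschitz function that vanishes on the lateral boundary belongs to `L²(I; H¹₀(G))`. -/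
theorem memL2H10_of_lipschitz {d : ℕ} {T : ℝ} (hT : 0 < T) {G : Set (Fin d → ℝ)}
    (hG : IsOpen G) (hGb : Bornology.IsBounded G) {K : NNReal} {U : (Fin (d + 1) → ℝ) → ℝ}
    (hU : LipschitzWith K U)
    (h0 : ∀ t ∈ Set.Icc 0 T, ∀ y ∈ closure G, y ∉ G → U (Fin.cons t y) = 0)
    {u : ℝ → (Fin d → ℝ) → ℝ}
    (hu : ∀ t ∈ Set.Ioo 0 T, u t = G.indicator fun y => U (Fin.cons t y)) :
    MemL2H10 T G u := by
  -- Freezing time outside the interval extends the slices to all times with joint continuity, and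
  -- so gives joint measurability of the spatial gradient.
  set c : ℝ → ℝ := fun t => max 0 (min T t) with hc
  have hc1 : LipschitzWith 1 c := (LipschitzWith.id.const_min T).const_max 0
  have hcI : ∀ t, c t ∈ Set.Icc 0 T := fun t =>
    ⟨le_max_left _ _, max_le hT.le (min_le_left _ _)⟩
  have hceq : ∀ t ∈ Set.Ioo 0 T, c t = t := fun t ht => by
    simp only [hc]
    rw [min_eq_right ht.2.le, max_eq_right ht.1.le]
  set V : ℝ → (Fin d → ℝ) → ℝ := fun t => G.indicator fun y => U (Fin.cons (c t) y) with hV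
  have hVu : ∀ t ∈ Set.Ioo 0 T, u t = V t := fun t ht => by
    simp only [hV]
    rw [hu t ht, hceq t ht]
  have hVy : ∀ t, LipschitzWith K (V t) := fun t =>
    lipschitzWith_indicator hG (LipschitzWith.of_dist_le_mul fun y y' => by
      refine (hU.dist_le_mul _ _).trans (le_of_eq ?_)
      rw [dist_cons_cons, dist_self, max_eq_right dist_nonneg])
      (h0 (c t) (hcI t))
  have hVt : ∀ y, LipschitzWith K fun t => V t y := fun y =>
    LipschitzWith.of_dist_le_mul fun t t' => by
      by_cases hy : y ∈ G
      · simp only [hV, Set.indicator_of_mem hy]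
        refine (hU.dist_le_mul _ _).trans (mul_le_mul_of_nonneg_left ?_ K.2)
        rw [dist_cons_cons, dist_self, max_eq_left dist_nonneg]
        simpa using hc1.dist_le_mul t t'
      · simp only [hV, Set.indicator_of_notMem hy, dist_self]
        positivity
  have hVc : Continuous (Function.uncurry V) := (LipschitzWith.uncurry hVt hVy).continuous
  obtain ⟨M, hM⟩ : ∃ M : ℝ, ∀ t y, ‖V t y‖ ≤ M := by
    obtain ⟨R, hR⟩ := hGb.exists_norm_le
    refine ⟨max 0 (‖U 0‖ + K * max T R), fun t y => ?_⟩
    by_cases hy : y ∈ G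
    · simp only [hV, Set.indicator_of_mem hy]
      refine le_max_of_le_right ?_
      have h1 := hU.dist_le_mul (Fin.cons (c t) y) 0
      have h2 : (0 : Fin (d + 1) → ℝ) = Fin.cons 0 0 := by
        funext i
        refine Fin.cases ?_ (fun j => ?_) i <;> simp
      have h3 : dist (Fin.cons (c t) y : Fin (d + 1) → ℝ) 0 ≤ max T R := by
        rw [h2, dist_cons_cons, dist_zero_right, dist_zero_right]
        refine max_le_max ?_ (hR y hy)
        rw [Real.norm_of_nonneg (hcI t).1]
        exact (hcI t).2
      have h4 := norm_le_norm_add_norm_sub' (U (Fin.cons (c t) y)) (U 0)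
      rw [← dist_eq_norm] at h4
      refine h4.trans (add_le_add le_rfl (h1.trans ?_))
      gcongr
    · simp only [hV, Set.indicator_of_notMem hy, norm_zero]
      exact le_max_left _ _
  have hfin : IsFiniteMeasure ((volume.restrict (Set.Ioo 0 T)).prod (volume.restrict G)) := by
    have : IsFiniteMeasure (volume.restrict G) := ⟨by
      rw [Measure.restrict_apply_univ]
      exact hGb.measure_lt_top⟩
    infer_instance
  refine ⟨?_, fun j t y => fderiv ℝ (V t) y (Pi.single j 1), fun j => ?_, ?_⟩
  · have hmem : MemLp (Function.uncurry V) 2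
        ((volume.restrict (Set.Ioo 0 T)).prod (volume.restrict G)) :=
      MemLp.of_bound hVc.aestronglyMeasurable M (Eventually.of_forall fun p => hM p.1 p.2)
    refine (memLp_congr_ae ?_).2 hmem
    rw [Measure.prod_restrict]
    refine (ae_restrict_iff' (measurableSet_Ioo.prod hG.measurableSet)).2
      (Eventually.of_forall fun p hp => ?_)
    exact congrFun (hVu p.1 hp.1) p.2
  · refine MemLp.of_bound
      (measurable_fderiv_apply_const_with_param ℝ hVc (Pi.single j 1)).aestronglyMeasurable K
      (Eventually.of_forall fun p => ?_)
    refine ((fderiv ℝ (V p.1) p.2).le_opNorm _).trans ?_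
    rw [Pi.norm_single]
    simpa using norm_fderiv_le_of_lipschitz ℝ (hVy p.1)
  · refine (ae_restrict_iff' measurableSet_Ioo).2 (Eventually.of_forall fun t ht => ?_)
    rw [hVu t ht]
    exact isH10_of_lipschitz hG hGb (hVy t) fun y hy => Set.indicator_of_notMem hy _

/-! ### Geometry of triangulated cylinders -/

section Cylinder

variable {d : ℕ} {T : ℝ} {G : Set (Fin d → ℝ)}

theorem mem_closure_stCylinder (hT : 0 < T) {x : Fin (d + 1) → ℝ} :
    x ∈ closure (stCylinder T G) ↔ x 0 ∈ Set.Icc 0 T ∧ Fin.tail x ∈ closure G := by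
  set e := (Fin.consEquivL ℝ fun _ : Fin (d + 1) => ℝ).symm.toHomeomorph with he
  have h1 : stCylinder T G = Set.preimage e (Set.Ioo 0 T ×ˢ G) := rfl
  rw [h1, ← e.preimage_closure, closure_prod_eq, closure_Ioo hT.ne]
  rfl

/-- Choose `y` on the segment from `x` to `q` over `G`, and `z` slightly beyond `x`. Each simplex
meeting a small neighbourhood of `y` contains `y`, hence also `z`. By convexity, the homothety
centred at `z` that takes `y` to `x` maps nearby points of the closed cylinder into it. So a
neighbourhood of the spatial part of `x` lies in `closure G`, whose interior is `G`. -/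
theorem mem_of_bary_pos (hT : 0 < T) (hG : IsOpen G) (hGi : interior (closure G) = G)
    {𝒯 : Finset (Finset (Fin (d + 1) → ℝ))} (h : IsRegularTriangulation 𝒯 (stCylinder T G))
    {σ : Finset (Fin (d + 1) → ℝ)} (hσ : σ ∈ 𝒯) {x q : Fin (d + 1) → ℝ}
    (hx : x ∈ convexHull ℝ (σ : Set (Fin (d + 1) → ℝ))) (hq : q ∈ σ) (hqx : 0 < bary σ q x)
    (hqG : Fin.tail q ∈ G) : Fin.tail x ∈ G := by
  classical
  have Hσ := h.isSimplex hσ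
  have htail : Continuous (Fin.tail : (Fin (d + 1) → ℝ) → Fin d → ℝ) :=
    continuous_pi fun i => continuous_apply i.succ
  obtain ⟨r, hr0, hr1, hrG⟩ : ∃ r : ℝ, 0 < r ∧ r < 1 ∧
      Fin.tail (AffineMap.lineMap x q r : Fin (d + 1) → ℝ) ∈ G := by
    have hc : Continuous fun r : ℝ => Fin.tail (AffineMap.lineMap x q r : Fin (d + 1) → ℝ) :=
      htail.comp AffineMap.lineMap_continuous
    have h1 : ∀ᶠ r : ℝ in 𝓝[<] 1,
        Fin.tail (AffineMap.lineMap x q r : Fin (d + 1) → ℝ) ∈ G := by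
      refine (hc.tendsto 1).mono_left nhdsWithin_le_nhds |>.eventually (hG.mem_nhds ?_)
      simpa using hqG
    have h2 : ∀ᶠ r : ℝ in 𝓝[<] 1, r ∈ Set.Ioo (0 : ℝ) 1 := Ioo_mem_nhdsLT one_pos
    obtain ⟨r, hr, hr'⟩ := (h1.and h2).exists
    exact ⟨r, hr'.1, hr'.2, hr⟩
  set y : Fin (d + 1) → ℝ := AffineMap.lineMap x q r with hy
  set δ : ℝ := bary σ q x with hδ
  set z : Fin (d + 1) → ℝ := AffineMap.lineMap x q (-δ) with hz
  have hline : ∀ (p : Fin (d + 1) → ℝ) (s : ℝ),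
      bary σ p (AffineMap.lineMap x q s) = (1 - s) * bary σ p x + s * bary σ p q := by
    intro p s
    rw [AffineMap.apply_lineMap, AffineMap.lineMap_apply_ring]
  have hqσ : q ∈ convexHull ℝ (σ : Set (Fin (d + 1) → ℝ)) := subset_convexHull ℝ _ hq
  have hyσ : y ∈ convexHull ℝ (σ : Set (Fin (d + 1) → ℝ)) :=
    (convex_convexHull ℝ _).lineMap_mem hx hqσ ⟨hr0.le, hr1.le⟩
  -- the simplices that contain `y` contain `z`, too
  have hzτ : ∀ τ ∈ 𝒯, y ∈ convexHull ℝ (τ : Set (Fin (d + 1) → ℝ)) →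
      z ∈ convexHull ℝ (τ : Set (Fin (d + 1) → ℝ)) := by
    intro τ hτ hyτ
    have hsub : ∀ p, 0 < bary σ p x → p ∈ τ := by
      intro p hp
      by_contra hc
      have h1 := h.bary_eq hσ hτ hyσ hyτ p
      rw [hline, bary_of_notMem hc] at h1
      have h2 : 0 < (1 - r) * bary σ p x := mul_pos (by linarith) hp
      have h3 := mul_nonneg hr0.le (Hσ.bary_nonneg hqσ p)
      simp only [AffineMap.coe_zero, Pi.zero_apply] at h1
      linarith
    have hz0 : ∀ p, p ∉ σ ∩ τ → bary σ p z = 0 := by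
      intro p hp
      by_cases hpσ : p ∈ σ
      · have hpτ : p ∉ τ := fun h' => hp (Finset.mem_inter.2 ⟨hpσ, h'⟩)
        have hpx : bary σ p x = 0 :=
          le_antisymm (not_lt.1 fun h' => hpτ (hsub p h')) (Hσ.bary_nonneg hx p)
        have hpq : p ≠ q := by
          rintro rfl
          exact hqx.ne' hpx
        rw [hline, hpx, Hσ.bary_ne hq hpq]
        ring
      · simp [bary_of_notMem hpσ]
    have hzb : IsBarycentric (σ ∩ τ) z fun p => bary σ p z := by
      refine ⟨fun p => ?_, hz0, ?_, ?_⟩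
      · rw [hline]
        by_cases hpq : p = q
        · subst hpq
          rw [Hσ.bary_self hq, ← hδ]
          nlinarith
        · rw [Hσ.bary_ne hq hpq, mul_zero, add_zero]
          exact mul_nonneg (by linarith) (Hσ.bary_nonneg hx p)
      · rw [← Hσ.sum_bary z]
        exact Finset.sum_subset Finset.inter_subset_left fun p _ hp => hz0 p hp
      · conv_rhs => rw [← Hσ.sum_bary_smul z]
        exact Finset.sum_subset Finset.inter_subset_left fun p _ hp => by
          rw [hz0 p hp, zero_smul]
    exact (hzb.mono Finset.inter_subset_right).mem_convexHull
  have hnear : ∀ᶠ y' in 𝓝 y, ∀ τ ∈ 𝒯, y' ∈ convexHull ℝ (τ : Set (Fin (d + 1) → ℝ)) →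
      y ∈ convexHull ℝ (τ : Set (Fin (d + 1) → ℝ)) := by
    rw [Filter.eventually_all_finset]
    intro τ _
    by_cases hyτ : y ∈ convexHull ℝ (τ : Set (Fin (d + 1) → ℝ))
    · exact Eventually.of_forall fun _ _ => hyτ
    · have hcl : IsClosed (convexHull ℝ (τ : Set (Fin (d + 1) → ℝ))) :=
        (Finset.finite_toSet τ).isClosed_convexHull ℝ
      filter_upwards [hcl.isOpen_compl.mem_nhds hyτ] with y' hy' hy''
      exact absurd hy'' hy'
  -- The solution of `(1 - t) (-δ) + t r = 0`, so that the homothety takes `y` to `x`.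
  set t : ℝ := δ / (δ + r) with ht
  have hδr : 0 < δ + r := by linarith
  have ht0 : 0 < t := div_pos hqx hδr
  have ht1 : t ≤ 1 := (div_le_one hδr).2 (by linarith)
  -- The point whose image under the homothety has spatial part `a`. Its time is kept at that of
  -- `y`, which guarantees that it remains in the closed cylinder even at the initial and final
  -- times.
  set Y : (Fin d → ℝ) → Fin (d + 1) → ℝ := fun a =>
    y + Fin.cons 0 (t⁻¹ • (a - Fin.tail x)) with hY
  have hYc : Continuous Y := by
    have h1 : Continuous fun a : Fin d → ℝ => t⁻¹ • (a - Fin.tail x) := by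
      fun_prop
    have h2 : Continuous fun a : Fin d → ℝ =>
        (Fin.cons 0 (t⁻¹ • (a - Fin.tail x)) : Fin (d + 1) → ℝ) :=
      Continuous.finCons (A := fun _ => ℝ) continuous_const h1
    exact continuous_const.add h2
  have hYx : Y (Fin.tail x) = y := by
    funext i
    refine Fin.cases ?_ (fun j => ?_) i <;> simp [hY]
  have hev1 : ∀ᶠ a in 𝓝 (Fin.tail x), ∀ τ ∈ 𝒯,
      Y a ∈ convexHull ℝ (τ : Set (Fin (d + 1) → ℝ)) →
        y ∈ convexHull ℝ (τ : Set (Fin (d + 1) → ℝ)) := by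
    have := hYc.tendsto (Fin.tail x)
    rw [hYx] at this
    exact this.eventually hnear
  have hev2 : ∀ᶠ a in 𝓝 (Fin.tail x), Fin.tail (Y a) ∈ G := by
    have := (htail.comp hYc).tendsto (Fin.tail x)
    simp only [Function.comp_apply, hYx] at this
    exact this.eventually (hG.mem_nhds hrG)
  have hy0 : y 0 ∈ Set.Icc 0 T :=
    ((mem_closure_stCylinder hT).1 (h.convexHull_subset hσ hyσ)).1
  rw [← hGi, mem_interior_iff_mem_nhds]
  filter_upwards [hev1, hev2] with a ha1 ha2
  have hYD : Y a ∈ closure (stCylinder T G) := by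
    rw [mem_closure_stCylinder hT]
    exact ⟨by simpa [hY] using hy0, subset_closure ha2⟩
  obtain ⟨τ, hτ, hYτ⟩ := h.exists_mem hYD
  have hmem : (AffineMap.lineMap z (Y a) t : Fin (d + 1) → ℝ) ∈
      convexHull ℝ (τ : Set (Fin (d + 1) → ℝ)) :=
    (convex_convexHull ℝ _).lineMap_mem (hzτ τ hτ (ha1 τ hτ hYτ)) hYτ ⟨ht0.le, ht1⟩
  have hfin := ((mem_closure_stCylinder hT).1 (h.convexHull_subset hτ hmem)).2
  convert hfin using 1
  funext j
  have e : (1 - t) * δ = t * r := by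
    rw [ht]
    field_simp
    ring
  simp only [Fin.tail, AffineMap.lineMap_apply_module, hz, hY, hy, Pi.add_apply, Pi.smul_apply,
    smul_eq_mul, Fin.cons_succ, Pi.sub_apply]
  have e2 : t * (t⁻¹ * (a j - x j.succ)) = a j - x j.succ := by
    rw [← mul_assoc, mul_inv_cancel₀ ht0.ne', one_mul]
  linear_combination (q j.succ - x j.succ) * e - e2

end Cylinder

/-! ### Nodal values of continuous piecewise linear functions -/

/-- The extension by zero of a function on `X`. -/
def zeroExt {n : ℕ} {X : Set (Fin n → ℝ)} (u : X → ℝ) : (Fin n → ℝ) → ℝ :=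
  Function.extend Subtype.val u 0

theorem zeroExt_apply {n : ℕ} {X : Set (Fin n → ℝ)} (u : X → ℝ) {x : Fin n → ℝ} (hx : x ∈ X) :
    zeroExt u x = u ⟨x, hx⟩ :=
  Subtype.val_injective.extend_apply u 0 ⟨x, hx⟩

theorem zeroExt_of_notMem {n : ℕ} {X : Set (Fin n → ℝ)} (u : X → ℝ) {x : Fin n → ℝ}
    (hx : x ∉ X) : zeroExt u x = 0 :=
  Function.extend_apply' _ _ _ fun ⟨a, ha⟩ => hx (ha ▸ a.2)

theorem asTimeSpace_apply {d : ℕ} {X : Set (Fin (d + 1) → ℝ)} (u : X → ℝ) (t : ℝ)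
    (y : Fin d → ℝ) : asTimeSpace X u t y = zeroExt u (Fin.cons t y) := rfl

namespace IsRegularTriangulation

variable {n : ℕ} {𝒯 : Finset (Finset (Fin n → ℝ))} {D : Set (Fin n → ℝ)}

theorem sum_hat_eq (h : IsRegularTriangulation 𝒯 D) {σ : Finset (Fin n → ℝ)} (hσ : σ ∈ 𝒯)
    {x : Fin n → ℝ} (hx : x ∈ convexHull ℝ (σ : Set (Fin n → ℝ))) (c : (Fin n → ℝ) → ℝ) :
    ∑ p ∈ vertices 𝒯, c p * hat 𝒯 p x = ∑ p ∈ σ, c p * bary σ p x := by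
  simp only [h.hat_eq_bary hσ hx]
  symm
  refine Finset.sum_subset (fun p hp => mem_vertices.2 ⟨σ, hσ, hp⟩) fun p _ hp => ?_
  simp [bary_of_notMem hp]

theorem eq_sum_bary (h : IsRegularTriangulation 𝒯 D) {u : closure D → ℝ}
    (hu : u ∈ S1 𝒯 (closure D)) {σ : Finset (Fin n → ℝ)} (hσ : σ ∈ 𝒯) (x : closure D)
    (hx : (x : Fin n → ℝ) ∈ convexHull ℝ (σ : Set (Fin n → ℝ))) :
    u x = ∑ p ∈ σ, zeroExt u p * bary σ p x := by
  obtain ⟨f, hf⟩ := hu.2 σ hσ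
  rw [hf x hx, (h.isSimplex hσ).affineMap_eq f]
  refine Finset.sum_congr rfl fun p hp => ?_
  have hpσ : p ∈ convexHull ℝ (σ : Set (Fin n → ℝ)) := subset_convexHull ℝ _ hp
  rw [zeroExt_apply u (h.convexHull_subset hσ hpσ), hf _ hpσ, mul_comm]

theorem eq_sum_hat (h : IsRegularTriangulation 𝒯 D) {u : closure D → ℝ}
    (hu : u ∈ S1 𝒯 (closure D)) (x : closure D) :
    u x = ∑ p ∈ vertices 𝒯, zeroExt u p * hat 𝒯 p x := by
  obtain ⟨σ, hσ, hx⟩ := h.exists_mem x.2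
  rw [h.sum_hat_eq hσ hx, h.eq_sum_bary hu hσ x hx]

/-- The realization of the emulating network is defined on the whole space and Lipschitz. Continuity
across simplices and a Lipschitz extension thus come together; the size of the network plays no
role. -/
theorem exists_lipschitz_eq_sum_hat (h : IsRegularTriangulation 𝒯 D) (c : (Fin n → ℝ) → ℝ) :
    ∃ (K : NNReal) (U : (Fin n → ℝ) → ℝ), LipschitzWith K U ∧
      ∀ x ∈ closure D, U x = ∑ p ∈ vertices 𝒯, c p * hat 𝒯 p x := by
  obtain ⟨Φ, h1, h2, -⟩ := h.exists_network (ι := vertices 𝒯) (fun p => p) (fun p => p.2)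
    (Matrix.of fun (_ : Fin 1) p => c p)
    (L₁ := ∑ p : vertices 𝒯, numSharing 𝒯 p) (L₂ := n + 1)
    (fun p => Nat.lt_two_pow_self.le.trans (Nat.pow_le_pow_right (by norm_num)
      (Finset.single_le_sum (f := fun p : vertices 𝒯 => numSharing 𝒯 p)
        (fun _ _ => Nat.zero_le _) (Finset.mem_univ p))))
    Nat.lt_two_pow_self.le rfl rfl le_rfl
  obtain ⟨K, hK⟩ := h1.exists_lipschitzWith
  refine ⟨K, fun x => Φ.realize x 0, LipschitzWith.of_dist_le_mul fun x y =>
    (dist_le_pi_dist _ _ 0).trans (hK.dist_le_mul x y), fun x hx => ?_⟩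
  simp only [h2 x hx, Matrix.mulVec, dotProduct, Matrix.of_apply]
  exact Finset.sum_coe_sort (vertices 𝒯) fun p => c p * hat 𝒯 p x

theorem sum_hat_mem_S1 (h : IsRegularTriangulation 𝒯 D) (c : (Fin n → ℝ) → ℝ) :
    (fun x : closure D => ∑ p ∈ vertices 𝒯, c p * hat 𝒯 p x) ∈ S1 𝒯 (closure D) := by
  obtain ⟨K, U, hU, hUc⟩ := h.exists_lipschitz_eq_sum_hat c
  refine ⟨?_, fun σ hσ => ⟨∑ p ∈ σ, c p • bary σ p, fun x hx => ?_⟩⟩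
  · have e : (fun x : closure D => ∑ p ∈ vertices 𝒯, c p * hat 𝒯 p x) = U ∘ Subtype.val :=
      funext fun x => (hUc x x.2).symm
    rw [e]
    exact hU.continuous.comp continuous_subtype_val
  · refine (h.sum_hat_eq hσ hx c).trans ?_
    have : ∀ s : Finset (Fin n → ℝ), (∑ p ∈ s, c p • bary σ p) (x : Fin n → ℝ) =
        ∑ p ∈ s, c p * bary σ p x := by
      classical
      intro s
      induction s using Finset.induction_on with
      | empty => simp
      | insert a s ha ih => rw [Finset.sum_insert ha, Finset.sum_insert ha, AffineMap.coe_add,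
          Pi.add_apply, ih, AffineMap.coe_smul, Pi.smul_apply, smul_eq_mul]
    exact (this σ).symm

theorem sum_hat_vertex (h : IsRegularTriangulation 𝒯 D) (c : (Fin n → ℝ) → ℝ)
    {q : Fin n → ℝ} (hq : q ∈ vertices 𝒯) : ∑ p ∈ vertices 𝒯, c p * hat 𝒯 p q = c q := by
  rw [Finset.sum_eq_single q (fun p _ hpq => by rw [h.hat_ne hq hpq, mul_zero])
    fun h' => absurd hq h', h.hat_self hq, mul_one]

end IsRegularTriangulation

/-! ### The first component -/

section Cylinder

variable {d : ℕ} {T : ℝ} {G : Set (Fin d → ℝ)} {𝒯 : Finset (Finset (Fin (d + 1) → ℝ))}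

theorem eq_zero_of_mem_lateral (hT : 0 < T) (hG : IsPolytopalDomain G)
    (h : IsRegularTriangulation 𝒯 (stCylinder T G)) {u : closure (stCylinder T G) → ℝ}
    (hu : u ∈ S1 𝒯 (closure (stCylinder T G)))
    (h0 : ∀ p ∈ vertices 𝒯, Fin.tail p ∉ G → zeroExt u p = 0)
    (x : closure (stCylinder T G)) (hx : Fin.tail (x : Fin (d + 1) → ℝ) ∉ G) : u x = 0 := by
  obtain ⟨σ, hσ, hxσ⟩ := h.exists_mem x.2
  rw [h.eq_sum_bary hu hσ x hxσ]
  refine Finset.sum_eq_zero fun p hp => ?_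
  rcases ((h.isSimplex hσ).bary_nonneg hxσ p).eq_or_lt with he | hlt
  · rw [← he, mul_zero]
  · rw [h0 p (mem_vertices.2 ⟨σ, hσ, hp⟩) fun hpG => hx
      (mem_of_bary_pos hT hG.isOpen hG.interior_closure h hσ hxσ hp hlt hpG), zero_mul]

theorem memL2H10_of_nodal (hT : 0 < T) (hG : IsPolytopalDomain G)
    (h : IsRegularTriangulation 𝒯 (stCylinder T G)) {u : closure (stCylinder T G) → ℝ}
    (hu : u ∈ S1 𝒯 (closure (stCylinder T G)))
    (h0 : ∀ p ∈ vertices 𝒯, Fin.tail p ∉ G → zeroExt u p = 0) :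
    asTimeSpace (closure (stCylinder T G)) u ∈ L2H10 T G := by
  obtain ⟨K, U, hU, hUu⟩ := h.exists_lipschitz_eq_sum_hat (zeroExt u)
  have hUx : ∀ x : closure (stCylinder T G), U x = u x := fun x => by
    rw [hUu x x.2, h.eq_sum_hat hu x]
  have hlat : ∀ t ∈ Set.Icc 0 T, ∀ y ∈ closure G, y ∉ G →
      (Fin.cons t y : Fin (d + 1) → ℝ) ∈ closure (stCylinder T G) ∧ U (Fin.cons t y) = 0 := by
    intro t ht y hy hyG
    have hmem : (Fin.cons t y : Fin (d + 1) → ℝ) ∈ closure (stCylinder T G) :=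
      (mem_closure_stCylinder hT).2 ⟨by simpa using ht, by simpa using hy⟩
    refine ⟨hmem, ?_⟩
    rw [hUx ⟨_, hmem⟩]
    exact eq_zero_of_mem_lateral hT hG h hu h0 ⟨_, hmem⟩ (by simpa using hyG)
  refine memL2H10_of_lipschitz hT hG.isOpen hG.isBounded hU
    (fun t ht y hy hyG => (hlat t ht y hy hyG).2) fun t ht => ?_
  have htI : t ∈ Set.Icc 0 T := ⟨ht.1.le, ht.2.le⟩
  funext y
  rw [asTimeSpace_apply]
  by_cases hyG : y ∈ G
  · have hmem : (Fin.cons t y : Fin (d + 1) → ℝ) ∈ closure (stCylinder T G) :=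
      (mem_closure_stCylinder hT).2 ⟨by simpa using htI, by simpa using subset_closure hyG⟩
    rw [Set.indicator_of_mem hyG, zeroExt_apply u hmem, ← hUx]
  · rw [Set.indicator_of_notMem hyG]
    by_cases hyc : y ∈ closure G
    · obtain ⟨hmem, hz⟩ := hlat t htI y hyc hyG
      rw [zeroExt_apply u hmem, ← hUx, hz]
    · refine zeroExt_of_notMem u fun hmem => hyc ?_
      simpa using ((mem_closure_stCylinder hT).1 hmem).2

/-- After normalization to the value one at `p`, the function exceeds `1 / 2` near `p`. Almost every
time slice near `p` lies in `H¹₀(G)`, which contradicts `IsH10.exists_lt_half`. -/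
theorem nodal_of_memL2H10 (hT : 0 < T) (hG : IsPolytopalDomain G)
    {u : closure (stCylinder T G) → ℝ} (hu : Continuous u)
    (hmem : asTimeSpace (closure (stCylinder T G)) u ∈ L2H10 T G)
    (p : closure (stCylinder T G)) (hp : Fin.tail (p : Fin (d + 1) → ℝ) ∉ G) : u p = 0 := by
  by_contra hne
  set v : closure (stCylinder T G) → ℝ := (u p)⁻¹ • u with hv
  have hvc : Continuous v := hu.const_smul _
  have hvmem : asTimeSpace (closure (stCylinder T G)) v ∈ L2H10 T G := by
    rw [hv, map_smul]
    exact (L2H10 T G).smul_mem _ hmem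
  have hvp : v p = 1 := by simp [hv, hne]
  obtain ⟨r, hr, hball⟩ := Metric.eventually_nhds_iff.1
    ((hvc.tendsto p).eventually (lt_mem_nhds (show (1 / 2 : ℝ) < v p by rw [hvp]; norm_num)))
  obtain ⟨-, g, -, hae⟩ := hvmem
  obtain ⟨hp0, hpG⟩ := (mem_closure_stCylinder hT).1 p.2
  obtain ⟨t, ht, htr, hH⟩ : ∃ t ∈ Set.Ioo 0 T, dist t ((p : Fin (d + 1) → ℝ) 0) < r ∧
      IsH10 G (asTimeSpace (closure (stCylinder T G)) v t) fun j => g j t := by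
    -- Even if `p` lies at time `0` or `T`, the admissible times form a nonempty open set, hence one
    -- of positive measure.
    have hopen : IsOpen (Set.Ioo 0 T ∩ Metric.ball ((p : Fin (d + 1) → ℝ) 0) r) :=
      isOpen_Ioo.inter Metric.isOpen_ball
    have hnon : (Set.Ioo 0 T ∩ Metric.ball ((p : Fin (d + 1) → ℝ) 0) r).Nonempty := by
      have : (p : Fin (d + 1) → ℝ) 0 ∈ closure (Set.Ioo 0 T) := by rwa [closure_Ioo hT.ne]
      obtain ⟨b, hb, hbd⟩ := Metric.mem_closure_iff.1 this r hr
      exact ⟨b, hb, by rwa [Metric.mem_ball, dist_comm]⟩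
    rw [ae_restrict_iff' measurableSet_Ioo] at hae
    obtain ⟨t, ht, hP⟩ := (hae.and_frequently
      (frequently_ae_iff.2 (hopen.measure_pos volume hnon).ne')).exists.imp
      fun t ht => And.intro ht.2 ht.1
    exact ⟨t, ht.1, ht.2, hP ht.1⟩
  obtain ⟨y, ⟨hyG, hyr⟩, hlt⟩ := hH.exists_lt_half hG.isOpen hpG
    (by rwa [hG.interior_closure]) hr
  have hmem' : (Fin.cons t y : Fin (d + 1) → ℝ) ∈ closure (stCylinder T G) :=
    subset_closure ⟨by simpa using ht, by simpa using hyG⟩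
  rw [asTimeSpace_apply, zeroExt_apply v hmem'] at hlt
  have hd : dist (⟨_, hmem'⟩ : closure (stCylinder T G)) p < r := by
    rw [Subtype.dist_eq, ← Fin.cons_self_tail (p : Fin (d + 1) → ℝ), dist_cons_cons]
    exact max_lt htr hyr
  exact absurd (hball hd) (not_lt.2 hlt.le)

end Cylinder

/-! ### The finite element space -/

section FiniteElement

variable {d : ℕ} {T : ℝ} {G : Set (Fin d → ℝ)} {𝒯 : Finset (Finset (Fin (d + 1) → ℝ))}

theorem mem_V4 {v : Fin (d + 1) → closure (stCylinder T G) → ℝ} :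
    v ∈ V4 T G 𝒯 ↔ (∀ k, v k ∈ S1 𝒯 (closure (stCylinder T G))) ∧
      asTimeSpace (closure (stCylinder T G)) (v 0) ∈ L2H10 T G := by
  simp only [V4, Submodule.mem_pi, Set.mem_univ, true_imp_iff]
  constructor
  · intro H
    have H0 := H 0
    rw [if_pos rfl] at H0
    refine ⟨fun k => ?_, H0.2⟩
    have := H k
    split_ifs at this with hk
    exacts [this.1, this]
  · rintro ⟨H1, H2⟩ k
    split_ifs with hk
    · subst hk
      exact ⟨H1 0, H2⟩
    · exact H1 k

theorem mem_idx {i : (Fin (d + 1) → ℝ) × Fin (d + 1)} :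
    i ∈ idx T G 𝒯 ↔ i.1 ∈ vertices 𝒯 ∧ (i.2 = 0 → i.1 0 ∈ Set.Icc 0 T ∧ Fin.tail i.1 ∈ G) := by
  simp [idx]

theorem zeroExt_eq_zero_of_notMem_idx (hT : 0 < T) (hG : IsPolytopalDomain G)
    (h : IsRegularTriangulation 𝒯 (stCylinder T G)) (v : V4 T G 𝒯) {p : Fin (d + 1) → ℝ}
    (hp : p ∈ vertices 𝒯) {k : Fin (d + 1)} (hi : (p, k) ∉ idx T G 𝒯) :
    zeroExt (v.1 k) p = 0 := by
  have hv := mem_V4.1 v.2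
  have hpc := h.mem_closure_of_mem_vertices hp
  rw [mem_idx] at hi
  have hk : k = 0 := by
    by_contra hk
    exact hi ⟨hp, fun h' => absurd h' hk⟩
  subst hk
  rw [zeroExt_apply _ hpc]
  refine nodal_of_memL2H10 hT hG (hv.1 0).1 hv.2 ⟨p, hpc⟩ fun hpG => hi ⟨hp, fun _ => ?_⟩
  exact ⟨((mem_closure_stCylinder hT).1 hpc).1, hpG⟩

theorem V4_eq_sum_idx (hT : 0 < T) (hG : IsPolytopalDomain G)
    (h : IsRegularTriangulation 𝒯 (stCylinder T G)) (v : V4 T G 𝒯) (k : Fin (d + 1))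
    (x : closure (stCylinder T G)) :
    v.1 k x = ∑ i : idx T G 𝒯,
      (if i.1.2 = k then zeroExt (v.1 k) i.1.1 else 0) * hat 𝒯 i.1.1 x := by
  have hv := mem_V4.1 v.2
  rw [h.eq_sum_hat (hv.1 k) x, Finset.sum_coe_sort (idx T G 𝒯) fun i =>
    (if i.2 = k then zeroExt (v.1 k) i.1 else 0) * hat 𝒯 i.1 x]
  have hsub : idx T G 𝒯 ⊆ vertices 𝒯 ×ˢ Finset.univ := fun i hi =>
    Finset.mem_product.2 ⟨(mem_idx.1 hi).1, Finset.mem_univ _⟩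
  rw [Finset.sum_subset hsub, Finset.sum_product]
  · refine Finset.sum_congr rfl fun p _ => ?_
    simp [ite_mul]
  · intro i hi hi'
    split_ifs with hk
    · subst hk
      rw [zeroExt_eq_zero_of_notMem_idx hT hG h v (Finset.mem_product.1 hi).1 hi', zero_mul]
    · rw [zero_mul]

theorem mem_vertices_of_idx (i : idx T G 𝒯) : i.1.1 ∈ vertices 𝒯 := (mem_idx.1 i.2).1

/-- The nodal values of a finite element function. -/
def nodalValues (h : IsRegularTriangulation 𝒯 (stCylinder T G)) :
    V4 T G 𝒯 →ₗ[ℝ] (idx T G 𝒯 → ℝ) where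
  toFun v i := v.1 i.1.2 ⟨i.1.1, h.mem_closure_of_mem_vertices (mem_vertices_of_idx i)⟩
  map_add' _ _ := rfl
  map_smul' _ _ := rfl

/-- Injectivity needs that the omitted nodal values of the first component vanish, which comes from
`nodal_of_memL2H10`. Surjectivity needs that this vanishing suffices for membership in `L²(I;
H¹₀(G))`, by `memL2H10_of_nodal`. -/
theorem nodalValues_bijective (hT : 0 < T) (hG : IsPolytopalDomain G)
    (h : IsRegularTriangulation 𝒯 (stCylinder T G)) : Function.Bijective (nodalValues h) := by
  classical
  constructor
  · rw [← LinearMap.ker_eq_bot, LinearMap.ker_eq_bot']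
    intro v hv
    ext k x
    rw [V4_eq_sum_idx hT hG h v k x]
    refine Finset.sum_eq_zero fun i _ => ?_
    split_ifs with hk
    · have := congrFun hv i
      subst hk
      rw [zeroExt_apply _ (h.mem_closure_of_mem_vertices (mem_vertices_of_idx i))]
      change v.1 i.1.2 _ = 0 at this
      rw [this, zero_mul]
    · rw [zero_mul]
  · intro c
    set b : Fin (d + 1) → (Fin (d + 1) → ℝ) → ℝ := fun k p =>
      if hi : (p, k) ∈ idx T G 𝒯 then c ⟨(p, k), hi⟩ else 0 with hb
    set v : Fin (d + 1) → closure (stCylinder T G) → ℝ := fun k x =>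
      ∑ p ∈ vertices 𝒯, b k p * hat 𝒯 p x with hv
    have hS : ∀ k, v k ∈ S1 𝒯 (closure (stCylinder T G)) := fun k => h.sum_hat_mem_S1 (b k)
    have hval : ∀ k, ∀ p (hp : p ∈ vertices 𝒯),
        v k ⟨p, h.mem_closure_of_mem_vertices hp⟩ = b k p := fun k p hp =>
      h.sum_hat_vertex (b k) hp
    have hmem : v ∈ V4 T G 𝒯 := by
      refine mem_V4.2 ⟨hS, memL2H10_of_nodal hT hG h (hS 0) fun p hp hpG => ?_⟩
      rw [zeroExt_apply _ (h.mem_closure_of_mem_vertices hp), hval 0 p hp]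
      simp only [hb]
      exact dif_neg fun hi => hpG ((mem_idx.1 hi).2 rfl).2
    refine ⟨⟨v, hmem⟩, ?_⟩
    funext i
    refine (hval i.1.2 i.1.1 (mem_vertices_of_idx i)).trans ?_
    simp only [hb]
    exact dif_pos i.2

theorem finrank_V4 (hT : 0 < T) (hG : IsPolytopalDomain G)
    (h : IsRegularTriangulation 𝒯 (stCylinder T G)) :
    Module.finrank ℝ (V4 T G 𝒯) = (idx T G 𝒯).card := by
  rw [(LinearEquiv.ofBijective _ (nodalValues_bijective hT hG h)).finrank_eq]
  simp

end FiniteElement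

/-! ### Emulation of finite element functions -/

/-- The widths of the hidden layers of the networks, as functions of `d` and the numbers of
simplices that share a node. -/
def feWidths (d : ℕ) (M : Multiset ℕ) : List ℕ :=
  treeWidths (Nat.clog 2 (d + 1 + 1)) (Multiset.replicate M.sum (d + 1 + 1)) ++
    (treeWidths (Nat.clog 2 M.sup) M ++ [M.card])

theorem clog_two_le_logb {m : ℕ} (hm : 1 ≤ m) : (Nat.clog 2 m : ℝ) ≤ Real.logb 2 m + 1 := by
  have h0 : 0 ≤ Real.logb 2 m := Real.logb_nonneg (by norm_num) (by exact_mod_cast hm)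
  have := Real.natCeil_logb_natCast 2 m
  rw [← this]
  exact_mod_cast (Nat.ceil_lt_add_one h0).le

/-- Only the terms with `L₁` produce `N ℓ`, with factor `3 + 12 = 15`. Everything else is absorbed
in `d² R` by `N ≤ R` and `d ≥ 1`; for `L₂` even a linear bound in `d` is enough. -/
theorem size_estimate {d N R L₁ L₂ ℓ : ℝ} (hd : 1 ≤ d) (hN : 0 ≤ N) (hNR : N ≤ R)
    (hL₁ : L₁ ≤ ℓ + 1) (hL₂ : L₂ ≤ d + 2) :
    (N + 4 * R + 4 * ((d + 1 + 1) * R)) * (d + 1 + 1) +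
      (N + 3 * L₁ * N + 12 * (R + L₁ * N) + 3 * L₂ * (N + 4 * R) +
        12 * ((d + 1 + 1) * R + L₂ * R)) ≤ 15 * N * ℓ + 200 * d ^ 2 * R := by
  have hR : 0 ≤ R := hN.trans hNR
  have hdR : R ≤ d * R := le_mul_of_one_le_left hR hd
  have hdR0 : 0 ≤ d * R := hR.trans hdR
  have hddR : d * R ≤ d ^ 2 * R := by
    rw [sq, mul_assoc]
    exact le_mul_of_one_le_left hdR0 hd
  have h1 : (N + 4 * R + 4 * ((d + 1 + 1) * R)) * (d + 1 + 1) ≤ (17 * (d * R)) * (3 * d) := by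
    apply mul_le_mul
    · linarith
    · linarith
    · linarith
    · linarith
  have h2 : L₁ * N ≤ (ℓ + 1) * N := mul_le_mul_of_nonneg_right hL₁ hN
  have h3 : L₂ * (N + 4 * R) ≤ (3 * d) * (5 * R) := by
    refine (mul_le_mul_of_nonneg_right hL₂ (by linarith)).trans ?_
    apply mul_le_mul <;> linarith
  have h4 : L₂ * R ≤ (3 * d) * R := mul_le_mul_of_nonneg_right (by linarith) hR
  nlinarith

section

variable {d : ℕ} {T : ℝ} {G : Set (Fin d → ℝ)} {𝒯 : Finset (Finset (Fin (d + 1) → ℝ))}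

theorem idx_nonempty (hd : 1 ≤ d) (hT : 0 < T) (hG : IsPolytopalDomain G)
    (h : IsRegularTriangulation 𝒯 (stCylinder T G)) : (idx T G 𝒯).Nonempty := by
  obtain ⟨y, hy⟩ := hG.isConnected.nonempty
  have hmem : (Fin.cons (T / 2) y : Fin (d + 1) → ℝ) ∈ closure (stCylinder T G) :=
    subset_closure ⟨by simp [hT], by simpa using hy⟩
  obtain ⟨σ, hσ, -⟩ := h.exists_mem hmem
  obtain ⟨p, hp⟩ : σ.Nonempty := Finset.card_pos.1 (by rw [h.card_eq σ hσ]; omega)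
  -- For `d ≥ 1` the last component is not the first, so no boundary condition excludes the vertex.
  refine ⟨(p, Fin.last d), mem_idx.2 ⟨mem_vertices.2 ⟨σ, hσ, hp⟩, fun h0 => ?_⟩⟩
  exact absurd (congrArg Fin.val h0) (by simp; omega)

theorem numSharing_le_maxSharing (i : idx T G 𝒯) : numSharing 𝒯 i.1.1 ≤ maxSharing T G 𝒯 :=
  Finset.le_sup (f := fun i : (Fin (d + 1) → ℝ) × Fin (d + 1) => numSharing 𝒯 i.1) i.2

theorem one_le_maxSharing (hd : 1 ≤ d) (hT : 0 < T) (hG : IsPolytopalDomain G)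
    (h : IsRegularTriangulation 𝒯 (stCylinder T G)) : 1 ≤ maxSharing T G 𝒯 := by
  obtain ⟨i, hi⟩ := idx_nonempty hd hT hG h
  exact (h.one_le_numSharing (mem_idx.1 hi).1).trans (numSharing_le_maxSharing ⟨i, hi⟩)

theorem card_idx_le_sumSharing (h : IsRegularTriangulation 𝒯 (stCylinder T G)) :
    (idx T G 𝒯).card ≤ sumSharing T G 𝒯 := by
  rw [Finset.card_eq_sum_ones]
  exact Finset.sum_le_sum fun i hi => h.one_le_numSharing (mem_idx.1 hi).1

theorem sumSharing_le : sumSharing T G 𝒯 ≤ (idx T G 𝒯).card * maxSharing T G 𝒯 := by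
  rw [← smul_eq_mul]
  exact Finset.sum_le_card_nsmul _ _ _ fun i hi => numSharing_le_maxSharing ⟨i, hi⟩

theorem sizeBound_le (hd : 1 ≤ d) (hT : 0 < T) (hG : IsPolytopalDomain G)
    (h : IsRegularTriangulation 𝒯 (stCylinder T G)) :
    sizeBound 200 T G 𝒯 ≤
      400 * (d : ℝ) ^ 2 * maxSharing T G 𝒯 * Module.finrank ℝ (V4 T G 𝒯) := by
  rw [finrank_V4 hT hG h, sizeBound]
  have hm : (1 : ℝ) ≤ maxSharing T G 𝒯 := by exact_mod_cast one_le_maxSharing hd hT hG h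
  have hs : (sumSharing T G 𝒯 : ℝ) ≤ (idx T G 𝒯).card * maxSharing T G 𝒯 := by
    exact_mod_cast sumSharing_le
  have hd' : (1 : ℝ) ≤ d := by exact_mod_cast hd
  have hd2 : (1 : ℝ) ≤ (d : ℝ) ^ 2 := one_le_pow₀ hd'
  have hN : (0 : ℝ) ≤ (idx T G 𝒯).card := Nat.cast_nonneg _
  have hlog : Real.logb 2 (maxSharing T G 𝒯) ≤ maxSharing T G 𝒯 := by
    rw [Real.logb_le_iff_le_rpow (by norm_num) (by linarith), Real.rpow_natCast]
    exact_mod_cast Nat.lt_two_pow_self.le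
  have h1 : ((idx T G 𝒯).card : ℝ) * Real.logb 2 (maxSharing T G 𝒯) ≤
      (d : ℝ) ^ 2 * ((idx T G 𝒯).card * maxSharing T G 𝒯) :=
    (mul_le_mul_of_nonneg_left hlog hN).trans
      (le_mul_of_one_le_left (mul_nonneg hN (by linarith)) hd2)
  have h2 : (d : ℝ) ^ 2 * sumSharing T G 𝒯 ≤
      (d : ℝ) ^ 2 * ((idx T G 𝒯).card * maxSharing T G 𝒯) :=
    mul_le_mul_of_nonneg_left hs (by linarith)
  linarith

/-- Each index feeds exactly one output, so the output layer has at most `|ℐ|` weights whatever the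
coefficients are. -/
theorem ncard_ite_ne_zero_le {k : ℕ} (f : idx T G 𝒯 → Fin k) (c : Fin k → idx T G 𝒯 → ℝ) :
    {p : Fin k × idx T G 𝒯 | Matrix.of (fun j i => if f i = j then c j i else 0) p.1 p.2 ≠ 0}.ncard
      ≤ (idx T G 𝒯).card := by
  have hsub : {p : Fin k × idx T G 𝒯 |
      Matrix.of (fun j i => if f i = j then c j i else 0) p.1 p.2 ≠ 0} ⊆
      Set.image (fun i => (f i, i)) Set.univ := by
    rintro ⟨j, i⟩ hp
    by_contra hc
    exact hp (if_neg fun hij => hc ⟨i, Set.mem_univ i, Prod.ext hij rfl⟩)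
  refine (Set.ncard_le_ncard hsub (Set.toFinite _)).trans
    ((Set.ncard_image_le Set.finite_univ).trans ?_)
  rw [Set.ncard_univ, Nat.card_eq_fintype_card, Fintype.card_coe]

/-- Linear combinations of the shape functions are emulated by networks with an architecture that
depends only on `d` and the family `{s(i)}`. -/
theorem exists_fe_network (hd : 1 ≤ d) (hT : 0 < T) (hG : IsPolytopalDomain G)
    (h : IsRegularTriangulation 𝒯 (stCylinder T G)) {k : ℕ} (B : Matrix (Fin k) (idx T G 𝒯) ℝ)
    (hB : {p : Fin k × idx T G 𝒯 | B p.1 p.2 ≠ 0}.ncard ≤ (idx T G 𝒯).card) :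
    ∃ Φ : NN (d + 1) k, Φ.IsReLU ∧
      (∀ x ∈ stCylinder T G, Φ.realize x = B.mulVec fun i => hat 𝒯 i.1.1 x) ∧
      (Φ.depth : ℝ) ≤ depthBound T G 𝒯 ∧ (Φ.size : ℝ) ≤ sizeBound 200 T G 𝒯 ∧
      Φ.architecture = reluArchitecture (feWidths d (sharingData T G 𝒯)) k := by
  have hm := one_le_maxSharing hd hT hG h
  have hdata : (Finset.univ.val.map fun i : idx T G 𝒯 => numSharing 𝒯 i.1.1) =
      sharingData T G 𝒯 :=
    Multiset.attach_map_val' _ fun i : (Fin (d + 1) → ℝ) × Fin (d + 1) => numSharing 𝒯 i.1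
  have hsup : (sharingData T G 𝒯).sup = maxSharing T G 𝒯 := rfl
  have hsum : (sharingData T G 𝒯).sum = sumSharing T G 𝒯 := rfl
  have hcard : (sharingData T G 𝒯).card = (idx T G 𝒯).card := by simp [sharingData]
  obtain ⟨Φ, h1, h2, h3, h4⟩ := h.exists_network (fun i : idx T G 𝒯 => i.1.1)
    mem_vertices_of_idx B (L₁ := Nat.clog 2 (maxSharing T G 𝒯)) (L₂ := Nat.clog 2 (d + 1 + 1))
    (fun i => (numSharing_le_maxSharing i).trans (Nat.le_pow_clog (by norm_num) _))
    (Nat.le_pow_clog (by norm_num) _) (Fintype.card_coe _)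
    (show ∑ i : idx T G 𝒯, numSharing 𝒯 i.1.1 = sumSharing T G 𝒯 from
      Finset.sum_coe_sort (idx T G 𝒯) fun i => numSharing 𝒯 i.1) hB
  have harch : Φ.architecture = reluArchitecture (feWidths d (sharingData T G 𝒯)) k := by
    rw [h3, feWidths, hsup, hsum, hcard, hdata]
  have hL₁ := clog_two_le_logb hm
  refine ⟨Φ, h1, fun x hx => h2 x (subset_closure hx), ?_, ?_, harch⟩
  -- The depth is `L₁ + L₂ + 2`. The two roundings and the passage from `d + 2` to `d + 1` add at
  -- most one each, so the constant `5` would suffice.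
  · rw [NN.depth_eq_length_architecture, harch, depthBound]
    simp only [reluArchitecture, feWidths, List.length_append, List.length_map,
      length_treeWidths, List.length_singleton, hsup]
    have hL₂ := clog_two_le_logb (m := d + 1 + 1) (by omega)
    have hlog : Real.logb 2 ((d + 1 + 1 : ℕ) : ℝ) ≤ Real.logb 2 ((d : ℝ) + 1) + 1 := by
      have hd0 : (0 : ℝ) ≤ d := Nat.cast_nonneg d
      have e : Real.logb 2 ((d : ℝ) + 1) + 1 = Real.logb 2 (((d : ℝ) + 1) * 2) := by
        rw [Real.logb_mul (by positivity) (by norm_num), Real.logb_self_eq_one (by norm_num)]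
      rw [e]
      refine Real.logb_le_logb_of_le (by norm_num) (by positivity) ?_
      push_cast
      linarith
    push_cast at hL₂ hlog ⊢
    linarith
  · have h4' : (Φ.size : ℝ) ≤ _ := Nat.cast_le.2 h4
    refine h4'.trans ?_
    push_cast
    have hℓ : 0 ≤ Real.logb 2 (maxSharing T G 𝒯) :=
      Real.logb_nonneg (by norm_num) (by exact_mod_cast hm)
    have hL₂ : ((Nat.clog 2 (d + 1 + 1) : ℕ) : ℝ) ≤ (d : ℝ) + 2 := by
      have : Nat.clog 2 (d + 1 + 1) ≤ d + 1 + 1 := Nat.clog_le_of_le_pow Nat.lt_two_pow_self.le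
      have h' : ((Nat.clog 2 (d + 1 + 1) : ℕ) : ℝ) ≤ ((d + 1 + 1 : ℕ) : ℝ) := Nat.cast_le.2 this
      push_cast at h'
      linarith
    have hN : (0 : ℝ) ≤ (idx T G 𝒯).card := Nat.cast_nonneg _
    have hNR : ((idx T G 𝒯).card : ℝ) ≤ sumSharing T G 𝒯 := by
      exact_mod_cast card_idx_le_sumSharing h
    refine (size_estimate (R := (sumSharing T G 𝒯 : ℝ)) (by exact_mod_cast hd) hN hNR hL₁
      hL₂).trans ?_
    rw [sizeBound]
    have := mul_nonneg hN hℓ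
    linarith

end

/-- The linear structure of a module carried over to the range of an injective map. -/
theorem exists_module_range {V α : Type*} [AddCommGroup V] [Module ℝ V] (Φ : V → α)
    (hΦ : Function.Injective Φ) :
    ∃ (_ : AddCommGroup (Set.range Φ)) (_ : Module ℝ (Set.range Φ)),
      (∀ (v w : V) (c : ℝ), (⟨Φ v, v, rfl⟩ : Set.range Φ) + c • (⟨Φ w, w, rfl⟩ : Set.range Φ) =
        ⟨Φ (v + c • w), v + c • w, rfl⟩) ∧
      ∃ R : Set.range Φ ≃ₗ[ℝ] V, ∀ Ψ, Φ (R Ψ) = Ψ.1 := by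
  let e : Set.range Φ ≃ V := (Equiv.ofInjective Φ hΦ).symm
  let _ := e.addCommGroup
  let _ := e.module ℝ
  have he : ∀ v, e ⟨Φ v, v, rfl⟩ = v := fun v => Equiv.ofInjective_symm_apply hΦ v
  refine ⟨inferInstance, inferInstance, fun v w c => ?_, e.linearEquiv ℝ, fun Ψ => ?_⟩
  · apply (e.linearEquiv ℝ).injective
    rw [map_add, map_smul]
    simp only [Equiv.linearEquiv_apply, he]
  · obtain ⟨v, hv⟩ := Ψ.2
    obtain rfl : Ψ = ⟨Φ v, v, rfl⟩ := Subtype.ext hv.symm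
    rw [Equiv.linearEquiv_apply, he]

end FoSLS

end

/-! ### The theorem -/

open FoSLS
theorem proposition4p7 :
    ∃ C : ℝ, 0 < C ∧ ∃ C' : ℝ, 0 < C' ∧
    -- layer dimensions and activation lists of `Φ` and `Φ^v`, functions of `d` and `{s(i)}` only
    ∃ archBasis archFE : ℕ → Multiset ℕ → List (List (ℝ → ℝ)),
    ∀ (d : ℕ) (_ : 1 ≤ d) (T : ℝ) (_ : 0 < T) (G : Set (Fin d → ℝ)) (_ : IsPolytopalDomain G)
      (𝒯 : Finset (Finset (Fin (d + 1) → ℝ)))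
      (_ : IsRegularTriangulation 𝒯 (stCylinder T G)),
      -- `|ℐ| = dim`, and the second inequality in the bound of the size
      Module.finrank ℝ (V4 T G 𝒯) = (idx T G 𝒯).card ∧
      sizeBound C T G 𝒯 ≤
        C' * (d : ℝ) ^ 2 * maxSharing T G 𝒯 * Module.finrank ℝ (V4 T G 𝒯) ∧
      -- emulation of the shape functions
      (∃ (e : idx T G 𝒯 ≃ Fin (idx T G 𝒯).card) (Φ : NN (d + 1) (idx T G 𝒯).card),
        Φ.IsReLU ∧
        (∀ x ∈ stCylinder T G, ∀ i : idx T G 𝒯, Φ.realize x (e i) = hat 𝒯 i.1.1 x) ∧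
        (Φ.depth : ℝ) ≤ depthBound T G 𝒯 ∧
        (Φ.size : ℝ) ≤ sizeBound C T G 𝒯 ∧
        Φ.architecture = archBasis d (sharingData T G 𝒯)) ∧
      -- emulation of the finite element functions
      ∃ Φ : V4 T G 𝒯 → NN (d + 1) (d + 1),
        (∀ v : V4 T G 𝒯,
          (Φ v).IsReLU ∧
          (∀ (x : Fin (d + 1) → ℝ) (hx : x ∈ stCylinder T G) (k : Fin (d + 1)),
            (Φ v).realize x k = v.1 k ⟨x, subset_closure hx⟩) ∧
          ((Φ v).depth : ℝ) ≤ depthBound T G 𝒯 ∧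
          ((Φ v).size : ℝ) ≤ sizeBound C T G 𝒯 ∧
          (Φ v).architecture = archFE d (sharingData T G 𝒯)) ∧
        -- the networks form a vector space, and realization is a linear bijection onto `V4`
        ∃ (_ : AddCommGroup (Set.range Φ)) (_ : Module ℝ (Set.range Φ)),
          (∀ (v w : V4 T G 𝒯) (c : ℝ),
            (⟨Φ v, v, rfl⟩ : Set.range Φ) + c • (⟨Φ w, w, rfl⟩ : Set.range Φ) =
              ⟨Φ (v + c • w), v + c • w, rfl⟩) ∧
          ∃ R : Set.range Φ ≃ₗ[ℝ] V4 T G 𝒯,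
            ∀ (Ψ : Set.range Φ) (x : Fin (d + 1) → ℝ) (hx : x ∈ stCylinder T G)
              (k : Fin (d + 1)),
              (R Ψ).1 k ⟨x, subset_closure hx⟩ = Ψ.1.realize x k := by
  refine ⟨200, by norm_num, 400, by norm_num,
    fun d M => reluArchitecture (feWidths d M) M.card,
    fun d M => reluArchitecture (feWidths d M) (d + 1), ?_⟩
  intro d hd T hT G hG 𝒯 h
  classical
  refine ⟨finrank_V4 hT hG h, sizeBound_le hd hT hG h, ?_, ?_⟩
  · set e : idx T G 𝒯 ≃ Fin (idx T G 𝒯).card := (idx T G 𝒯).equivFin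
    obtain ⟨Φ, h1, h2, h3, h4, h5⟩ := exists_fe_network hd hT hG h
      (Matrix.of fun (j : Fin (idx T G 𝒯).card) i => if e i = j then (1 : ℝ) else 0)
      (ncard_ite_ne_zero_le e fun _ _ => 1)
    refine ⟨e, Φ, h1, fun x hx i => ?_, h3, h4, ?_⟩
    · rw [h2 x hx]
      simp [Matrix.mulVec, dotProduct]
    · rw [h5]
      simp [sharingData]
  · choose Φ h1 h2 h3 h4 h5 using fun v : V4 T G 𝒯 => exists_fe_network hd hT hG h
      (Matrix.of fun (k : Fin (d + 1)) i =>
        if i.1.2 = k then zeroExt (v.1 k) i.1.1 else (0 : ℝ))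
      (ncard_ite_ne_zero_le (fun i => i.1.2) fun k i => zeroExt (v.1 k) i.1.1)
    have hreal : ∀ (v : V4 T G 𝒯) (x : Fin (d + 1) → ℝ) (hx : x ∈ stCylinder T G)
        (k : Fin (d + 1)), (Φ v).realize x k = v.1 k ⟨x, subset_closure hx⟩ := by
      intro v x hx k
      rw [h2 v x hx, V4_eq_sum_idx hT hG h v k]
      rfl
    -- Equal networks have equal realizations, so the two functions agree on the cylinder and, by
    -- continuity, on its closure.
    have hinj : Function.Injective Φ := by
      intro v w hvw
      have hcomp : ∀ k, v.1 k = w.1 k := by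
        intro k
        have hvc : Continuous (v.1 k) := ((mem_V4.1 v.2).1 k).1
        have hwc : Continuous (w.1 k) := ((mem_V4.1 w.2).1 k).1
        refine Continuous.ext_on (s := Set.preimage Subtype.val (stCylinder T G)) ?_ hvc hwc ?_
        · intro x
          rw [closure_subtype]
          refine closure_mono ?_ x.2
          exact fun y hy => ⟨⟨y, subset_closure hy⟩, hy, rfl⟩
        · intro x hx
          have := hreal v x hx k
          rw [hvw, hreal w x hx k] at this
          exact this.symm
      exact Subtype.ext (funext hcomp)
    obtain ⟨i1, i2, hadd, R, hR⟩ := exists_module_range Φ hinj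
    refine ⟨Φ, fun v => ⟨h1 v, hreal v, h3 v, h4 v, h5 v⟩, i1, i2, hadd, R, fun Ψ x hx k => ?_⟩
    rw [← hR Ψ, hreal _ x hx]
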